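/- Let $\Gamma$ be an acyclic quiver with finitely many vertices (every closed path has length $0$), let $\mathbb{Z}\Gamma$ be its path algebra over $\mathbb{Z}$ (the product $pq$ of paths is "first $p$, then $q$"), and let $\mathcal{B}$ be the quotient of $\mathbb{Z}\Gamma$ by the two-sided ideal generated by a set of linear combinations of paths of length $\geq 1$. For a vertex $v$ let $I_v\in\mathcal{B}$ be the idempotent given by the path of length $0$ at $v$. Suppose that $\mathcal{B}$ is a bigraded differential graded algebra, graded by $\mathbb{Z}\times\tfrac12\mathbb{Z}$ (homological and quantum degree), with a differential $d$ of bidegree $(1,0)$ satisfying $d(ab)=d(a)b+(-1)^{i}a\,d(b)$ for $a$ of homological degree $i$, such that every $I_v$ has bidegree $(0,0)$ and $d(I_v)=0$. (The algebras $\mathcal{B}\Gamma_n$, where the vertices of $\Gamma_n$ are the equivalence classes of decorated cleaved links, are of this form.) For bigraded right differential $\mathcal{B}$-modules $M$, $N$ with $(1,0)$ differential let $\mathrm{HOM}(M,N)$ be the complex whose degree-$n$ term consists of the $\mathcal{B}$-linear maps of bidegree $(n,0)$, with differential $f\mapsto d f-(-1)^n f d$. Let $\mathcal{K}(\mathcal{B})$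 be the homotopy category, with morphism groups $H^0\,\mathrm{HOM}(M,N)$, and let $M\{(m,n)\}_{i,j}=M_{i-m,j-n}$. The distinguished triangles of $\mathcal{K}(\mathcal{B})$ are the diagrams isomorphic in $\mathcal{K}(\mathcal{B})$ to $M\xrightarrow{u}N\to C(u)\to M\{(-1,0)\}$, where $C(u)=N\oplus M\{(-1,0)\}$ is the mapping cone of a morphism $u$. Call $P$ projective if $\mathrm{HOM}(P,M)$ has trivial homology whenever $M$ has, and compact if $\bigoplus_i\mathrm{Hom}_{\mathcal{K}(\mathcal{B})}(P,N_i)\to\mathrm{Hom}_{\mathcal{K}(\mathcal{B})}(P,\bigoplus_i N_i)$ is an isomorphism for every family $(N_i)$. Let $K_0(\mathcal{B})$ be the abelian group generated by the classes $[P]$ of the compact projective modules $P$, subject to $[P_2]=[P_1]+[P_3]$ for every distinguished triangle $P_1\to P_2\to P_3\to P_1\{(-1,0)\}$. It is a $\mathbb{Z}[q^{1/2},q^{-1/2}]$-module through $q^{j}[P]=[P\{(0,j)\}]$ for $j\in\tfrac12\mathbb{Z}$. Then $K_0(\mathcal{B})$ is isomorphic, as a $\mathbb{Z}[q^{1/2},q^{-1/2}]$-module,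 to the free $\mathbb{Z}[q^{1/2},q^{-1/2}]$-module spanned by the idempotents $I_v$, one for each vertex $v$ of $\Gamma$. More precisely, there is an isomorphism from this free module to $K_0(\mathcal{B})$ that sends each $I_v$ to the class $[I_v\mathcal{B}]$, and the modules $I_v\mathcal{B}$ are compact and projective. -/

import Mathlib

open scoped DirectSum LaurentPolynomial

universe u

noncomputable section

namespace BigradedDG

/-! ### Path algebras of quivers and their quotients -/

/-- The path algebra `ℤV` of a quiver `V`: the free abelian group on all paths of `V`, including
the path of length zero at each vertex. -/
def PathAlgebra (V : Type u) [Quiver.{u} V] : Type u :=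
  (Σ v w : V, Quiver.Path v w) →₀ ℤ

namespace PathAlgebra

variable {V : Type u} [Quiver.{u} V]

instance : AddCommGroup (PathAlgebra V) :=
  inferInstanceAs (AddCommGroup ((Σ v w : V, Quiver.Path v w) →₀ ℤ))

/-- The basis element of the path algebra given by a path. -/
def ofPath {v w : V} (p : Quiver.Path v w) : PathAlgebra V :=
  Finsupp.single (⟨v, w, p⟩ : Σ v w : V, Quiver.Path v w) (1 : ℤ)

open Classical in
/-- The product of two paths: first `p`, then `q`, and zero if `q` does not start where `p` ends. -/
def pathMul (p q : Σ v w : V, Quiver.Path v w) : PathAlgebra V :=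
  if h : p.2.1 = q.1 then ofPath (p.2.2.comp (q.2.2.cast h.symm rfl)) else 0

/-- The product of the path algebra, the bilinear extension of the product of paths. -/
def mulHom : PathAlgebra V →ₗ[ℤ] PathAlgebra V →ₗ[ℤ] PathAlgebra V :=
  Finsupp.linearCombination ℤ (fun p => Finsupp.linearCombination ℤ (fun q => pathMul p q))

theorem mulHom_ofPath {v w v' w' : V} (p : Quiver.Path v w) (q : Quiver.Path v' w') :
    mulHom (ofPath p) (ofPath q) = pathMul ⟨v, w, p⟩ ⟨v', w', q⟩ := by
  simp only [mulHom, ofPath]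
  erw [Finsupp.linearCombination_single, one_smul, Finsupp.linearCombination_single, one_smul]

theorem mulHom_comp {v w w' : V} (p : Quiver.Path v w) (q : Quiver.Path w w') :
    mulHom (ofPath p) (ofPath q) = ofPath (p.comp q) := by
  rw [mulHom_ofPath, pathMul]; simp

theorem mulHom_ne {v w v' w' : V} (p : Quiver.Path v w) (q : Quiver.Path v' w') (h : w ≠ v') :
    mulHom (ofPath p) (ofPath q) = 0 := by
  rw [mulHom_ofPath, pathMul]; simp [h]

/-- Additive induction over the basis of paths. -/
theorem induction_path {motive : PathAlgebra V → Prop} (x : PathAlgebra V)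
    (h0 : motive 0) (hadd : ∀ x y, motive x → motive y → motive (x + y))
    (hneg : ∀ x, motive x → motive (-x))
    (hp : ∀ (v w : V) (p : Quiver.Path v w), motive (ofPath p)) : motive x := by
  let S : AddSubgroup (PathAlgebra V) :=
    { carrier := {x | motive x}
      zero_mem' := h0
      add_mem' := fun {a b} ha hb => hadd a b ha hb
      neg_mem' := fun {a} ha => hneg a ha }
  change x ∈ S
  refine Finsupp.induction_linear (motive := fun x : PathAlgebra V => x ∈ S) x S.zero_mem
    (fun a b ha hb => S.add_mem ha hb) ?_
  rintro ⟨v, w, p⟩ n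
  have h1 : (Finsupp.single (⟨v, w, p⟩ : Σ v w : V, Quiver.Path v w) n : PathAlgebra V)
      = n • ofPath p := by
    change _ = n • (Finsupp.single _ _ : _ →₀ ℤ)
    rw [Finsupp.smul_single, smul_eq_mul, mul_one]
  rw [h1]
  exact S.zsmul_mem (hp v w p) n

theorem mulHom_assoc (x y z : PathAlgebra V) :
    mulHom (mulHom x y) z = mulHom x (mulHom y z) := by
  induction x using induction_path with
  | h0 => simp
  | hadd a b ha hb => simp [ha, hb]
  | hneg a ha => simp [ha]
  | hp v w p =>
  induction y using induction_path with
  | h0 => simp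
  | hadd a b ha hb => simp [ha, hb]
  | hneg a ha => simp [ha]
  | hp v' w' q =>
  induction z using induction_path with
  | h0 => simp
  | hadd a b ha hb => simp [ha, hb]
  | hneg a ha => simp [ha]
  | hp v'' w'' r =>
  by_cases h : w = v'
  · subst h
    by_cases h' : w' = v''
    · subst h'
      rw [mulHom_comp, mulHom_comp, mulHom_comp, mulHom_comp, Quiver.Path.comp_assoc]
    · rw [mulHom_comp, mulHom_ne _ _ h', mulHom_ne _ _ h', map_zero]
  · rw [mulHom_ne _ _ h, map_zero, LinearMap.zero_apply]
    by_cases h' : w' = v''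
    · subst h'
      rw [mulHom_comp, mulHom_ne _ _ h]
    · rw [mulHom_ne _ _ h', map_zero]

variable [Fintype V]

theorem mulHom_one_left (x : PathAlgebra V) :
    mulHom (∑ v : V, ofPath (Quiver.Path.nil : Quiver.Path v v)) x = x := by
  classical
  induction x using induction_path with
  | h0 => simp
  | hadd a b ha hb => rw [map_add, ha, hb]
  | hneg a ha => rw [map_neg, ha]
  | hp v w p =>
  rw [map_sum, LinearMap.sum_apply, Finset.sum_eq_single v]
  · rw [mulHom_comp, Quiver.Path.nil_comp]
  · intro b _ hb
    exact mulHom_ne _ _ hb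
  · simp

theorem mulHom_one_right (x : PathAlgebra V) :
    mulHom x (∑ v : V, ofPath (Quiver.Path.nil : Quiver.Path v v)) = x := by
  classical
  induction x using induction_path with
  | h0 => simp
  | hadd a b ha hb => rw [map_add, LinearMap.add_apply, ha, hb]
  | hneg a ha => rw [map_neg, LinearMap.neg_apply, ha]
  | hp v w p =>
  rw [map_sum, Finset.sum_eq_single w]
  · rw [mulHom_comp, Quiver.Path.comp_nil]
  · intro b _ hb
    exact mulHom_ne _ _ hb.symm
  · simp

/-- The path algebra of a quiver with finitely many vertices is a ring; its unit is the sum of the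
paths of length zero. -/
instance : Ring (PathAlgebra V) :=
  { (inferInstance : AddCommGroup (PathAlgebra V)) with
    mul := fun x y => mulHom x y
    one := ∑ v : V, ofPath (Quiver.Path.nil : Quiver.Path v v)
    left_distrib := fun x y z => map_add (mulHom x) y z
    right_distrib := fun x y z => by
      change mulHom (x + y) z = mulHom x z + mulHom y z
      rw [map_add, LinearMap.add_apply]
    zero_mul := fun x => by
      change mulHom 0 x = 0
      rw [map_zero, LinearMap.zero_apply]
    mul_zero := fun x => map_zero (mulHom x)
    mul_assoc := mulHom_assoc
    one_mul := mulHom_one_left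
    mul_one := mulHom_one_right }

end PathAlgebra

/-- The elements of the path algebra that involve only paths of length at least one. -/
def positivePaths (V : Type u) [Quiver.{u} V] : AddSubgroup (PathAlgebra V) :=
  AddSubgroup.closure {x | ∃ (v w : V) (p : Quiver.Path v w), 1 ≤ p.length ∧
    x = PathAlgebra.ofPath p}

/-- The quiver algebra with relations: the quotient of the path algebra by the two-sided ideal
generated by a set `rel` of elements. -/
abbrev QuiverAlgebra {V : Type u} [Quiver.{u} V] [Fintype V] (rel : Set (PathAlgebra V)) :
    Type u :=
  (TwoSidedIdeal.span rel).ringCon.Quotient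

/-- The image in the quiver algebra with relations of the path of length zero at `v`. -/
def vertexIdempotent {V : Type u} [Quiver.{u} V] [Fintype V] (rel : Set (PathAlgebra V)) (v : V) :
    QuiverAlgebra rel :=
  (TwoSidedIdeal.span rel).ringCon.mk' (PathAlgebra.ofPath (Quiver.Path.nil : Quiver.Path v v))

theorem vertexIdempotent_mul_self {V : Type u} [Quiver.{u} V] [Fintype V]
    (rel : Set (PathAlgebra V)) (v : V) :
    vertexIdempotent rel v * vertexIdempotent rel v = vertexIdempotent rel v := by
  rw [vertexIdempotent, ← map_mul]
  congr 1
  exact PathAlgebra.mulHom_comp _ _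

/-! ### Gradings -/

theorem map_coe_eq_zero {ι : Type*} [DecidableEq ι] {M N : Type*} [AddCommGroup M]
    [AddCommGroup N] (deg : ι → AddSubgroup M) (deg' : ι → AddSubgroup N)
    (hN : Function.Injective (DirectSum.coeAddMonoidHom deg'))
    (p : M →+ N) (hp : ∀ i x, x ∈ deg i → p x ∈ deg' i)
    (x : ⨁ i, deg i) (hx : DirectSum.coeAddMonoidHom deg x = 0) (i : ι) : p (x i) = 0 := by
  let r : ∀ i, deg i →+ deg' i := fun i =>
    (p.comp (deg i).subtype).codRestrict (deg' i) (fun x => hp i x x.2)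
  have key : (DirectSum.coeAddMonoidHom deg').comp (DirectSum.map r)
      = p.comp (DirectSum.coeAddMonoidHom deg) := by
    ext i y
    simp only [AddMonoidHom.comp_apply, DirectSum.map_of, DirectSum.coeAddMonoidHom_of]
    rfl
  have h1 : DirectSum.map r x = 0 := by
    apply hN
    have := DFunLike.congr_fun key x
    simp only [AddMonoidHom.comp_apply, hx, map_zero] at this
    rw [this, map_zero]
  have h2 : (DirectSum.map r x) i = 0 := by rw [h1]; rfl
  rw [DirectSum.map_apply] at h2
  exact congrArg Subtype.val h2

theorem map_mem_range_coe {ι κ : Type*} [DecidableEq ι] [DecidableEq κ]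
    {M N : Type*} [AddCommGroup M] [AddCommGroup N]
    (deg : ι → AddSubgroup M) (deg' : κ → AddSubgroup N) (e : κ → ι)
    (hN : Function.Surjective (DirectSum.coeAddMonoidHom deg'))
    (s : N →+ M) (hs : ∀ i x, x ∈ deg' i → s x ∈ deg (e i)) (y : N) :
    s y ∈ (DirectSum.coeAddMonoidHom deg).range := by
  obtain ⟨z, rfl⟩ := hN y
  induction z using DirectSum.induction_on with
  | zero => simp
  | of i z =>
    refine ⟨DirectSum.of (fun i => deg i) (e i) ⟨s z, hs i z z.2⟩, ?_⟩
    simp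
  | add a b ha hb =>
    rw [map_add, map_add]
    exact AddSubgroup.add_mem _ ha hb

theorem isInternal_prod {M N : Type*} [AddCommGroup M] [AddCommGroup N]
    {deg : ℤ × ℤ → AddSubgroup M} {deg' : ℤ × ℤ → AddSubgroup N}
    (h : DirectSum.IsInternal deg) (h' : DirectSum.IsInternal deg') :
    DirectSum.IsInternal (fun g => (deg g).prod (deg' g)) := by
  constructor
  · rw [injective_iff_map_eq_zero]
    intro x hx
    refine DFinsupp.ext fun i => Subtype.ext (Prod.ext ?_ ?_)
    · exact map_coe_eq_zero (fun g => (deg g).prod (deg' g)) deg h.1 (AddMonoidHom.fst M N)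
        (fun _ _ hx => (AddSubgroup.mem_prod.1 hx).1) x hx i
    · exact map_coe_eq_zero (fun g => (deg g).prod (deg' g)) deg' h'.1 (AddMonoidHom.snd M N)
        (fun _ _ hx => (AddSubgroup.mem_prod.1 hx).2) x hx i
  · rintro ⟨m, n⟩
    have h1 := map_mem_range_coe (fun g => (deg g).prod (deg' g)) deg id h.2
      (AddMonoidHom.inl M N) (fun i x hx => ⟨hx, (deg' i).zero_mem⟩) m
    have h2 := map_mem_range_coe (fun g => (deg g).prod (deg' g)) deg' id h'.2
      (AddMonoidHom.inr M N) (fun i x hx => ⟨(deg i).zero_mem, hx⟩) n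
    have h3 := AddSubgroup.add_mem _ h1 h2
    simpa using h3

open Classical in
theorem isInternal_directSum {I : Type*} {M : I → Type*} [∀ i, AddCommGroup (M i)]
    {deg : ∀ i, ℤ × ℤ → AddSubgroup (M i)} (h : ∀ i, DirectSum.IsInternal (deg i))
    {deg' : ℤ × ℤ → AddSubgroup (⨁ i, M i)} (hdeg : ∀ g x, x ∈ deg' g ↔ ∀ i, x i ∈ deg i g) :
    DirectSum.IsInternal deg' := by
  constructor
  · rw [injective_iff_map_eq_zero]
    intro x hx
    ext g i
    exact map_coe_eq_zero _ (deg i) (h i).1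
      (DFinsupp.evalAddMonoidHom i : (⨁ i, M i) →+ M i)
      (fun _ _ hx => (hdeg _ _).1 hx i) x hx g
  · intro x
    change x ∈ (DirectSum.coeAddMonoidHom deg').range
    induction x using DirectSum.induction_on with
    | zero => exact AddSubgroup.zero_mem _
    | of i m =>
      refine map_mem_range_coe deg' (deg i) id (h i).2 (DirectSum.of M i) ?_ m
      intro g m hm
      rw [id, hdeg]
      intro j
      by_cases hj : i = j
      · subst hj
        rwa [DirectSum.of_eq_same]
      · rw [DirectSum.of_eq_of_ne _ _ _ (Ne.symm hj)]
        exact AddSubgroup.zero_mem _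
    | add a b ha hb => exact AddSubgroup.add_mem _ ha hb

theorem isInternal_sub {M : Type*} [AddCommGroup M] {deg : ℤ × ℤ → AddSubgroup M}
    (h : DirectSum.IsInternal deg) (s : ℤ × ℤ) :
    DirectSum.IsInternal (fun g => deg (g - s)) := by
  constructor
  · have h1 := h.addSubgroup_iSupIndep
    have h2 : iSupIndep (fun g => deg (g - s)) := h1.comp (fun a b hab => sub_left_injective hab)
    exact h2.dfinsuppSumAddHom_injective
  · intro x
    refine map_mem_range_coe (fun g => deg (g - s)) deg (fun g => g + s) h.2
      (AddMonoidHom.id M) ?_ x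
    intro i x hx
    simpa using hx

/-! ### Bigraded differential graded algebras and their right modules

All bidegrees are pairs `(i, k) : ℤ × ℤ`, where `i` is the homological degree and `k` is **twice**
the quantum degree, so that the quantum grading is by half-integers. A differential of bidegree
`(1, 0)` raises `i` by one and keeps `k`. -/

/-- A bigraded differential graded algebra with a `(1,0)` differential, on the ring `A`. -/
structure DGAlg (A : Type u) [Ring A] where
  /-- The homogeneous elements of each bidegree. -/
  deg : ℤ × ℤ → AddSubgroup A
  isInternal : DirectSum.IsInternal deg
  one_mem : (1 : A) ∈ deg 0
  mul_mem : ∀ {g h : ℤ × ℤ} {a b : A}, a ∈ deg g → b ∈ deg h → a * b ∈ deg (g + h)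
  /-- The differential. -/
  d : A →+ A
  d_mem : ∀ {g : ℤ × ℤ} {a : A}, a ∈ deg g → d a ∈ deg (g + (1, 0))
  d_d : ∀ a : A, d (d a) = 0
  leibniz : ∀ {g : ℤ × ℤ} {a : A}, a ∈ deg g → ∀ b : A,
    d (a * b) = d a * b + g.1.negOnePow • (a * d b)

/-- The structure of a bigraded differential right module over `𝒜`, with a `(1,0)` differential,
on the right `A`-module `M` (in Mathlib: a module over `Aᵐᵒᵖ`, with `m · a = op a • m`). -/
@[ext]
structure DGStr {A : Type u} [Ring A] (𝒜 : DGAlg A) (M : Type u) [AddCommGroup M]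
    [Module Aᵐᵒᵖ M] where
  /-- The homogeneous elements of each bidegree. -/
  deg : ℤ × ℤ → AddSubgroup M
  isInternal : DirectSum.IsInternal deg
  smul_mem : ∀ {g h : ℤ × ℤ} {m : M} {a : A}, m ∈ deg g → a ∈ 𝒜.deg h →
    MulOpposite.op a • m ∈ deg (g + h)
  /-- The differential. -/
  d : M →+ M
  d_mem : ∀ {g : ℤ × ℤ} {m : M}, m ∈ deg g → d m ∈ deg (g + (1, 0))
  d_d : ∀ m : M, d (d m) = 0
  leibniz : ∀ {g : ℤ × ℤ} {m : M}, m ∈ deg g → ∀ a : A,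
    d (MulOpposite.op a • m) =
      MulOpposite.op a • d m + g.1.negOnePow • (MulOpposite.op (𝒜.d a) • m)

namespace DGStr

variable {A : Type u} [Ring A] {𝒜 : DGAlg A}
variable {M N : Type u} [AddCommGroup M] [Module Aᵐᵒᵖ M] [AddCommGroup N] [Module Aᵐᵒᵖ N]

/-- The shift `M{s}`, where `M{s}_g = M_{g - s}`. The action is unchanged, and the differential is
multiplied by `(-1)^m` if `s = (m, n)`. -/
def shift (S : DGStr 𝒜 M) (s : ℤ × ℤ) : DGStr 𝒜 M where
  deg g := S.deg (g - s)
  isInternal := isInternal_sub S.isInternal s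
  smul_mem := fun {g h m a} hm ha => by
    have := S.smul_mem hm ha
    rwa [sub_add_eq_add_sub] at this
  d :=
    { toFun := fun m => s.1.negOnePow • S.d m
      map_zero' := by simp
      map_add' := by simp }
  d_mem := fun {g _} hm => by
    have := S.d_mem hm
    rw [sub_add_eq_add_sub] at this
    rcases Int.units_eq_one_or s.1.negOnePow with h | h
    · simpa [h] using this
    · simpa [h] using this
  d_d := fun m => by
    rcases Int.units_eq_one_or s.1.negOnePow with h | h <;> simp [h, S.d_d]
  leibniz := fun {g m} hm a => by
    have h1 := S.leibniz hm a
    have h2 : (g - s).1.negOnePow = g.1.negOnePow * s.1.negOnePow := by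
      rw [Prod.fst_sub, Int.negOnePow_sub]
    rw [h2] at h1
    rcases Int.units_eq_one_or s.1.negOnePow with h | h <;>
      simp [h, h1, add_comm]

/-- The suspension `M{(-1,0)}`. -/
abbrev susp (S : DGStr 𝒜 M) : DGStr 𝒜 M := S.shift (-1, 0)

/-- The `A`-linear maps of bidegree `(n, 0)`: the terms of the complex `HOM(M, N)`. -/
def homDeg (S : DGStr 𝒜 M) (T : DGStr 𝒜 N) (n : ℤ) : AddSubgroup (M →ₗ[Aᵐᵒᵖ] N) where
  carrier := {f | ∀ (g : ℤ × ℤ) (m : M), m ∈ S.deg g → f m ∈ T.deg (g + (n, 0))}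
  zero_mem' := fun g _ _ => (T.deg (g + (n, 0))).zero_mem
  add_mem' := fun ha hb g m hm => (T.deg (g + (n, 0))).add_mem (ha g m hm) (hb g m hm)
  neg_mem' := fun ha g m hm => (T.deg (g + (n, 0))).neg_mem (ha g m hm)

/-- The cycles of degree `n` of `HOM(M, N)`, whose differential is
`f ↦ d ∘ f - (-1)^n f ∘ d`. -/
def cycles (S : DGStr 𝒜 M) (T : DGStr 𝒜 N) (n : ℤ) : AddSubgroup (M →ₗ[Aᵐᵒᵖ] N) where
  carrier := {f | f ∈ homDeg S T n ∧ ∀ m, T.d (f m) - n.negOnePow • f (S.d m) = 0}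
  zero_mem' := ⟨(homDeg S T n).zero_mem, fun m => by simp⟩
  add_mem' := fun {a b} ha hb => ⟨(homDeg S T n).add_mem ha.1 hb.1, fun m => by
    have h1 := ha.2 m
    have h2 := hb.2 m
    rw [sub_eq_zero] at h1 h2
    simp [h1, h2]⟩
  neg_mem' := fun {a} ha => ⟨(homDeg S T n).neg_mem ha.1, fun m => by
    have h1 := ha.2 m
    rw [sub_eq_zero] at h1
    simp [h1]⟩

/-- The boundaries of degree `n` of `HOM(M, N)`. -/
def boundaries (S : DGStr 𝒜 M) (T : DGStr 𝒜 N) (n : ℤ) : AddSubgroup (M →ₗ[Aᵐᵒᵖ] N) where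
  carrier := {f | ∃ h ∈ homDeg S T (n - 1),
    ∀ m, f m = T.d (h m) - (n - 1).negOnePow • h (S.d m)}
  zero_mem' := ⟨0, (homDeg S T (n - 1)).zero_mem, fun m => by simp⟩
  add_mem' := by
    rintro a b ⟨h, hh, ha⟩ ⟨k, hk, hb⟩
    refine ⟨h + k, (homDeg S T (n - 1)).add_mem hh hk, fun m => ?_⟩
    simp only [LinearMap.add_apply, ha, hb, map_add, smul_add]
    abel
  neg_mem' := by
    rintro a ⟨h, hh, ha⟩
    refine ⟨-h, (homDeg S T (n - 1)).neg_mem hh, fun m => ?_⟩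
    simp only [LinearMap.neg_apply, ha, map_neg, smul_neg]
    abel

/-- A morphism of differential bigraded modules: an `A`-linear map of bidegree `(0,0)` that
commutes with the differentials. -/
abbrev IsMorphism (S : DGStr 𝒜 M) (T : DGStr 𝒜 N) (f : M →ₗ[Aᵐᵒᵖ] N) : Prop :=
  f ∈ cycles S T 0

/-- Two `A`-linear maps are homotopic if they differ by `d ∘ h + h ∘ d` for an `A`-linear map `h`
of bidegree `(-1,0)`. -/
abbrev Homotopic (S : DGStr 𝒜 M) (T : DGStr 𝒜 N) (f g : M →ₗ[Aᵐᵒᵖ] N) : Prop :=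
  f - g ∈ boundaries S T 0

/-- The group of morphisms from `M` to `N` in the homotopy category `K(A)`: morphisms of
differential bigraded modules modulo those homotopic to zero. -/
abbrev HomK (S : DGStr 𝒜 M) (T : DGStr 𝒜 N) : Type u :=
  cycles S T 0 ⧸ (boundaries S T 0).addSubgroupOf (cycles S T 0)

/-- An isomorphism in `K(A)`. -/
def IsHomotopyEquiv (S : DGStr 𝒜 M) (T : DGStr 𝒜 N) (f : M →ₗ[Aᵐᵒᵖ] N) : Prop :=
  IsMorphism S T f ∧ ∃ f' : N →ₗ[Aᵐᵒᵖ] M, IsMorphism T S f' ∧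
    Homotopic S S (f' ∘ₗ f) LinearMap.id ∧ Homotopic T T (f ∘ₗ f') LinearMap.id

/-- A differential module with trivial homology. -/
def IsAcyclic (S : DGStr 𝒜 M) : Prop := ∀ m, S.d m = 0 → ∃ m', S.d m' = m

theorem morphism_d {S : DGStr 𝒜 M} {T : DGStr 𝒜 N} {f : M →ₗ[Aᵐᵒᵖ] N} (hf : IsMorphism S T f)
    (m : M) : T.d (f m) = f (S.d m) := by
  have := hf.2 m
  rwa [sub_eq_zero, Int.negOnePow_zero, one_smul] at this

/-- The mapping cone of a morphism `u : M ⟶ N`: the module `N ⊕ M{(-1,0)}` with the differential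
`(n, m) ↦ (d n + u m, - d m)`. -/
def cone (S : DGStr 𝒜 M) (T : DGStr 𝒜 N) (u : M →ₗ[Aᵐᵒᵖ] N) (hu : IsMorphism S T u) :
    DGStr 𝒜 (N × M) where
  deg g := (T.deg g).prod (S.susp.deg g)
  isInternal := isInternal_prod T.isInternal S.susp.isInternal
  smul_mem := fun hm ha => ⟨T.smul_mem hm.1 ha, S.susp.smul_mem hm.2 ha⟩
  d :=
    { toFun := fun x => (T.d x.1 + u x.2, S.susp.d x.2)
      map_zero' := by simp
      map_add' := fun x y => by
        ext
        · simp only [Prod.fst_add, Prod.snd_add, map_add]; abel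
        · simp only [Prod.snd_add, map_add] }
  d_mem := fun {g x} hx => by
    refine ⟨(T.deg _).add_mem (T.d_mem hx.1) ?_, S.susp.d_mem hx.2⟩
    have h1 := hu.1 _ _ hx.2
    have h2 : g - (-1, 0) + (0, 0) = g + (1, 0) := by ext <;> simp
    rwa [h2] at h1
  d_d := fun x => by
    ext
    · change T.d (T.d x.1 + u x.2) + u (S.susp.d x.2) = 0
      have h1 : S.susp.d x.2 = - S.d x.2 := by
        change (-1 : ℤ).negOnePow • S.d x.2 = _
        rw [Int.negOnePow_neg, Int.negOnePow_one, Units.neg_smul, one_smul]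
      rw [map_add, T.d_d, morphism_d hu, h1, map_neg]
      simp
    · exact S.susp.d_d x.2
  leibniz := fun {g x} hx a => by
    ext
    · change T.d (MulOpposite.op a • x.1) + u (MulOpposite.op a • x.2) =
        MulOpposite.op a • (T.d x.1 + u x.2) + g.1.negOnePow • (MulOpposite.op (𝒜.d a) • x.1)
      rw [T.leibniz hx.1, map_smul, smul_add]
      abel
    · exact S.susp.leibniz hx.2 a


open Classical in
/-- The direct sum of a family of differential bigraded modules. -/
def directSum {I : Type u} {D : I → Type u} [∀ i, AddCommGroup (D i)] [∀ i, Module Aᵐᵒᵖ (D i)]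
    (T : ∀ i, DGStr 𝒜 (D i)) : DGStr 𝒜 (⨁ i, D i) where
  deg g :=
    { carrier := {x | ∀ i, x i ∈ (T i).deg g}
      zero_mem' := fun i => ((T i).deg g).zero_mem
      add_mem' := fun ha hb i => ((T i).deg g).add_mem (ha i) (hb i)
      neg_mem' := fun ha i => ((T i).deg g).neg_mem (ha i) }
  isInternal := isInternal_directSum (fun i => (T i).isInternal) (fun _ _ => Iff.rfl)
  smul_mem := fun hm ha i => (T i).smul_mem (hm i) ha
  d := DirectSum.map (fun i => (T i).d)
  d_mem := fun {g x} hx i => by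
    rw [DirectSum.map_apply]
    exact (T i).d_mem (hx i)
  d_d := fun x => by
    ext i
    rw [DirectSum.map_apply, DirectSum.map_apply, (T i).d_d]
    rfl
  leibniz := fun {g x} hx a => by
    ext i
    rw [DirectSum.map_apply]
    change (T i).d (MulOpposite.op a • x i) = MulOpposite.op a • DirectSum.map (fun i => (T i).d) x i
      + g.1.negOnePow • (MulOpposite.op (𝒜.d a) • x i)
    rw [DirectSum.map_apply, (T i).leibniz (hx i)]

open Classical in
theorem lof_comp_mem_homDeg {I : Type u} {D : I → Type u} [∀ i, AddCommGroup (D i)]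
    [∀ i, Module Aᵐᵒᵖ (D i)] (S : DGStr 𝒜 M) (T : ∀ i, DGStr 𝒜 (D i)) (i : I) (n : ℤ)
    (f : M →ₗ[Aᵐᵒᵖ] D i) (hf : f ∈ homDeg S (T i) n) :
    DirectSum.lof Aᵐᵒᵖ I D i ∘ₗ f ∈ homDeg S (directSum T) n := by
  intro g m hm j
  rw [LinearMap.comp_apply, DirectSum.lof_eq_of]
  by_cases hj : i = j
  · subst hj
    rw [DirectSum.of_eq_same]
    exact hf g m hm
  · rw [DirectSum.of_eq_of_ne _ _ _ (Ne.symm hj)]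
    exact AddSubgroup.zero_mem _

open Classical in
/-- Composing with the inclusion of a summand sends cycles to cycles. -/
theorem lof_comp_mem_cycles {I : Type u} {D : I → Type u} [∀ i, AddCommGroup (D i)]
    [∀ i, Module Aᵐᵒᵖ (D i)] (S : DGStr 𝒜 M) (T : ∀ i, DGStr 𝒜 (D i)) (i : I) (n : ℤ)
    (f : M →ₗ[Aᵐᵒᵖ] D i) (hf : f ∈ cycles S (T i) n) :
    DirectSum.lof Aᵐᵒᵖ I D i ∘ₗ f ∈ cycles S (directSum T) n := by
  refine ⟨lof_comp_mem_homDeg S T i n f hf.1, fun m => ?_⟩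
  have h1 := hf.2 m
  change DirectSum.map (fun i => (T i).d) (DirectSum.lof Aᵐᵒᵖ I D i (f m))
    - n.negOnePow • DirectSum.lof Aᵐᵒᵖ I D i (f (S.d m)) = 0
  rw [DirectSum.lof_eq_of, DirectSum.lof_eq_of, DirectSum.map_of]
  rw [sub_eq_zero] at h1 ⊢
  rw [h1, Units.smul_def, Units.smul_def, map_zsmul]

/-- A differential module `P` is projective if `HOM(P, M)` has trivial homology for every `M` with
trivial homology. -/
def IsProjective (S : DGStr 𝒜 M) : Prop :=
  ∀ (D : Type u) [AddCommGroup D] [Module Aᵐᵒᵖ D] (T : DGStr 𝒜 D), T.IsAcyclic →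
    ∀ n : ℤ, cycles S T n ≤ boundaries S T n

/-- The map `⨁ Zᵢ/Bᵢ → Z/B` induced by homomorphisms that send `Zᵢ` to `Z` and `Bᵢ` to `B`. -/
def sumQuot {I : Type u} [DecidableEq I] {L : I → Type u} [∀ i, AddCommGroup (L i)]
    {L' : Type u} [AddCommGroup L'] (φ : ∀ i, L i →+ L') (Z B : ∀ i, AddSubgroup (L i))
    (Z' B' : AddSubgroup L') (hZ : ∀ i x, x ∈ Z i → φ i x ∈ Z')
    (hB : ∀ i x, x ∈ B i → φ i x ∈ B') :
    (⨁ i, Z i ⧸ (B i).addSubgroupOf (Z i)) →+ Z' ⧸ B'.addSubgroupOf Z' :=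
  DirectSum.toAddMonoid fun i =>
    QuotientAddGroup.map _ _
      (((φ i).comp (Z i).subtype).codRestrict Z' (fun x => hZ i x x.2))
      (fun x hx => hB i x hx)

/-- Composition with the inclusion of a summand, as a homomorphism. -/
def lofComp (M : Type u) [AddCommGroup M] [Module Aᵐᵒᵖ M] {I : Type u} [DecidableEq I]
    (D : I → Type u) [∀ i, AddCommGroup (D i)] [∀ i, Module Aᵐᵒᵖ (D i)] (i : I) :
    (M →ₗ[Aᵐᵒᵖ] D i) →+ (M →ₗ[Aᵐᵒᵖ] ⨁ i, D i) where
  toFun f := DirectSum.lof Aᵐᵒᵖ I D i ∘ₗ f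
  map_zero' := LinearMap.comp_zero _
  map_add' _ _ := LinearMap.comp_add _ _ _

open Classical in
theorem lofComp_mem_boundaries {I : Type u} {D : I → Type u} [∀ i, AddCommGroup (D i)]
    [∀ i, Module Aᵐᵒᵖ (D i)] (S : DGStr 𝒜 M) (T : ∀ i, DGStr 𝒜 (D i)) (i : I) (n : ℤ)
    (f : M →ₗ[Aᵐᵒᵖ] D i) (hf : f ∈ boundaries S (T i) n) :
    lofComp M D i f ∈ boundaries S (directSum T) n := by
  obtain ⟨h, hh, hf⟩ := hf
  refine ⟨lofComp M D i h, lof_comp_mem_homDeg S T i (n - 1) h hh, fun m => ?_⟩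
  change DirectSum.lof Aᵐᵒᵖ I D i (f m) =
    DirectSum.map (fun i => (T i).d) (DirectSum.lof Aᵐᵒᵖ I D i (h m))
      - (n - 1).negOnePow • DirectSum.lof Aᵐᵒᵖ I D i (h (S.d m))
  rw [DirectSum.lof_eq_of, DirectSum.lof_eq_of, DirectSum.lof_eq_of, DirectSum.map_of, hf m,
    Units.smul_def, Units.smul_def, map_sub, map_zsmul]

open Classical in
/-- The natural map `⨁ Hom(M, Nᵢ) → Hom(M, ⨁ Nᵢ)` of morphism groups in `K(A)`. -/
def homSumMap {I : Type u} {D : I → Type u} [∀ i, AddCommGroup (D i)] [∀ i, Module Aᵐᵒᵖ (D i)]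
    (S : DGStr 𝒜 M) (T : ∀ i, DGStr 𝒜 (D i)) :
    (⨁ i, HomK S (T i)) →+ HomK S (directSum T) :=
  sumQuot (lofComp M D) (fun i => cycles S (T i) 0) (fun i => boundaries S (T i) 0)
    (cycles S (directSum T) 0) (boundaries S (directSum T) 0)
    (fun i f hf => lof_comp_mem_cycles S T i 0 f hf)
    (fun i f hf => lofComp_mem_boundaries S T i 0 f hf)

/-- An object `M` is compact if the natural map `⨁ Hom(M, Nᵢ) → Hom(M, ⨁ Nᵢ)` is an isomorphism for
every family `Nᵢ`. -/
def IsCompact (S : DGStr 𝒜 M) : Prop :=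
  ∀ (I : Type u) (D : I → Type u) [∀ i, AddCommGroup (D i)] [∀ i, Module Aᵐᵒᵖ (D i)]
    (T : ∀ i, DGStr 𝒜 (D i)), Function.Bijective (homSumMap S T)

/-! ### Compatibility with the shift of the quantum grading -/

theorem shift_zero (S : DGStr 𝒜 M) : S.shift 0 = S := by
  ext
  · simp [shift]
  · simp [shift]

theorem shift_shift (S : DGStr 𝒜 M) (s t : ℤ × ℤ) : (S.shift s).shift t = S.shift (s + t) := by
  ext g x
  · simp only [shift]
    rw [sub_sub, add_comm t s]
  · simp only [shift, AddMonoidHom.coe_mk, ZeroHom.coe_mk, Prod.fst_add, Int.negOnePow_add]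
    rw [smul_smul, mul_comm]

theorem quantum_d (S : DGStr 𝒜 M) (k : ℤ) (m : M) : (S.shift (0, k)).d m = S.d m := by
  simp [shift]

theorem homDeg_shift (S : DGStr 𝒜 M) (T : DGStr 𝒜 N) (s : ℤ × ℤ) (n : ℤ) :
    homDeg (S.shift s) (T.shift s) n = homDeg S T n := by
  ext f
  constructor
  · intro hf g m hm
    have h1 := hf (g + s) m (by simpa [shift] using hm)
    have h2 : g + s + (n, 0) - s = g + (n, 0) := by abel
    simp only [shift] at h1
    rwa [h2] at h1
  · intro hf g m hm
    have h1 := hf (g - s) m hm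
    rwa [sub_add_eq_add_sub] at h1

theorem cycles_quantum (S : DGStr 𝒜 M) (T : DGStr 𝒜 N) (k n : ℤ) :
    cycles (S.shift (0, k)) (T.shift (0, k)) n = cycles S T n := by
  ext f
  change (_ ∧ _) ↔ (_ ∧ _)
  rw [homDeg_shift]
  simp only [quantum_d]

theorem boundaries_quantum (S : DGStr 𝒜 M) (T : DGStr 𝒜 N) (k n : ℤ) :
    boundaries (S.shift (0, k)) (T.shift (0, k)) n = boundaries S T n := by
  ext f
  change (∃ h ∈ homDeg _ _ _, _) ↔ (∃ h ∈ homDeg _ _ _, _)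
  rw [homDeg_shift]
  simp only [quantum_d]

theorem shift_quantum_neg (T : DGStr 𝒜 N) (k : ℤ) : (T.shift (0, -k)).shift (0, k) = T := by
  rw [shift_shift]
  convert shift_zero T
  simp

theorem directSum_quantum {I : Type u} {D : I → Type u} [∀ i, AddCommGroup (D i)]
    [∀ i, Module Aᵐᵒᵖ (D i)] (T : ∀ i, DGStr 𝒜 (D i)) (k : ℤ) :
    directSum (fun i => (T i).shift (0, k)) = (directSum T).shift (0, k) := by
  apply DGStr.ext
  · rfl
  · refine AddMonoidHom.ext fun x => ?_
    rw [quantum_d]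
    refine DFinsupp.ext fun i => ?_
    change DirectSum.map (fun i => ((T i).shift (0, k)).d) x i
      = DirectSum.map (fun i => (T i).d) x i
    rw [DirectSum.map_apply, DirectSum.map_apply, quantum_d]

theorem IsAcyclic.quantum {S : DGStr 𝒜 M} (h : S.IsAcyclic) (k : ℤ) :
    (S.shift (0, k)).IsAcyclic := by
  intro m hm
  rw [quantum_d] at hm
  obtain ⟨m', hm'⟩ := h m hm
  exact ⟨m', by rw [quantum_d, hm']⟩

theorem IsProjective.quantum {S : DGStr 𝒜 M} (h : S.IsProjective) (k : ℤ) :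
    (S.shift (0, k)).IsProjective := by
  intro D _ _ T hT n
  rw [← shift_quantum_neg T k, cycles_quantum, boundaries_quantum]
  exact h D _ (hT.quantum _) n

theorem sumQuot_bijective_congr {I : Type u} [DecidableEq I] {L : I → Type u}
    [∀ i, AddCommGroup (L i)] {L' : Type u} [AddCommGroup L'] (φ : ∀ i, L i →+ L')
    (Z B Z₁ B₁ : ∀ i, AddSubgroup (L i)) (Z' B' Z₁' B₁' : AddSubgroup L')
    (hZ : ∀ i x, x ∈ Z i → φ i x ∈ Z') (hB : ∀ i x, x ∈ B i → φ i x ∈ B')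
    (hZ₁ : ∀ i x, x ∈ Z₁ i → φ i x ∈ Z₁') (hB₁ : ∀ i x, x ∈ B₁ i → φ i x ∈ B₁')
    (e1 : Z = Z₁) (e2 : B = B₁) (e3 : Z' = Z₁') (e4 : B' = B₁')
    (h : Function.Bijective (sumQuot φ Z B Z' B' hZ hB)) :
    Function.Bijective (sumQuot φ Z₁ B₁ Z₁' B₁' hZ₁ hB₁) := by
  subst e1 e2 e3 e4
  exact h

theorem IsCompact.quantum {S : DGStr 𝒜 M} (h : S.IsCompact) (k : ℤ) :
    (S.shift (0, k)).IsCompact := by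
  intro I D _ _ T
  obtain ⟨T', rfl⟩ : ∃ T' : ∀ i, DGStr 𝒜 (D i), T = fun i => (T' i).shift (0, k) :=
    ⟨fun i => (T i).shift (0, -k), funext fun i => (shift_quantum_neg (T i) k).symm⟩
  classical
  refine sumQuot_bijective_congr _ _ _ _ _ _ _ _ _ _ _ _ _ ?_ ?_ ?_ ?_ (h I D T')
  · exact funext fun i => (cycles_quantum S (T' i) k 0).symm
  · exact funext fun i => (boundaries_quantum S (T' i) k 0).symm
  · rw [directSum_quantum, cycles_quantum]
  · rw [directSum_quantum, boundaries_quantum]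

theorem IsHomotopyEquiv.quantum {S : DGStr 𝒜 M} {T : DGStr 𝒜 N} {f : M →ₗ[Aᵐᵒᵖ] N}
    (h : IsHomotopyEquiv S T f) (k : ℤ) :
    IsHomotopyEquiv (S.shift (0, k)) (T.shift (0, k)) f := by
  simpa only [IsHomotopyEquiv, IsMorphism, Homotopic, cycles_quantum, boundaries_quantum] using h

theorem cone_quantum (S : DGStr 𝒜 M) (T : DGStr 𝒜 N) (u : M →ₗ[Aᵐᵒᵖ] N) (hu : IsMorphism S T u)
    (k : ℤ) (hu' : IsMorphism (S.shift (0, k)) (T.shift (0, k)) u) :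
    cone (S.shift (0, k)) (T.shift (0, k)) u hu' = (cone S T u hu).shift (0, k) := by
  apply DGStr.ext
  · funext g
    simp only [cone, shift]
    rw [sub_right_comm]
  · refine AddMonoidHom.ext fun x => ?_
    rw [quantum_d]
    ext <;> simp [cone, shift]

theorem susp_quantum (S : DGStr 𝒜 M) (k : ℤ) :
    (S.shift (0, k)).susp = S.susp.shift (0, k) := by
  rw [susp, shift_shift, shift_shift, add_comm]

end DGStr

/-! ### Distinguished triangles and the Grothendieck group -/

/-- A bigraded differential right module over `𝒜`, with a `(1,0)` differential. -/
structure DGMod {A : Type u} [Ring A] (𝒜 : DGAlg A) : Type (u + 1) where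
  carrier : Type u
  [addCommGroup : AddCommGroup carrier]
  [module : Module Aᵐᵒᵖ carrier]
  str : DGStr 𝒜 carrier

attribute [instance] DGMod.addCommGroup DGMod.module

variable {A : Type u} [Ring A] {𝒜 : DGAlg A}

/-- The diagram `P₁ ⟶ P₂ ⟶ P₃ ⟶ P₁{(-1,0)}` of morphisms `f, g, h` is isomorphic in `K(A)` to a
standard triangle `M ⟶ N ⟶ C(u) ⟶ M{(-1,0)}`. -/
def IsDistinguished {P₁ P₂ P₃ : Type u} [AddCommGroup P₁] [Module Aᵐᵒᵖ P₁] [AddCommGroup P₂]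
    [Module Aᵐᵒᵖ P₂] [AddCommGroup P₃] [Module Aᵐᵒᵖ P₃] (S₁ : DGStr 𝒜 P₁) (S₂ : DGStr 𝒜 P₂)
    (S₃ : DGStr 𝒜 P₃) (f : P₁ →ₗ[Aᵐᵒᵖ] P₂) (g : P₂ →ₗ[Aᵐᵒᵖ] P₃) (h : P₃ →ₗ[Aᵐᵒᵖ] P₁) : Prop :=
  S₁.IsMorphism S₂ f ∧ S₂.IsMorphism S₃ g ∧ S₃.IsMorphism S₁.susp h ∧
    ∃ (M N : DGMod 𝒜) (u : M.carrier →ₗ[Aᵐᵒᵖ] N.carrier) (hu : M.str.IsMorphism N.str u)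
      (a : P₁ →ₗ[Aᵐᵒᵖ] M.carrier) (b : P₂ →ₗ[Aᵐᵒᵖ] N.carrier)
      (c : P₃ →ₗ[Aᵐᵒᵖ] N.carrier × M.carrier),
      S₁.IsHomotopyEquiv M.str a ∧ S₂.IsHomotopyEquiv N.str b ∧
      S₃.IsHomotopyEquiv (M.str.cone N.str u hu) c ∧
      S₁.Homotopic N.str (b ∘ₗ f) (u ∘ₗ a) ∧
      S₂.Homotopic (M.str.cone N.str u hu) (c ∘ₗ g)
        (LinearMap.inl Aᵐᵒᵖ N.carrier M.carrier ∘ₗ b) ∧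
      S₃.Homotopic M.str.susp (LinearMap.snd Aᵐᵒᵖ N.carrier M.carrier ∘ₗ c) (a ∘ₗ h)

theorem IsDistinguished.quantum {P₁ P₂ P₃ : Type u} [AddCommGroup P₁] [Module Aᵐᵒᵖ P₁]
    [AddCommGroup P₂] [Module Aᵐᵒᵖ P₂] [AddCommGroup P₃] [Module Aᵐᵒᵖ P₃] {S₁ : DGStr 𝒜 P₁}
    {S₂ : DGStr 𝒜 P₂} {S₃ : DGStr 𝒜 P₃} {f : P₁ →ₗ[Aᵐᵒᵖ] P₂} {g : P₂ →ₗ[Aᵐᵒᵖ] P₃}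
    {h : P₃ →ₗ[Aᵐᵒᵖ] P₁} (H : IsDistinguished S₁ S₂ S₃ f g h) (k : ℤ) :
    IsDistinguished (S₁.shift (0, k)) (S₂.shift (0, k)) (S₃.shift (0, k)) f g h := by
  obtain ⟨hf, hg, hh, ⟨M, S⟩, ⟨N, T⟩, u, hu, a, b, c, ha, hb, hc, h1, h2, h3⟩ := H
  dsimp only at u hu a b c ha hb hc h1 h2 h3
  have hu' : (S.shift (0, k)).IsMorphism (T.shift (0, k)) u := by
    change u ∈ DGStr.cycles _ _ _
    rw [DGStr.cycles_quantum]
    exact hu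
  refine ⟨?_, ?_, ?_, ⟨M, S.shift (0, k)⟩, ⟨N, T.shift (0, k)⟩, u, hu', a, b, c, ha.quantum k,
    hb.quantum k, ?_, ?_, ?_, ?_⟩
  · change _ ∈ DGStr.cycles _ _ _
    rwa [DGStr.cycles_quantum]
  · change _ ∈ DGStr.cycles _ _ _
    rwa [DGStr.cycles_quantum]
  · change _ ∈ DGStr.cycles _ _ _
    rwa [DGStr.susp_quantum, DGStr.cycles_quantum]
  · dsimp only
    rw [DGStr.cone_quantum _ _ _ hu]
    exact hc.quantum k
  · change _ ∈ DGStr.boundaries _ _ _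
    dsimp only
    rwa [DGStr.boundaries_quantum]
  · change _ ∈ DGStr.boundaries _ _ _
    dsimp only
    rw [DGStr.cone_quantum _ _ _ hu, DGStr.boundaries_quantum]
    exact h2
  · change _ ∈ DGStr.boundaries _ _ _
    dsimp only
    rw [DGStr.susp_quantum, DGStr.boundaries_quantum]
    exact h3

/-- The objects of `P(A)`: the compact projective differential bigraded right modules. -/
structure Perf {A : Type u} [Ring A] (𝒜 : DGAlg A) : Type (u + 1) extends DGMod 𝒜 where
  projective : str.IsProjective
  compact : str.IsCompact

/-- The shift `P{(0, k/2)}` of the quantum grading of a compact projective module by `k/2`. -/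
abbrev Perf.quantum (P : Perf 𝒜) (k : ℤ) : Perf 𝒜 where
  carrier := P.carrier
  str := P.str.shift (0, k)
  projective := P.projective.quantum k
  compact := P.compact.quantum k

/-- The subgroup generated by `[P₂] - ([P₁] + [P₃])` for all distinguished triangles
`P₁ ⟶ P₂ ⟶ P₃ ⟶ P₁{(-1,0)}`. -/
def K0Relations {A : Type u} [Ring A] (𝒜 : DGAlg A) : AddSubgroup (FreeAbelianGroup (Perf 𝒜)) :=
  AddSubgroup.closure {x | ∃ (P₁ P₂ P₃ : Perf 𝒜) (f : P₁.carrier →ₗ[Aᵐᵒᵖ] P₂.carrier)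
    (g : P₂.carrier →ₗ[Aᵐᵒᵖ] P₃.carrier) (h : P₃.carrier →ₗ[Aᵐᵒᵖ] P₁.carrier),
    IsDistinguished P₁.str P₂.str P₃.str f g h ∧
    x = FreeAbelianGroup.of P₂ - (FreeAbelianGroup.of P₁ + FreeAbelianGroup.of P₃)}

/-- The Grothendieck group `K₀(A)`. -/
def K0 {A : Type u} [Ring A] (𝒜 : DGAlg A) : Type (u + 1) :=
  FreeAbelianGroup (Perf 𝒜) ⧸ K0Relations 𝒜

namespace K0

instance : AddCommGroup (K0 𝒜) :=
  inferInstanceAs (AddCommGroup (FreeAbelianGroup (Perf 𝒜) ⧸ K0Relations 𝒜))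

/-- The class `[P]` of a compact projective module. -/
def mk (P : Perf 𝒜) : K0 𝒜 := QuotientAddGroup.mk' (K0Relations 𝒜) (FreeAbelianGroup.of P)

theorem hom_ext {B : Type*} [AddCommGroup B] {f g : K0 𝒜 →+ B} (h : ∀ P, f (mk P) = g (mk P)) :
    f = g := by
  apply QuotientAddGroup.addMonoidHom_ext
  apply FreeAbelianGroup.lift_ext
  exact h

/-- The endomorphism `[P] ↦ [P{(0, k/2)}]`. -/
def quantum (k : ℤ) : K0 𝒜 →+ K0 𝒜 :=
  QuotientAddGroup.map (K0Relations 𝒜) (K0Relations 𝒜)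
    (FreeAbelianGroup.map fun P => P.quantum k) (by
      rw [K0Relations, AddSubgroup.closure_le]
      rintro x ⟨P₁, P₂, P₃, f, g, h, H, rfl⟩
      change FreeAbelianGroup.map (fun P : Perf 𝒜 => P.quantum k) _ ∈ AddSubgroup.closure _
      refine AddSubgroup.subset_closure
        ⟨P₁.quantum k, P₂.quantum k, P₃.quantum k, f, g, h, H.quantum k, ?_⟩
      simp)

theorem quantum_mk (k : ℤ) (P : Perf 𝒜) : quantum k (mk P) = mk (P.quantum k) := rfl

theorem perf_quantum_zero (P : Perf 𝒜) : P.quantum 0 = P := by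
  obtain ⟨⟨C, S⟩, h1, h2⟩ := P
  simp only [Perf.quantum]
  congr 2
  exact S.shift_zero

theorem perf_quantum_quantum (P : Perf 𝒜) (k l : ℤ) :
    (P.quantum k).quantum l = P.quantum (l + k) := by
  obtain ⟨⟨C, S⟩, h1, h2⟩ := P
  simp only [Perf.quantum]
  congr 2
  refine (S.shift_shift _ _).trans ?_
  simp [add_comm]

/-- The shifts of the quantum grading as an action of `ℤ` on `K₀(A)`. -/
def quantumHom (𝒜 : DGAlg A) : Multiplicative ℤ →* AddMonoid.End (K0 𝒜) where
  toFun k := quantum k.toAdd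
  map_one' := hom_ext fun P => by
    change quantum 0 (mk P) = mk P
    rw [quantum_mk, perf_quantum_zero]
  map_mul' k l := hom_ext fun P => by
    change quantum (k.toAdd + l.toAdd) (mk P) = quantum k.toAdd (quantum l.toAdd (mk P))
    rw [quantum_mk, quantum_mk, quantum_mk, perf_quantum_quantum]

/-- `K₀(A)` is a module over `ℤ[q^{1/2}, q^{-1/2}]`, realised as the ring `ℤ[T;T⁻¹]` of Laurent
polynomials in `T = q^{1/2}`; the action is `q^{k/2} [P] = [P{(0, k/2)}]`. -/
instance : Module ℤ[T;T⁻¹] (K0 𝒜) :=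
  Module.compHom (K0 𝒜) (AddMonoidAlgebra.lift ℤ (AddMonoid.End (K0 𝒜)) ℤ (quantumHom 𝒜)).toRingHom

theorem T_smul_mk (k : ℤ) (P : Perf 𝒜) :
    (LaurentPolynomial.T k : ℤ[T;T⁻¹]) • mk P = mk (P.quantum k) := by
  change (AddMonoidAlgebra.lift ℤ (AddMonoid.End (K0 𝒜)) ℤ (quantumHom 𝒜))
    (LaurentPolynomial.T k : ℤ[T;T⁻¹]) (mk P) = _
  rw [LaurentPolynomial.T, AddMonoidAlgebra.lift_single, one_smul]
  rfl

end K0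

/-! ### The right module generated by an idempotent -/

/-- The right `A`-module `eA = {x | e x = x}` of an idempotent `e`. -/
def idempotentModule (e : A) : Submodule Aᵐᵒᵖ A where
  carrier := {x | e * x = x}
  zero_mem' := mul_zero e
  add_mem' := fun {a b} ha hb => by
    change e * (a + b) = a + b
    rw [mul_add, ha, hb]
  smul_mem' := fun c x hx => by
    change e * (x * c.unop) = x * c.unop
    rw [← mul_assoc, hx]

/-- The differential bigraded right module `eA`, for an idempotent `e` of bidegree `(0,0)` on which
the differential vanishes, with the grading and the differential of `A`. -/
def idempotentDGMod (𝒜 : DGAlg A) (e : A) (he : e * e = e) (h0 : e ∈ 𝒜.deg 0) (hd : 𝒜.d e = 0) :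
    DGMod 𝒜 where
  carrier := idempotentModule e
  str :=
    { deg := fun g => (𝒜.deg g).comap (idempotentModule e).subtype.toAddMonoidHom
      isInternal := by
        constructor
        · rw [injective_iff_map_eq_zero]
          intro x hx
          ext i
          exact map_coe_eq_zero _ 𝒜.deg 𝒜.isInternal.1
            (idempotentModule e).subtype.toAddMonoidHom (fun _ _ hx => hx) x hx i
        · intro x
          have h1 := map_mem_range_coe
            (fun g => (𝒜.deg g).comap (idempotentModule e).subtype.toAddMonoidHom) 𝒜.deg id
            𝒜.isInternal.2
            ((AddMonoidHom.mulLeft e).codRestrict (idempotentModule e).toAddSubgroup (fun a => by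
              change e * (e * a) = e * a
              rw [← mul_assoc, he]))
            (fun i a ha => by
              have := 𝒜.mul_mem h0 ha
              rwa [zero_add] at this) (x : A)
          have h2 : ((AddMonoidHom.mulLeft e).codRestrict (idempotentModule e).toAddSubgroup
              (fun a => by
                change e * (e * a) = e * a
                rw [← mul_assoc, he])) (x : A) = x := Subtype.ext x.2
          rw [h2] at h1
          exact h1
      smul_mem := fun hm ha => 𝒜.mul_mem hm ha
      d := (𝒜.d.comp (idempotentModule e).subtype.toAddMonoidHom).codRestrict
        (idempotentModule e).toAddSubgroup (fun x => by
          change e * 𝒜.d x = 𝒜.d x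
          have h1 := 𝒜.leibniz h0 (x : A)
          rw [hd, zero_mul, zero_add, Prod.fst_zero, Int.negOnePow_zero, one_smul] at h1
          rw [← h1]
          exact congrArg 𝒜.d x.2)
      d_mem := fun hm => 𝒜.d_mem hm
      d_d := fun m => Subtype.ext (𝒜.d_d m)
      leibniz := fun {g m} hm a => Subtype.ext (by
        have h1 := 𝒜.leibniz hm a
        rw [Units.smul_def] at h1 ⊢
        exact h1) }

end BigradedDG

end

open BigradedDG

/-! The vertices of an acyclic quiver are partially ordered by the existence of paths. Since the
relations involve only paths of positive length, the vertex idempotents `e v` form a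
`TriangularSystem`: they are orthogonal with sum 1, `e v * a * e w` vanishes unless `v ≤ w`, and `e
v * a * e v = ε v a • e v` for a ring homomorphism `ε v : A →+* ℤ`. Everything after that uses only
this structure.

The modules `e v A` are projective and compact because HOM(eA, M) is the complex Me. What remains is
that their classes generate the Grothendieck group and are independent over the Laurent polynomials.

Generation rests on `perf_induction`: every compact projective P becomes acyclic after attaching
finitely many cells, that is, after repeatedly passing to the cone of a map from a shift of `e k A`
given by a homogeneous cycle. An acyclic projective is contractible and has class zero, each cone
contributes the class of its cell, and a homological shift acts by a sign, so [P] is a combination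
of the classes [`e v A`]. The vertices are treated in increasing order. If the homology of `P e w`
vanishes for all w in a lower set U and k is minimal outside U, then cells of type k kill the
homology of `P e k` without disturbing U, because `e k A e w = 0` for w in U. Finitely many suffice:
the homology of `P e k` is finitely generated, and killing a generator of a finitely generated
abelian group creates at most one new class, which generates a free summand of relations and is
killed in turn without creating another.

Finite generation (`not_exists_chain`) is where compactness is used. Up to quasi-isomorphism P may
be replaced by the submodule annihilated by the idempotents of U, on which A acts on the k-part
through `ε k`. Hence additive characters of that part are A-linear maps to copies of ℚ/ℤ with A
acting through `ε k`. If the homology were not finitely generated, infinitely many such characters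
would assemble to a morphism from P to a direct sum that is nonzero in homology on infinitely many
summands, contradicting compactness.

Independence comes from Euler characteristics. For each v, consider the complex of A-linear
functionals to ℚ, where A acts on ℚ through `ε v`. Its cohomology is finite dimensional for compact
projectives (again by `perf_induction`), and the long exact sequence of a cone makes the graded
Euler characteristic additive on triangles. On the shifts of `e k A` it is a monomial if `k = v` and
zero otherwise, so these Euler characteristics read off the coordinates of an element
(`eulerHom_classMap`). -/

noncomputable section

namespace BigradedDG

open MulOpposite (op)

/-! ### Homogeneous components -/

section Components

variable {ι : Type*} [DecidableEq ι] {M N : Type*} [AddCommGroup M] [AddCommGroup N]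

/-- The projection to the homogeneous component of degree `g` of an internal grading. -/
def component {deg : ι → AddSubgroup M} (H : DirectSum.IsInternal deg) (g : ι) : M →+ M :=
  (deg g).subtype.comp ((DFinsupp.evalAddMonoidHom g).comp
    (AddEquiv.ofBijective (DirectSum.coeAddMonoidHom deg) H).symm.toAddMonoidHom)

variable {deg : ι → AddSubgroup M} (H : DirectSum.IsInternal deg)

theorem component_mem (g : ι) (m : M) : component H g m ∈ deg g :=
  Subtype.property _

theorem component_coe (g : ι) (x : ⨁ i, deg i) :
    component H g (DirectSum.coeAddMonoidHom deg x) = x g := by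
  have : (AddEquiv.ofBijective (DirectSum.coeAddMonoidHom deg) H).symm
      (DirectSum.coeAddMonoidHom deg x) = x :=
    (AddEquiv.ofBijective (DirectSum.coeAddMonoidHom deg) H).symm_apply_apply x
  change ((AddEquiv.ofBijective (DirectSum.coeAddMonoidHom deg) H).symm
      (DirectSum.coeAddMonoidHom deg x) g : M) = _
  rw [this]

theorem component_of_mem {g : ι} {m : M} (hm : m ∈ deg g) : component H g m = m := by
  have := component_coe H g (DirectSum.of (fun i => deg i) g ⟨m, hm⟩)
  rw [DirectSum.coeAddMonoidHom_of] at this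
  rw [this, DirectSum.of_eq_same]

theorem component_of_mem_ne {g h : ι} {m : M} (hm : m ∈ deg h) (hne : h ≠ g) :
    component H g m = 0 := by
  have := component_coe H g (DirectSum.of (fun i => deg i) h ⟨m, hm⟩)
  rw [DirectSum.coeAddMonoidHom_of] at this
  rw [this, DirectSum.of_eq_of_ne _ _ _ hne.symm]
  rfl

theorem finite_component_ne_zero (m : M) : {g | component H g m ≠ 0}.Finite := by
  classical
  obtain ⟨x, rfl⟩ := H.2 m
  refine (DFinsupp.support x).finite_toSet.subset fun g hg => ?_
  rw [Set.mem_ofPred_eq, component_coe] at hg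
  simp only [Finset.mem_coe, DFinsupp.mem_support_toFun]
  intro h
  exact hg (by rw [h]; rfl)

include H in
/-- Additive induction over homogeneous elements. -/
theorem homogeneous_induction {p : M → Prop} (h0 : p 0) (hadd : ∀ x y, p x → p y → p (x + y))
    (hom : ∀ g x, x ∈ deg g → p x) (m : M) : p m := by
  obtain ⟨x, rfl⟩ := H.2 m
  induction x using DirectSum.induction_on with
  | zero => simpa using h0
  | of i x => rw [DirectSum.coeAddMonoidHom_of]; exact hom i x x.2
  | add x y hx hy => rw [map_add]; exact hadd _ _ hx hy

/-- An additive map of degree `e` commutes with the projections to the components. -/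
theorem component_map {κ : Type*} [DecidableEq κ] {deg' : κ → AddSubgroup N}
    (H' : DirectSum.IsInternal deg') (f : M →+ N)
    (e : ι → κ) (he : Function.Injective e) (hf : ∀ g m, m ∈ deg g → f m ∈ deg' (e g))
    (g : ι) (m : M) : component H' (e g) (f m) = f (component H g m) := by
  induction m using homogeneous_induction H with
  | h0 => simp
  | hadd x y hx hy => rw [map_add, map_add, hx, hy, map_add, map_add]
  | hom h x hx =>
    by_cases hne : h = g
    · subst hne
      rw [component_of_mem H' (hf _ _ hx), component_of_mem H hx]
    · rw [component_of_mem_ne H' (hf _ _ hx) (he.ne hne), component_of_mem_ne H hx hne, map_zero]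

/-- The sum of the homogeneous components of an element. -/
theorem exists_finset_sum_component (m : M) : ∃ s : Finset ι, m = ∑ g ∈ s, component H g m := by
  classical
  obtain ⟨x, rfl⟩ := H.2 m
  refine ⟨DFinsupp.support x, ?_⟩
  conv_lhs => rw [← DirectSum.sum_support_of x, map_sum]
  refine Finset.sum_congr rfl fun g _ => ?_
  rw [DirectSum.coeAddMonoidHom_of, component_coe]

end Components

namespace DGStr

variable {A : Type u} [Ring A] {𝒜 : DGAlg A}
variable {M N L : Type u} [AddCommGroup M] [Module Aᵐᵒᵖ M] [AddCommGroup N] [Module Aᵐᵒᵖ N]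
  [AddCommGroup L] [Module Aᵐᵒᵖ L]

/-! ### The complexes `HOM(M, N)` -/

theorem isMorphism_iff {S : DGStr 𝒜 M} {T : DGStr 𝒜 N} {f : M →ₗ[Aᵐᵒᵖ] N} :
    IsMorphism S T f ↔ (∀ g m, m ∈ S.deg g → f m ∈ T.deg g) ∧ ∀ m, T.d (f m) = f (S.d m) := by
  constructor
  · intro h
    refine ⟨fun g m hm => ?_, morphism_d h⟩
    have := h.1 g m hm
    rwa [Prod.mk_zero_zero, add_zero] at this
  · rintro ⟨h1, h2⟩
    refine ⟨fun g m hm => ?_, fun m => ?_⟩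
    · rw [Prod.mk_zero_zero, add_zero]
      exact h1 g m hm
    · rw [h2, Int.negOnePow_zero, one_smul, sub_self]

theorem mem_boundaries_zero {S : DGStr 𝒜 M} {T : DGStr 𝒜 N} {f : M →ₗ[Aᵐᵒᵖ] N} :
    f ∈ boundaries S T 0 ↔
      ∃ h ∈ homDeg S T (-1), ∀ m, f m = T.d (h m) + h (S.d m) := by
  change (∃ h ∈ homDeg S T (0 - 1), ∀ m, f m = T.d (h m) - (0 - 1 : ℤ).negOnePow • h (S.d m)) ↔ _
  simp [Int.negOnePow_neg, Int.negOnePow_one]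

theorem boundaries_le_cycles (S : DGStr 𝒜 M) (T : DGStr 𝒜 N) (n : ℤ) :
    boundaries S T n ≤ cycles S T n := by
  rintro f ⟨h, hh, hf⟩
  refine ⟨fun g m hm => ?_, fun m => ?_⟩
  · rw [hf]
    refine AddSubgroup.sub_mem _ ?_ ?_
    · have := T.d_mem (hh g m hm)
      have e : g + (n - 1, 0) + (1, 0) = g + (n, 0) := by ext <;> simp [add_assoc]
      rwa [e] at this
    · have := hh _ _ (S.d_mem hm)
      have e : g + (1, 0) + (n - 1, 0) = g + (n, 0) := by ext <;> simp [add_assoc]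
      rw [e] at this
      rcases Int.units_eq_one_or (n - 1).negOnePow with h | h <;> simpa [h] using this
  · rw [hf, hf, S.d_d, map_zero, smul_zero, sub_zero, map_sub, T.d_d, zero_sub]
    have e : n.negOnePow = - (n - 1).negOnePow := by
      rw [Int.negOnePow_sub, Int.negOnePow_one, mul_neg, mul_one, neg_neg]
    rw [e]
    rcases Int.units_eq_one_or (n - 1).negOnePow with h | h <;> simp [h]

theorem comp_mem_homDeg {S : DGStr 𝒜 M} {T : DGStr 𝒜 N} {R : DGStr 𝒜 L} {n p : ℤ}
    {f : M →ₗ[Aᵐᵒᵖ] N} {g : N →ₗ[Aᵐᵒᵖ] L} (hg : g ∈ homDeg T R p) (hf : f ∈ homDeg S T n) :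
    g ∘ₗ f ∈ homDeg S R (n + p) := by
  intro a m hm
  have := hg _ _ (hf a m hm)
  have e : a + (n, 0) + (p, 0) = a + (n + p, 0) := by ext <;> simp [add_assoc]
  rwa [e] at this

theorem IsMorphism.comp_mem_cycles {S : DGStr 𝒜 M} {T : DGStr 𝒜 N} {R : DGStr 𝒜 L} {n : ℤ}
    {f : M →ₗ[Aᵐᵒᵖ] N} {g : N →ₗ[Aᵐᵒᵖ] L} (hg : IsMorphism T R g) (hf : f ∈ cycles S T n) :
    g ∘ₗ f ∈ cycles S R n := by
  refine ⟨by simpa using comp_mem_homDeg hg.1 hf.1, fun m => ?_⟩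
  have h1 := hf.2 m
  rw [sub_eq_zero] at h1 ⊢
  rw [LinearMap.comp_apply, morphism_d hg, h1]
  rw [Units.smul_def, Units.smul_def, map_zsmul, LinearMap.comp_apply]

theorem IsMorphism.comp_mem_boundaries {S : DGStr 𝒜 M} {T : DGStr 𝒜 N} {R : DGStr 𝒜 L} {n : ℤ}
    {f : M →ₗ[Aᵐᵒᵖ] N} {g : N →ₗ[Aᵐᵒᵖ] L} (hg : IsMorphism T R g) (hf : f ∈ boundaries S T n) :
    g ∘ₗ f ∈ boundaries S R n := by
  obtain ⟨h, hh, hf⟩ := hf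
  refine ⟨g ∘ₗ h, by simpa using comp_mem_homDeg hg.1 hh, fun m => ?_⟩
  rw [LinearMap.comp_apply, hf, LinearMap.comp_apply, morphism_d hg, map_sub]
  rw [Units.smul_def, Units.smul_def, map_zsmul, LinearMap.comp_apply]

theorem mem_cycles_comp {S : DGStr 𝒜 M} {T : DGStr 𝒜 N} {R : DGStr 𝒜 L} {n : ℤ}
    {f : M →ₗ[Aᵐᵒᵖ] N} {g : N →ₗ[Aᵐᵒᵖ] L} (hg : g ∈ cycles T R n) (hf : IsMorphism S T f) :
    g ∘ₗ f ∈ cycles S R n := by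
  refine ⟨by simpa using comp_mem_homDeg hg.1 hf.1, fun m => ?_⟩
  have h1 := hg.2 (f m)
  rwa [morphism_d hf] at h1

theorem mem_boundaries_comp {S : DGStr 𝒜 M} {T : DGStr 𝒜 N} {R : DGStr 𝒜 L} {n : ℤ}
    {f : M →ₗ[Aᵐᵒᵖ] N} {g : N →ₗ[Aᵐᵒᵖ] L} (hg : g ∈ boundaries T R n) (hf : IsMorphism S T f) :
    g ∘ₗ f ∈ boundaries S R n := by
  obtain ⟨h, hh, hg⟩ := hg
  refine ⟨h ∘ₗ f, by simpa using comp_mem_homDeg hh hf.1, fun m => ?_⟩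
  rw [LinearMap.comp_apply, hg, morphism_d hf]
  rfl

theorem isMorphism_id (S : DGStr 𝒜 M) : IsMorphism S S LinearMap.id :=
  isMorphism_iff.2 ⟨fun _ _ hm => hm, fun _ => rfl⟩

theorem isHomotopyEquiv_id (S : DGStr 𝒜 M) : IsHomotopyEquiv S S LinearMap.id := by
  refine ⟨isMorphism_id S, LinearMap.id, isMorphism_id S, ?_, ?_⟩ <;>
  · change _ - _ ∈ _
    simp

theorem Homotopic.refl (S : DGStr 𝒜 M) (T : DGStr 𝒜 N) (f : M →ₗ[Aᵐᵒᵖ] N) :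
    Homotopic S T f f := by
  change _ - _ ∈ _
  simp

theorem isMorphism_zero (S : DGStr 𝒜 M) (T : DGStr 𝒜 N) : IsMorphism S T 0 :=
  (cycles S T 0).zero_mem

/-! ### Shifts -/

theorem shift_d (S : DGStr 𝒜 M) (s : ℤ × ℤ) (m : M) :
    (S.shift s).d m = s.1.negOnePow • S.d m := rfl

theorem susp_d (S : DGStr 𝒜 M) (m : M) : S.susp.d m = - S.d m := by
  rw [shift_d, Int.negOnePow_neg, Int.negOnePow_one, Units.neg_smul, one_smul]

theorem mem_shift_deg {S : DGStr 𝒜 M} {s g : ℤ × ℤ} {m : M} :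
    m ∈ (S.shift s).deg g ↔ m ∈ S.deg (g - s) := Iff.rfl

/-- Both differentials are multiplied by the same sign, so the commutation condition is unaffected.
-/
theorem cycles_shift (S : DGStr 𝒜 M) (T : DGStr 𝒜 N) (s : ℤ × ℤ) (n : ℤ) :
    cycles (S.shift s) (T.shift s) n = cycles S T n := by
  ext f
  change (_ ∧ _) ↔ (_ ∧ _)
  rw [homDeg_shift]
  simp only [shift_d]
  rcases Int.units_eq_one_or s.1.negOnePow with h | h
  · simp [h]
  · refine and_congr_right fun _ => forall_congr' fun m => ?_
    rw [h]
    simp only [Units.neg_smul, one_smul, map_neg, smul_neg, sub_neg_eq_add, neg_add_eq_zero,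
      sub_eq_zero]

theorem boundaries_shift (S : DGStr 𝒜 M) (T : DGStr 𝒜 N) (s : ℤ × ℤ) (n : ℤ) :
    boundaries (S.shift s) (T.shift s) n = boundaries S T n := by
  ext f
  change (∃ h ∈ homDeg _ _ _, _) ↔ (∃ h ∈ homDeg _ _ _, _)
  rw [homDeg_shift]
  simp only [shift_d]
  rcases Int.units_eq_one_or s.1.negOnePow with h | h
  · simp [h]
  · rw [h]
    constructor <;>
    · rintro ⟨k, hk, hf⟩
      -- An odd shift negates both differentials, and the sign is absorbed by the homotopy.
      refine ⟨-k, AddSubgroup.neg_mem _ hk, fun m => ?_⟩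
      rw [hf]
      simp

theorem shift_neg_shift (T : DGStr 𝒜 N) (s : ℤ × ℤ) : (T.shift (-s)).shift s = T := by
  rw [shift_shift, neg_add_cancel, shift_zero]

theorem IsAcyclic.shift {S : DGStr 𝒜 M} (h : S.IsAcyclic) (s : ℤ × ℤ) :
    (S.shift s).IsAcyclic := by
  intro m hm
  have h' : S.d m = 0 := by
    rw [shift_d] at hm
    rcases Int.units_eq_one_or s.1.negOnePow with h | h <;> simpa [h] using hm
  obtain ⟨m', hm'⟩ := h m h'
  refine ⟨s.1.negOnePow • m', ?_⟩
  rw [shift_d]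
  rcases Int.units_eq_one_or s.1.negOnePow with h | h <;> simp [h, hm']

theorem IsProjective.shift {S : DGStr 𝒜 M} (h : S.IsProjective) (s : ℤ × ℤ) :
    (S.shift s).IsProjective := by
  intro D _ _ T hT n
  rw [← shift_neg_shift T s, cycles_shift, boundaries_shift]
  exact h D _ (hT.shift _) n

theorem directSum_shift {I : Type u} {D : I → Type u} [∀ i, AddCommGroup (D i)]
    [∀ i, Module Aᵐᵒᵖ (D i)] (T : ∀ i, DGStr 𝒜 (D i)) (s : ℤ × ℤ) :
    directSum (fun i => (T i).shift s) = (directSum T).shift s := by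
  apply DGStr.ext
  · rfl
  · refine AddMonoidHom.ext fun x => ?_
    refine DFinsupp.ext fun i => ?_
    rw [shift_d, Units.smul_def, DFinsupp.smul_apply]
    change DirectSum.map (fun i => ((T i).shift s).d) x i
      = _ • DirectSum.map (fun i => (T i).d) x i
    rw [DirectSum.map_apply, DirectSum.map_apply, shift_d, Units.smul_def]

/-! ### Compactness -/

section Compact

open Classical in
/-- The projection of a direct sum to the summands outside of a finite set. -/
def dropProj {I : Type u} (D : I → Type u) [∀ i, AddCommGroup (D i)]
    [∀ i, Module Aᵐᵒᵖ (D i)] (F : Finset I) : (⨁ i, D i) →ₗ[Aᵐᵒᵖ] ⨁ i, D i :=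
  DFinsupp.filterLinearMap Aᵐᵒᵖ D (fun i => i ∉ F)

variable {I : Type u} {D : I → Type u} [∀ i, AddCommGroup (D i)] [∀ i, Module Aᵐᵒᵖ (D i)]

open Classical in
theorem dropProj_apply (F : Finset I) (x : ⨁ i, D i) (i : I) :
    dropProj (A := A) D F x i = if i ∈ F then 0 else x i := by
  change DFinsupp.filter (fun i => i ∉ F) x i = _
  rw [DFinsupp.filter_apply]
  by_cases h : i ∈ F <;> simp [h]

theorem directSum_d_apply (T : ∀ i, DGStr 𝒜 (D i)) (x : ⨁ i, D i) (i : I) :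
    (directSum T).d x i = (T i).d (x i) :=
  DirectSum.map_apply _ _ _

theorem isMorphism_dropProj (T : ∀ i, DGStr 𝒜 (D i)) (F : Finset I) :
    IsMorphism (directSum T) (directSum T) (dropProj D F) := by
  classical
  refine isMorphism_iff.2 ⟨fun g m hm i => ?_, fun m => DFinsupp.ext fun i => ?_⟩
  · rw [dropProj_apply]
    split_ifs
    · exact AddSubgroup.zero_mem _
    · exact hm i
  · rw [dropProj_apply, directSum_d_apply, dropProj_apply, directSum_d_apply]
    split_ifs <;> simp

theorem dropProj_comp_dropProj [DecidableEq I] (F F' : Finset I) :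
    dropProj (A := A) D F ∘ₗ dropProj D F' = dropProj D (F ∪ F') := by
  classical
  refine LinearMap.ext fun x => DFinsupp.ext fun i => ?_
  rw [LinearMap.comp_apply, dropProj_apply, dropProj_apply, dropProj_apply]
  by_cases h : i ∈ F <;> by_cases h' : i ∈ F' <;> simp [h, h']

theorem isMorphism_component (T : ∀ i, DGStr 𝒜 (D i)) (i : I) :
    IsMorphism (directSum T) (T i) (DirectSum.component Aᵐᵒᵖ I D i) :=
  isMorphism_iff.2 ⟨fun _ _ hm => hm i, fun x => (directSum_d_apply T x i).symm⟩

/-- Composition with a morphism, as a homomorphism of morphism groups in `K(A)`. -/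
def HomK.map (S : DGStr 𝒜 L) {T : DGStr 𝒜 M} {R : DGStr 𝒜 N} {g : M →ₗ[Aᵐᵒᵖ] N}
    (hg : IsMorphism T R g) : HomK S T →+ HomK S R :=
  QuotientAddGroup.map _ _
    ({ toFun := fun f => ⟨g ∘ₗ f, hg.comp_mem_cycles f.2⟩
       map_zero' := Subtype.ext (LinearMap.comp_zero _)
       map_add' := fun _ _ => Subtype.ext (LinearMap.comp_add _ _ _) } :
      cycles S T 0 →+ cycles S R 0)
    (fun _ hx => hg.comp_mem_boundaries hx)

/-- The class of a morphism in `K(A)`. -/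
def HomK.mk {S : DGStr 𝒜 M} {T : DGStr 𝒜 N} (f : M →ₗ[Aᵐᵒᵖ] N) (hf : IsMorphism S T f) :
    HomK S T :=
  QuotientAddGroup.mk' ((boundaries S T 0).addSubgroupOf (cycles S T 0)) ⟨f, hf⟩

theorem HomK.mk_surjective {S : DGStr 𝒜 M} {T : DGStr 𝒜 N} (x : HomK S T) :
    ∃ f hf, x = HomK.mk f hf := by
  obtain ⟨⟨f, hf⟩, rfl⟩ := QuotientAddGroup.mk'_surjective _ x
  exact ⟨f, hf, rfl⟩

theorem HomK.mk_eq_mk {S : DGStr 𝒜 M} {T : DGStr 𝒜 N} {f g : M →ₗ[Aᵐᵒᵖ] N}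
    {hf : IsMorphism S T f} {hg : IsMorphism S T g} :
    HomK.mk f hf = HomK.mk g hg ↔ f - g ∈ boundaries S T 0 := by
  rw [← sub_eq_zero, HomK.mk, HomK.mk, ← map_sub]
  exact QuotientAddGroup.eq_zero_iff _

theorem HomK.mk_eq_zero {S : DGStr 𝒜 M} {T : DGStr 𝒜 N} {f : M →ₗ[Aᵐᵒᵖ] N}
    {hf : IsMorphism S T f} : HomK.mk f hf = 0 ↔ f ∈ boundaries S T 0 :=
  QuotientAddGroup.eq_zero_iff _

theorem HomK.map_mk (S : DGStr 𝒜 L) {T : DGStr 𝒜 M} {R : DGStr 𝒜 N} {g : M →ₗ[Aᵐᵒᵖ] N}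
    (hg : IsMorphism T R g) (f : L →ₗ[Aᵐᵒᵖ] M) (hf : IsMorphism S T f) :
    HomK.map S hg (HomK.mk f hf) = HomK.mk (g ∘ₗ f) (hg.comp_mem_cycles hf) := rfl

theorem HomK.mk_add {S : DGStr 𝒜 M} {T : DGStr 𝒜 N} {f g : M →ₗ[Aᵐᵒᵖ] N}
    (hf : IsMorphism S T f) (hg : IsMorphism S T g) :
    HomK.mk f hf + HomK.mk g hg = HomK.mk (f + g) (AddSubgroup.add_mem _ hf hg) := rfl

theorem HomK.mk_sum {ι : Type*} {S : DGStr 𝒜 M} {T : DGStr 𝒜 N} (f : ι → M →ₗ[Aᵐᵒᵖ] N)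
    (hf : ∀ i, IsMorphism S T (f i)) (F : Finset ι) :
    ∑ i ∈ F, HomK.mk (f i) (hf i) =
      HomK.mk (∑ i ∈ F, f i) (AddSubgroup.sum_mem _ fun i _ => hf i) := by
  classical
  induction F using Finset.induction_on with
  | empty => exact (map_zero _).symm
  | insert i F hi ih =>
    rw [Finset.sum_insert hi, ih, HomK.mk_add]
    congr 1
    rw [Finset.sum_insert hi]

open Classical in
theorem homSumMap_of (S : DGStr 𝒜 M) (T : ∀ i, DGStr 𝒜 (D i)) (i : I) (f : M →ₗ[Aᵐᵒᵖ] D i)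
    (hf : IsMorphism S (T i) f) :
    homSumMap S T (DirectSum.of (fun i => HomK S (T i)) i (HomK.mk f hf)) =
      HomK.mk (DirectSum.lof Aᵐᵒᵖ I D i ∘ₗ f) (lof_comp_mem_cycles S T i 0 f hf) := by
  exact DirectSum.toAddMonoid_of _ _ _

/-- Projecting to a summand recovers the corresponding coordinate. This holds for every object, so
compactness is purely a surjectivity condition. -/
theorem homSumMap_injective (S : DGStr 𝒜 M) (T : ∀ i, DGStr 𝒜 (D i)) :
    Function.Injective (homSumMap S T) := by
  classical
  have key : ∀ (x : ⨁ i, HomK S (T i)) (i : I),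
      HomK.map S (isMorphism_component T i) (homSumMap S T x) = x i := by
    intro x i
    induction x using DirectSum.induction_on with
    | zero => simp
    | add x y hx hy => rw [map_add, map_add, hx, hy, DirectSum.add_apply]
    | of j y =>
      obtain ⟨f, hf, rfl⟩ := y.mk_surjective
      have h1 := homSumMap_of S T j f hf
      refine (congrArg _ h1).trans ?_
      rw [HomK.map_mk]
      by_cases hij : j = i
      · subst hij
        rw [DirectSum.of_eq_same, HomK.mk_eq_mk]
        convert AddSubgroup.zero_mem _
        rw [sub_eq_zero]
        refine LinearMap.ext fun m => ?_
        simp [DirectSum.component.lof_self]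
      · rw [DirectSum.of_eq_of_ne _ _ _ (Ne.symm hij), HomK.mk_eq_zero]
        convert AddSubgroup.zero_mem _
        refine LinearMap.ext fun m => ?_
        exact DirectSum.of_eq_of_ne _ _ _ (Ne.symm hij)
  intro x y hxy
  refine DFinsupp.ext fun i => ?_
  rw [← key x i, ← key y i, hxy]

/-- An object is compact if and only if every morphism to a direct sum is homotopic to zero on all
but finitely many summands, with a common homotopy. -/
theorem isCompact_iff {S : DGStr 𝒜 M} : S.IsCompact ↔
    ∀ (I : Type u) (D : I → Type u) [∀ i, AddCommGroup (D i)] [∀ i, Module Aᵐᵒᵖ (D i)]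
      (T : ∀ i, DGStr 𝒜 (D i)) (f : M →ₗ[Aᵐᵒᵖ] ⨁ i, D i), IsMorphism S (directSum T) f →
      ∃ F : Finset I, dropProj D F ∘ₗ f ∈ boundaries S (directSum T) 0 := by
  classical
  constructor
  · intro h I D _ _ T f hf
    obtain ⟨x, hx⟩ := (h I D T).2 (HomK.mk f hf)
    -- Vanishing is required for all larger finite sets as well, so that the union of two
    -- exceptional sets works for a sum.
    suffices H : ∃ F : Finset I, ∀ F', F ⊆ F' →
        HomK.map S (isMorphism_dropProj T F') (homSumMap S T x) = 0 by
      obtain ⟨F, hF⟩ := H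
      refine ⟨F, ?_⟩
      have := hF F subset_rfl
      rwa [hx, HomK.map_mk, HomK.mk_eq_zero] at this
    clear hx
    induction x using DirectSum.induction_on with
    | zero => exact ⟨∅, fun F' _ => by simp⟩
    | add x y hx hy =>
      obtain ⟨F₁, h₁⟩ := hx
      obtain ⟨F₂, h₂⟩ := hy
      refine ⟨F₁ ∪ F₂, fun F' hF' => ?_⟩
      rw [map_add, map_add, h₁ F' (Finset.union_subset_left hF'),
        h₂ F' (Finset.union_subset_right hF'), add_zero]
    | of i y =>
      obtain ⟨f, hf, rfl⟩ := y.mk_surjective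
      refine ⟨{i}, fun F' hF' => ?_⟩
      have h1 := homSumMap_of S T i f hf
      refine (congrArg _ h1).trans ?_
      rw [HomK.map_mk, HomK.mk_eq_zero]
      convert AddSubgroup.zero_mem _
      refine LinearMap.ext fun m => DFinsupp.ext fun j => ?_
      rw [LinearMap.comp_apply, dropProj_apply]
      split_ifs with hj
      · rfl
      · refine DirectSum.of_eq_of_ne _ _ _ ?_
        rintro rfl
        exact hj (hF' (Finset.mem_singleton_self _))
  · intro h I D _ _ T
    refine ⟨homSumMap_injective S T, fun y => ?_⟩
    obtain ⟨f, hf, rfl⟩ := y.mk_surjective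
    obtain ⟨F, hF⟩ := h I D T f hf
    have hc := fun i => (isMorphism_component T i).comp_mem_cycles hf
    -- The preimage collects the components of `f` in `F`. It differs from `f` by the part outside
    -- of `F`, which is null-homotopic.
    refine ⟨∑ i ∈ F, DirectSum.of (fun i => HomK S (T i)) i (HomK.mk _ (hc i)), ?_⟩
    rw [map_sum]
    have h1 : ∀ i ∈ F, homSumMap S T (DirectSum.of (fun i => HomK S (T i)) i (HomK.mk _ (hc i)))
        = _ := fun i _ => homSumMap_of S T i _ (hc i)
    rw [Finset.sum_congr rfl h1, HomK.mk_sum, HomK.mk_eq_mk, ← AddSubgroup.neg_mem_iff]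
    convert hF
    rw [neg_sub]
    refine LinearMap.ext fun m => DFinsupp.ext fun j => ?_
    rw [LinearMap.comp_apply, dropProj_apply, LinearMap.sub_apply,
      LinearMap.sum_apply, DirectSum.sub_apply, DFinsupp.finsetSum_apply]
    have h2 : ∀ i, (DirectSum.lof Aᵐᵒᵖ I D i ∘ₗ DirectSum.component Aᵐᵒᵖ I D i ∘ₗ f) m j =
        if i = j then f m j else 0 := by
      intro i
      split_ifs with hij
      · subst hij
        exact DirectSum.of_eq_same _ _
      · exact DirectSum.of_eq_of_ne _ _ _ (Ne.symm hij)
    simp only [h2]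
    rw [Finset.sum_ite_eq']
    split_ifs <;> simp

theorem IsCompact.shift {S : DGStr 𝒜 M} (h : S.IsCompact) (s : ℤ × ℤ) :
    (S.shift s).IsCompact := by
  rw [isCompact_iff] at h ⊢
  intro I D _ _ T f hf
  obtain ⟨T', rfl⟩ : ∃ T' : ∀ i, DGStr 𝒜 (D i), T = fun i => (T' i).shift s :=
    ⟨fun i => (T i).shift (-s), funext fun i => (shift_neg_shift (T i) s).symm⟩
  rw [directSum_shift, IsMorphism, cycles_shift] at hf
  obtain ⟨F, hF⟩ := h I D T' f hf
  refine ⟨F, ?_⟩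
  rwa [directSum_shift, boundaries_shift]

end Compact
end DGStr
end BigradedDG

namespace BigradedDG

open MulOpposite (op)

/-- The grading with only one component. -/
theorem isInternal_concentrated {ι : Type*} [DecidableEq ι] (M : Type*) [AddCommGroup M] (g : ι) :
    DirectSum.IsInternal (fun h => if h = g then (⊤ : AddSubgroup M) else ⊥) := by
  set deg : ι → AddSubgroup M := fun h => if h = g then (⊤ : AddSubgroup M) else ⊥ with hdeg
  have hne : ∀ h, h ≠ g → ∀ y : deg h, y = 0 := by
    rintro h hh ⟨y, hy⟩
    simp only [hdeg, if_neg hh, AddSubgroup.mem_bot] at hy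
    exact Subtype.ext hy
  constructor
  · rw [injective_iff_map_eq_zero]
    intro x hx
    have h1 : x = DirectSum.of (fun i => deg i) g (x g) := by
      refine DFinsupp.ext fun h => ?_
      by_cases hh : h = g
      · subst hh
        rw [DirectSum.of_eq_same]
      · rw [hne h hh (x h), DirectSum.of_eq_of_ne _ _ _ hh]
    rw [h1, DirectSum.coeAddMonoidHom_of] at hx
    rw [h1, Subtype.ext (a1 := x g) (a2 := 0) hx, map_zero]
  · intro m
    exact ⟨DirectSum.of (fun i => deg i) g ⟨m, by simp [hdeg]⟩, by simp⟩

namespace DGStr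

variable {A : Type u} [Ring A] {𝒜 : DGAlg A}
variable {M N L : Type u} [AddCommGroup M] [Module Aᵐᵒᵖ M] [AddCommGroup N] [Module Aᵐᵒᵖ N]
  [AddCommGroup L] [Module Aᵐᵒᵖ L]

/-! ### Mapping cones -/

section Cone

variable {S : DGStr 𝒜 M} {T : DGStr 𝒜 N} {u : M →ₗ[Aᵐᵒᵖ] N} (hu : IsMorphism S T u)

theorem cone_d (x : N × M) : (cone S T u hu).d x = (T.d x.1 + u x.2, - S.d x.2) :=
  Prod.ext rfl (susp_d S x.2)

theorem mem_cone_deg {g : ℤ × ℤ} {x : N × M} :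
    x ∈ (cone S T u hu).deg g ↔ x.1 ∈ T.deg g ∧ x.2 ∈ S.deg (g + (1, 0)) := by
  have : g - (-1, 0) = g + (1, 0) := by ext <;> simp
  rw [← this]
  exact Iff.rfl

theorem isMorphism_inl : IsMorphism T (cone S T u hu) (LinearMap.inl Aᵐᵒᵖ N M) := by
  refine isMorphism_iff.2 ⟨fun g m hm => ?_, fun m => ?_⟩
  · exact (mem_cone_deg hu).2 ⟨hm, AddSubgroup.zero_mem _⟩
  · rw [cone_d]
    simp

theorem isMorphism_snd : IsMorphism (cone S T u hu) S.susp (LinearMap.snd Aᵐᵒᵖ N M) :=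
  isMorphism_iff.2 ⟨fun _ _ hm => hm.2, fun _ => rfl⟩

/-- A cycle on a cone whose restriction to the target is a boundary comes, up to a boundary, from a
cycle on the suspension of the source. -/
theorem exists_cycle_susp {D : DGStr 𝒜 L} {n : ℤ} {f : N × M →ₗ[Aᵐᵒᵖ] L}
    (hf : f ∈ cycles (cone S T u hu) D n)
    (hb : f ∘ₗ LinearMap.inl Aᵐᵒᵖ N M ∈ boundaries T D n) :
    ∃ f' ∈ cycles S.susp D n,
      f - f' ∘ₗ LinearMap.snd Aᵐᵒᵖ N M ∈ boundaries (cone S T u hu) D n := by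
  obtain ⟨h, hh, hfh⟩ := hb
  -- The correction term is what remains on `M` after subtracting the differential of `h ∘ fst` from
  -- `f`; it arises from the component `u` of the differential of the cone.
  let f' : M →ₗ[Aᵐᵒᵖ] L :=
    f ∘ₗ LinearMap.inr Aᵐᵒᵖ N M + ((n - 1).negOnePow : ℤ) • (h ∘ₗ u)
  have hB : f - f' ∘ₗ LinearMap.snd Aᵐᵒᵖ N M ∈ boundaries (cone S T u hu) D n := by
    refine ⟨h ∘ₗ LinearMap.fst Aᵐᵒᵖ N M, fun g x hx => hh g x.1 hx.1, fun x => ?_⟩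
    obtain ⟨y, m⟩ := x
    have h1 : f (y, m) = f (y, 0) + f (0, m) := by rw [← map_add]; simp
    have h2 := hfh y
    rw [LinearMap.comp_apply, LinearMap.inl_apply] at h2
    rw [cone_d, LinearMap.sub_apply, h1, h2]
    simp only [f', LinearMap.comp_apply, LinearMap.add_apply, LinearMap.smul_apply,
      LinearMap.inr_apply, LinearMap.snd_apply, LinearMap.fst_apply, map_add, Units.smul_def,
      smul_add]
    abel
  refine ⟨f', ⟨fun g m hm => ?_, fun m => ?_⟩, hB⟩
  · refine AddSubgroup.add_mem _ (hf.1 g (0, m) ⟨AddSubgroup.zero_mem _, hm⟩)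
      (AddSubgroup.zsmul_mem _ ?_ _)
    have := hh _ _ ((isMorphism_iff.1 hu).1 _ _ hm)
    have e : g - (-1, 0) + (n - 1, 0) = g + (n, 0) := by ext <;> simp
    rwa [e] at this
  -- The cycle condition for `f'` need not be computed: `f' ∘ snd` is a cycle minus a boundary, and
  -- it suffices to evaluate on the elements `(0, m)`.
  · have h1 : f' ∘ₗ LinearMap.snd Aᵐᵒᵖ N M ∈ cycles (cone S T u hu) D n := by
      have := AddSubgroup.sub_mem _ hf (boundaries_le_cycles _ _ _ hB)
      rwa [sub_sub_cancel] at this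
    exact h1.2 (0, m)

/-- Projectivity of `T` makes the restriction to `N` a boundary, which leaves a cycle on the
suspension of `S`, where projectivity of `S` applies. -/
theorem isProjective_cone (hS : S.IsProjective) (hT : T.IsProjective) :
    (cone S T u hu).IsProjective := by
  intro D _ _ R hR n f hf
  obtain ⟨f', hf', hb⟩ := exists_cycle_susp hu hf
    (hT D R hR n (mem_cycles_comp hf (isMorphism_inl hu)))
  have := AddSubgroup.add_mem _ hb
    (mem_boundaries_comp (hS.shift (-1, 0) D R hR n hf') (isMorphism_snd hu))
  rwa [sub_add_cancel] at this

/-- The same two-step reduction as for projectivity: one finite set of summands is dropped for `T`,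
a second one for the suspension of `S`. -/
theorem isCompact_cone (hS : S.IsCompact) (hT : T.IsCompact) :
    (cone S T u hu).IsCompact := by
  classical
  have hS' := hS.shift (-1, 0)
  rw [isCompact_iff] at hS' hT ⊢
  intro I D _ _ R f hf
  obtain ⟨F, hF⟩ := hT I D R _ (mem_cycles_comp hf (isMorphism_inl hu))
  obtain ⟨f', hf', hb⟩ := exists_cycle_susp hu
    ((isMorphism_dropProj R F).comp_mem_cycles hf) hF
  obtain ⟨F', hF'⟩ := hS' I D R f' hf'
  refine ⟨F' ∪ F, ?_⟩
  have h1 := AddSubgroup.add_mem _ ((isMorphism_dropProj R F').comp_mem_boundaries hb)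
    (mem_boundaries_comp hF' (isMorphism_snd hu))
  rwa [LinearMap.comp_sub, LinearMap.comp_assoc, sub_add_cancel, ← LinearMap.comp_assoc,
    dropProj_comp_dropProj] at h1

end Cone

/-! ### Projective and acyclic objects -/

/-- A morphism with acyclic cone to a projective object has a section up to homotopy. -/
theorem IsProjective.exists_section {S : DGStr 𝒜 M} {T : DGStr 𝒜 N} (hS : S.IsProjective)
    {i : N →ₗ[Aᵐᵒᵖ] M} (hi : IsMorphism T S i) (hc : (cone T S i hi).IsAcyclic) :
    ∃ s : M →ₗ[Aᵐᵒᵖ] N, IsMorphism S T s ∧ Homotopic S S (i ∘ₗ s) LinearMap.id := by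
  -- The inclusion of `M` into the acyclic cone is null-homotopic. The second coordinate of the
  -- null-homotopy is the section, and the negative of the first is the homotopy from `i ∘ s` to the
  -- identity.
  obtain ⟨h, hh, hb⟩ := mem_boundaries_zero.1
    (hS _ (cone T S i hi) hc 0 (isMorphism_inl hi))
  refine ⟨LinearMap.snd _ _ _ ∘ₗ h, isMorphism_iff.2 ⟨fun g m hm => ?_, fun m => ?_⟩, ?_⟩
  · have h1 := ((mem_cone_deg hi).1 (hh g m hm)).2
    have e : g + (-1, 0) + (1, 0) = g := by ext <;> simp
    rwa [e] at h1
  · have h1 := congrArg Prod.snd (hb m)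
    rw [cone_d] at h1
    simp only [LinearMap.inl_apply, Prod.snd_add] at h1
    simp only [LinearMap.comp_apply, LinearMap.snd_apply]
    rw [eq_comm, neg_add_eq_zero] at h1
    exact h1
  · refine mem_boundaries_zero.2 ⟨-(LinearMap.fst _ _ _ ∘ₗ h),
      AddSubgroup.neg_mem _ fun g m hm => (hh g m hm).1, fun m => ?_⟩
    have h1 := congrArg Prod.fst (hb m)
    rw [cone_d] at h1
    simp only [LinearMap.inl_apply, Prod.fst_add] at h1
    simp only [LinearMap.comp_apply, LinearMap.sub_apply, LinearMap.snd_apply, LinearMap.neg_apply,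
      LinearMap.fst_apply, LinearMap.id_apply, map_neg]
    nth_rewrite 2 [h1]
    abel

/-- The zero module. -/
def zero (𝒜 : DGAlg A) : DGStr 𝒜 PUnit.{u + 1} where
  deg h := if h = 0 then ⊤ else ⊥
  isInternal := isInternal_concentrated _ 0
  smul_mem := fun _ _ => AddSubgroup.zero_mem _
  d := 0
  d_mem := fun _ => AddSubgroup.zero_mem _
  d_d := fun _ => rfl
  leibniz := fun _ _ => Subsingleton.elim _ _

theorem isProjective_zero : (zero 𝒜).IsProjective := by
  intro D _ _ R _ n f _
  rw [Subsingleton.elim f 0]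
  exact AddSubgroup.zero_mem _

theorem isCompact_zero : (zero 𝒜).IsCompact := by
  rw [isCompact_iff]
  intro I D _ _ R f _
  refine ⟨∅, ?_⟩
  rw [Subsingleton.elim f 0, LinearMap.comp_zero]
  exact AddSubgroup.zero_mem _

theorem isAcyclic_zero : (zero 𝒜).IsAcyclic := fun _ _ => ⟨0, Subsingleton.elim _ _⟩

theorem Homotopic.of_eq {S : DGStr 𝒜 M} {T : DGStr 𝒜 N} {f g : M →ₗ[Aᵐᵒᵖ] N} (h : f = g) :
    Homotopic S T f g :=
  h ▸ Homotopic.refl S T f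

theorem IsProjective.mem_boundaries {S : DGStr 𝒜 M} {T : DGStr 𝒜 N} (hS : S.IsProjective)
    (hT : T.IsAcyclic) {f : M →ₗ[Aᵐᵒᵖ] N} (hf : IsMorphism S T f) : f ∈ boundaries S T 0 :=
  hS _ T hT 0 hf

/-- Acyclic projectives are contractible, so the zero map serves as homotopy inverse of any morphism
between them. -/
theorem IsProjective.isHomotopyEquiv_of_isAcyclic {S : DGStr 𝒜 M} {T : DGStr 𝒜 N}
    (hS : S.IsProjective) (hT : T.IsProjective) (hS' : S.IsAcyclic) (hT' : T.IsAcyclic)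
    {f : M →ₗ[Aᵐᵒᵖ] N} (hf : IsMorphism S T f) : IsHomotopyEquiv S T f := by
  refine ⟨hf, 0, isMorphism_zero _ _, ?_, ?_⟩
  · exact hS.mem_boundaries hS' (AddSubgroup.sub_mem _ ((isMorphism_zero T S).comp_mem_cycles hf)
      (isMorphism_id S))
  · exact hT.mem_boundaries hT' (AddSubgroup.sub_mem _ (hf.comp_mem_cycles (isMorphism_zero T S))
      (isMorphism_id T))

theorem isAcyclic_cone {S : DGStr 𝒜 M} {T : DGStr 𝒜 N} {u : M →ₗ[Aᵐᵒᵖ] N}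
    (hu : IsMorphism S T u) (hS : S.IsAcyclic) (hT : T.IsAcyclic) :
    (cone S T u hu).IsAcyclic := by
  rintro ⟨n, m⟩ h
  rw [cone_d] at h
  have h1 : T.d n + u m = 0 := congrArg Prod.fst h
  have h2 : - S.d m = 0 := congrArg Prod.snd h
  obtain ⟨m', rfl⟩ := hS m (neg_eq_zero.1 h2)
  obtain ⟨n', hn'⟩ := hT (n + u m') (by rw [map_add, morphism_d hu, h1])
  refine ⟨(n', - m'), ?_⟩
  rw [cone_d]
  ext
  · simp [hn']
  · simp

end DGStr

/-! ### Relations in the Grothendieck group -/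

variable {A : Type u} [Ring A] {𝒜 : DGAlg A}

theorem isDistinguished_cone {M N : Type u} [AddCommGroup M] [Module Aᵐᵒᵖ M] [AddCommGroup N]
    [Module Aᵐᵒᵖ N] {S : DGStr 𝒜 M} {T : DGStr 𝒜 N} {u : M →ₗ[Aᵐᵒᵖ] N}
    (hu : S.IsMorphism T u) :
    IsDistinguished S T (S.cone T u hu) u (LinearMap.inl _ _ _) (LinearMap.snd _ _ _) :=
  ⟨hu, DGStr.isMorphism_inl hu, DGStr.isMorphism_snd hu, ⟨M, S⟩, ⟨N, T⟩, u, hu, LinearMap.id,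
    LinearMap.id, LinearMap.id, DGStr.isHomotopyEquiv_id _, DGStr.isHomotopyEquiv_id _,
    DGStr.isHomotopyEquiv_id _, DGStr.Homotopic.refl _ _ _, DGStr.Homotopic.refl _ _ _,
    DGStr.Homotopic.refl _ _ _⟩

/-- The cone of a morphism of compact projective modules. -/
abbrev Perf.cone (P Q : Perf 𝒜) (u : P.carrier →ₗ[Aᵐᵒᵖ] Q.carrier)
    (hu : P.str.IsMorphism Q.str u) : Perf 𝒜 where
  carrier := Q.carrier × P.carrier
  str := P.str.cone Q.str u hu
  projective := DGStr.isProjective_cone hu P.projective Q.projective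
  compact := DGStr.isCompact_cone hu P.compact Q.compact

/-- The shift of a compact projective module. -/
abbrev Perf.shift (P : Perf 𝒜) (s : ℤ × ℤ) : Perf 𝒜 where
  carrier := P.carrier
  str := P.str.shift s
  projective := P.projective.shift s
  compact := P.compact.shift s

theorem Perf.shift_shift (P : Perf 𝒜) (s t : ℤ × ℤ) : (P.shift s).shift t = P.shift (s + t) := by
  obtain ⟨⟨C, S⟩, h1, h2⟩ := P
  simp only [Perf.shift]
  congr 2
  exact S.shift_shift _ _

/-- The zero module as a compact projective module. -/
abbrev Perf.zero (𝒜 : DGAlg A) : Perf 𝒜 where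
  carrier := PUnit.{u + 1}
  str := DGStr.zero 𝒜
  projective := DGStr.isProjective_zero
  compact := DGStr.isCompact_zero

namespace K0

theorem mk_eq_add {P₁ P₂ P₃ : Perf 𝒜} {f : P₁.carrier →ₗ[Aᵐᵒᵖ] P₂.carrier}
    {g : P₂.carrier →ₗ[Aᵐᵒᵖ] P₃.carrier} {h : P₃.carrier →ₗ[Aᵐᵒᵖ] P₁.carrier}
    (H : IsDistinguished P₁.str P₂.str P₃.str f g h) : mk P₂ = mk P₁ + mk P₃ := by
  have h1 : FreeAbelianGroup.of P₂ - (FreeAbelianGroup.of P₁ + FreeAbelianGroup.of P₃) ∈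
      K0Relations 𝒜 := AddSubgroup.subset_closure ⟨P₁, P₂, P₃, f, g, h, H, rfl⟩
  rw [← sub_eq_zero]
  exact (QuotientAddGroup.eq_zero_iff _).2 h1

theorem mk_cone (P Q : Perf 𝒜) (u : P.carrier →ₗ[Aᵐᵒᵖ] Q.carrier)
    (hu : P.str.IsMorphism Q.str u) : mk Q = mk P + mk (P.cone Q u hu) :=
  mk_eq_add (isDistinguished_cone hu)

/-- For contractible `P`, the diagram `P → P → P` with zero maps is a distinguished triangle, which
yields [P] = [P] + [P]. -/
theorem mk_eq_zero_of_isAcyclic (P : Perf 𝒜) (hP : P.str.IsAcyclic) : mk P = 0 := by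
  have h0 : P.str.IsMorphism P.str 0 := DGStr.isMorphism_zero _ _
  have H : IsDistinguished P.str P.str P.str 0 0 0 := by
    refine ⟨h0, h0, DGStr.isMorphism_zero _ _, P.toDGMod, P.toDGMod, 0, h0, LinearMap.id,
      LinearMap.id, 0, DGStr.isHomotopyEquiv_id _, DGStr.isHomotopyEquiv_id _,
      P.projective.isHomotopyEquiv_of_isAcyclic (DGStr.isProjective_cone h0 P.projective P.projective) hP
        (DGStr.isAcyclic_cone h0 hP hP) (DGStr.isMorphism_zero _ _), DGStr.Homotopic.refl _ _ _, ?_, ?_⟩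
    · exact P.projective.mem_boundaries (DGStr.isAcyclic_cone h0 hP hP)
        (AddSubgroup.sub_mem _ (DGStr.isMorphism_zero _ _)
          ((DGStr.isMorphism_inl h0).comp_mem_cycles (DGStr.isMorphism_id _)))
    · exact DGStr.Homotopic.refl _ _ _
  have := mk_eq_add H
  simpa using this

/-- The suspension is the cone of `P → 0`, and the zero module has class zero. -/
theorem mk_susp (P : Perf 𝒜) : mk (P.shift (-1, 0)) = - mk P := by
  have h0 : P.str.IsMorphism (Perf.zero 𝒜).str 0 := DGStr.isMorphism_zero _ _
  have hinr : P.str.susp.IsMorphism (P.str.cone (DGStr.zero 𝒜) 0 h0)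
      (LinearMap.inr Aᵐᵒᵖ PUnit.{u + 1} P.carrier) := by
    rw [DGStr.isMorphism_iff]
    refine ⟨fun g m hm => ⟨AddSubgroup.zero_mem _, hm⟩, fun m => ?_⟩
    rw [DGStr.cone_d, DGStr.susp_d P.str m]
    rfl
  have H : IsDistinguished P.str (Perf.zero 𝒜).str (P.shift (-1, 0)).str 0 0 LinearMap.id := by
    refine ⟨h0, DGStr.isMorphism_zero _ _, DGStr.isMorphism_id _, P.toDGMod,
      (Perf.zero 𝒜).toDGMod, 0, h0, LinearMap.id, LinearMap.id, LinearMap.inr _ _ _,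
      DGStr.isHomotopyEquiv_id _, DGStr.isHomotopyEquiv_id _,
      ⟨hinr, LinearMap.snd _ _ _, DGStr.isMorphism_snd h0, ?_, ?_⟩, DGStr.Homotopic.refl _ _ _,
      ?_, DGStr.Homotopic.refl _ _ _⟩
    · exact DGStr.Homotopic.refl P.str.susp P.str.susp LinearMap.id
    · exact DGStr.Homotopic.of_eq (LinearMap.ext fun x => Prod.ext rfl rfl)
    · exact DGStr.Homotopic.of_eq (LinearMap.ext fun x => Prod.ext rfl rfl)
  have := mk_eq_add H
  rw [mk_eq_zero_of_isAcyclic (Perf.zero 𝒜) DGStr.isAcyclic_zero] at this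
  exact (neg_eq_of_add_eq_zero_right this.symm).symm

/-- A homological shift acts on the Grothendieck group by a sign. -/
theorem mk_shift (P : Perf 𝒜) (m k : ℤ) :
    mk (P.shift (m, k)) = m.negOnePow • mk (P.quantum k) := by
  have step : ∀ m : ℤ, mk (P.shift (m - 1, k)) = - mk (P.shift (m, k)) := by
    intro m
    rw [← mk_susp, Perf.shift_shift]
    congr 2
    ext <;> simp [sub_eq_add_neg]
  induction m using Int.induction_on with
  | zero => simp
  | succ i ih =>
    have := step (i + 1)
    rw [add_sub_cancel_right, ih] at this
    rw [Int.negOnePow_succ, Units.neg_smul, this, neg_neg]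
  | pred i ih =>
    rw [step, ih, Int.negOnePow_sub, Int.negOnePow_one, mul_neg, mul_one, Units.neg_smul]

end K0

end BigradedDG

namespace BigradedDG

open MulOpposite (op)

variable {A : Type u} [Ring A] {𝒜 : DGAlg A}

/-! ### Modules generated by idempotents -/

namespace DGStr

variable {M N : Type u} [AddCommGroup M] [Module Aᵐᵒᵖ M] [AddCommGroup N] [Module Aᵐᵒᵖ N]
variable (S : DGStr 𝒜 M) {e : A}

theorem d_smul (hd : 𝒜.d e = 0) (m : M) : S.d (op e • m) = op e • S.d m := by
  induction m using homogeneous_induction S.isInternal with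
  | h0 => simp
  | hadd x y hx hy => simp [smul_add, hx, hy]
  | hom g x hx => rw [S.leibniz hx, hd]; simp

theorem smul_mem_of_mem_zero (h0 : e ∈ 𝒜.deg 0) {g : ℤ × ℤ} {m : M} (hm : m ∈ S.deg g) :
    op e • m ∈ S.deg g := by
  simpa using S.smul_mem hm h0

theorem component_smul (h0 : e ∈ 𝒜.deg 0) (g : ℤ × ℤ) (m : M) :
    component S.isInternal g (op e • m) = op e • component S.isInternal g m :=
  component_map S.isInternal S.isInternal (DistribSMul.toAddMonoidHom M (op e)) id
    Function.injective_id (fun _ _ hm => S.smul_mem_of_mem_zero h0 hm) g m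

theorem component_d (g : ℤ × ℤ) (m : M) :
    component S.isInternal (g + (1, 0)) (S.d m) = S.d (component S.isInternal g m) :=
  component_map S.isInternal S.isInternal S.d (fun g => g + (1, 0)) (add_left_injective _)
    (fun _ _ hm => S.d_mem hm) g m

theorem smul_smul_self (he : e * e = e) (m : M) : op e • op e • m = op e • m := by
  rw [smul_smul, ← MulOpposite.op_mul, he]

variable {S} in
/-- A homogeneous boundary in the image of an idempotent bounds a homogeneous element of that
image. -/
theorem exists_primitive (he : e * e = e) (h0 : e ∈ 𝒜.deg 0) (hd : 𝒜.d e = 0) {g : ℤ × ℤ} {y : M}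
    (hy : y ∈ S.deg (g + (1, 0))) (hey : op e • y = y) (hb : ∃ z, S.d z = y) :
    ∃ z ∈ S.deg g, op e • z = z ∧ S.d z = y := by
  obtain ⟨z, rfl⟩ := hb
  -- Any primitive can be replaced by the `e`-part of its component of degree `g`, because both
  -- projections commute with the differential.
  refine ⟨op e • component S.isInternal g z,
    S.smul_mem_of_mem_zero h0 (component_mem _ _ _), smul_smul_self he _, ?_⟩
  rw [d_smul S hd, ← component_d, ← component_smul S h0, hey, component_of_mem _ hy]

end DGStr

section Idempotent

variable {M : Type u} [AddCommGroup M] [Module Aᵐᵒᵖ M] {e : A}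

/-- The map `eA ⟶ M` given by the action on an element `x` of `M`. -/
def evalMap (e : A) (x : M) : idempotentModule e →ₗ[Aᵐᵒᵖ] M where
  toFun a := op (a : A) • x
  map_add' a b := by
    change op ((a : A) + b) • x = _
    rw [MulOpposite.op_add, add_smul]
  map_smul' c a := by
    change op ((a : A) * c.unop) • x = c • op (a : A) • x
    rw [MulOpposite.op_mul, mul_smul, MulOpposite.op_unop]

theorem evalMap_apply (x : M) (a : idempotentModule e) : evalMap e x a = op (a : A) • x := rfl

/-- Since `a = e * a`, a linear map on eA is determined by its value at `e`. This is the
identification of HOM(eA, M) with Me. -/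
theorem map_idempotentModule (he : e * e = e) (f : idempotentModule e →ₗ[Aᵐᵒᵖ] M)
    (a : idempotentModule e) : f a = op (a : A) • f ⟨e, he⟩ := by
  rw [← map_smul]
  congr 1
  exact Subtype.ext a.2.symm

variable (he : e * e = e) (h0 : e ∈ 𝒜.deg 0) (hd : 𝒜.d e = 0)

/-- The structure of a differential bigraded module on `eA`. -/
def idempotentStr (he : e * e = e) (h0 : e ∈ 𝒜.deg 0) (hd : 𝒜.d e = 0) :
    DGStr 𝒜 (idempotentModule e) :=
  (idempotentDGMod 𝒜 e he h0 hd).str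

theorem mem_idempotentStr_deg {g : ℤ × ℤ} {a : idempotentModule e} :
    a ∈ (idempotentStr he h0 hd).deg g ↔ (a : A) ∈ 𝒜.deg g := Iff.rfl

theorem coe_idempotentStr_d (a : idempotentModule e) :
    ((idempotentStr he h0 hd).d a : A) = 𝒜.d a := rfl

theorem evalMap_isMorphism {S : DGStr 𝒜 M} {s : ℤ × ℤ} {x : M} (hx : x ∈ S.deg s)
    (hdx : S.d x = 0) :
    ((idempotentStr he h0 hd).shift s).IsMorphism S (evalMap e x) := by
  rw [DGStr.isMorphism_iff]
  refine ⟨fun g a ha => ?_, fun a => ?_⟩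
  · have h1 : (a : A) ∈ 𝒜.deg (g - s) := ha
    have h2 := S.smul_mem hx h1
    rwa [add_sub_cancel] at h2
  · rw [evalMap_apply, S.leibniz hx, hdx, smul_zero, zero_add, DGStr.shift_d, Units.smul_def,
      Units.smul_def, map_zsmul]
    rfl

/-- A cycle `f` of HOM(eA, T) corresponds to the cycle `f e` of Te. A homogeneous primitive `z` of
`f e` gives the homotopy `evalMap e z`. -/
theorem isProjective_idempotent : (idempotentStr he h0 hd).IsProjective := by
  intro D _ _ T hT n f hf
  have hmem : (⟨e, he⟩ : idempotentModule e) ∈ (idempotentStr he h0 hd).deg 0 := h0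
  have hdz : (idempotentStr he h0 hd).d (⟨e, he⟩ : idempotentModule e) = 0 :=
    Subtype.ext hd
  have h1 : f (⟨e, he⟩ : idempotentModule e) ∈ T.deg ((n - 1, 0) + (1, 0)) := by
    have := hf.1 0 _ hmem
    rw [zero_add] at this
    convert this using 2
    ext <;> simp
  have h2 : T.d (f (⟨e, he⟩ : idempotentModule e)) = 0 := by
    have := hf.2 (⟨e, he⟩ : idempotentModule e)
    rwa [hdz, map_zero, smul_zero, sub_zero] at this
  have h3 : op e • f (⟨e, he⟩ : idempotentModule e) = f (⟨e, he⟩ : idempotentModule e) :=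
    (map_idempotentModule he f ⟨e, he⟩).symm
  obtain ⟨z, hz, -, hdz'⟩ := DGStr.exists_primitive he h0 hd h1 h3 (hT _ h2)
  refine ⟨evalMap e z, fun g a ha => ?_, fun a => ?_⟩
  · have h5 := T.smul_mem hz ((mem_idempotentStr_deg he h0 hd).1 ha)
    rwa [add_comm] at h5
  · rw [map_idempotentModule he f a, evalMap_apply, evalMap_apply, coe_idempotentStr_d,
      T.leibniz hz, hdz', add_sub_cancel_right]

/-- The single element `f e` has finite support, and outside of that support `f` is zero, not merely
null-homotopic. -/
theorem isCompact_idempotent : (idempotentStr he h0 hd).IsCompact := by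
  classical
  rw [DGStr.isCompact_iff]
  intro I D _ _ T f hf
  refine ⟨DFinsupp.support (f (⟨e, he⟩ : idempotentModule e)), ?_⟩
  convert AddSubgroup.zero_mem _
  refine LinearMap.ext fun a => ?_
  rw [LinearMap.comp_apply, map_idempotentModule he f a, map_smul]
  have : DGStr.dropProj (A := A) D (DFinsupp.support (f (⟨e, he⟩ : idempotentModule e)))
      (f (⟨e, he⟩ : idempotentModule e)) = 0 := by
    refine DFinsupp.ext fun i => ?_
    rw [DGStr.dropProj_apply]
    split_ifs with h
    · rfl
    · exact DFinsupp.notMem_support_iff.1 h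
  rw [this, smul_zero]
  rfl

/-- The module `eA` of an idempotent `e` as a compact projective module. -/
abbrev Perf.idempotent (he : e * e = e) (h0 : e ∈ 𝒜.deg 0) (hd : 𝒜.d e = 0) : Perf 𝒜 where
  carrier := idempotentModule e
  str := idempotentStr he h0 hd
  projective := isProjective_idempotent he h0 hd
  compact := isCompact_idempotent he h0 hd

end Idempotent

/-! ### Triangular systems of idempotents -/

/-- A complete system of orthogonal idempotents of a differential graded algebra, indexed by a
finite partially ordered set, such that `e v * A * e w` vanishes unless `v ≤ w`, and
`e v * A * e v` is free of rank one. -/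
structure TriangularSystem (𝒜 : DGAlg A) (V : Type u) [Fintype V] [PartialOrder V] where
  /-- The idempotents. -/
  e : V → A
  mul_self : ∀ v, e v * e v = e v
  mul_of_ne : ∀ {v w}, v ≠ w → e v * e w = 0
  sum_eq : ∑ v, e v = 1
  mem : ∀ v, e v ∈ 𝒜.deg 0
  d_eq : ∀ v, 𝒜.d (e v) = 0
  mul_mul_of_not_le : ∀ {v w}, ¬ v ≤ w → ∀ a, e v * a * e w = 0
  /-- The augmentations. -/
  ε : V → A →+* ℤ
  mul_mul_self : ∀ v a, e v * a * e v = ε v a • e v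
  ε_self : ∀ v, ε v (e v) = 1

namespace TriangularSystem

variable {V : Type u} [Fintype V] [PartialOrder V] (Θ : TriangularSystem 𝒜 V)

theorem ε_of_ne {v w : V} (h : v ≠ w) : Θ.ε v (Θ.e w) = 0 := by
  have h1 := congrArg (Θ.ε v) (Θ.mul_of_ne h)
  rwa [map_mul, Θ.ε_self, one_mul, map_zero] at h1

theorem smul_e_eq_zero {v : V} {n : ℤ} : n • Θ.e v = 0 ↔ n = 0 := by
  refine ⟨fun h => ?_, fun h => by rw [h, zero_smul]⟩
  have := congrArg (Θ.ε v) h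
  simpa [Θ.ε_self] using this

/-- The element `e v * a * e v` has degree `g`, but as a multiple of `e v` it also has degree 0, so
it vanishes. -/
theorem ε_of_mem {v : V} {g : ℤ × ℤ} (hg : g ≠ 0) {a : A} (ha : a ∈ 𝒜.deg g) :
    Θ.ε v a = 0 := by
  have h1 : Θ.e v * a * Θ.e v ∈ 𝒜.deg g := by
    simpa using 𝒜.mul_mem (𝒜.mul_mem (Θ.mem v) ha) (Θ.mem v)
  have h2 : Θ.e v * a * Θ.e v ∈ 𝒜.deg 0 := by
    rw [Θ.mul_mul_self]
    exact AddSubgroup.zsmul_mem _ (Θ.mem v) _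
  have h3 : Θ.e v * a * Θ.e v = 0 := by
    rw [← component_of_mem 𝒜.isInternal h1, component_of_mem_ne 𝒜.isInternal h2 hg.symm]
  rwa [Θ.mul_mul_self, Θ.smul_e_eq_zero] at h3

/-- Only elements whose differential has degree 0 matter. These have nonzero degree themselves, so
`e v * x * e v = 0`, and its differential is `e v * d x * e v`. -/
theorem ε_d (v : V) (a : A) : Θ.ε v (𝒜.d a) = 0 := by
  induction a using homogeneous_induction 𝒜.isInternal with
  | h0 => simp
  | hadd x y hx hy => simp [hx, hy]
  | hom g x hx =>
    by_cases hg : g + (1, 0) = 0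
    · have hg' : g ≠ 0 := by
        rintro rfl
        simp at hg
      have h1 : Θ.e v * 𝒜.d x * Θ.e v = 𝒜.d (Θ.e v * x * Θ.e v) := by
        have hx' := 𝒜.mul_mem (Θ.mem v) hx
        rw [𝒜.leibniz hx', 𝒜.leibniz (Θ.mem v), Θ.d_eq]
        simp
      rw [Θ.mul_mul_self, Θ.mul_mul_self, Θ.ε_of_mem hg' hx, zero_smul, map_zero,
        Θ.smul_e_eq_zero] at h1
      exact h1
    · exact Θ.ε_of_mem hg (𝒜.d_mem hx)

section Module

variable {M : Type u} [AddCommGroup M] [Module Aᵐᵒᵖ M]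

theorem sum_smul (m : M) : ∑ v, op (Θ.e v) • m = m := by
  rw [← Finset.sum_smul, ← Finset.op_sum, Θ.sum_eq, MulOpposite.op_one, one_smul]

theorem smul_smul_of_ne {v w : V} (h : v ≠ w) (m : M) : op (Θ.e w) • op (Θ.e v) • m = 0 := by
  rw [smul_smul, ← MulOpposite.op_mul, Θ.mul_of_ne h, MulOpposite.op_zero, zero_smul]

/-- The cycles of `M e` are boundaries. -/
def _root_.BigradedDG.DGStr.ExactAt (S : DGStr 𝒜 M) (e : A) : Prop :=
  ∀ m, op e • m = m → S.d m = 0 → ∃ m', S.d m' = m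

theorem isAcyclic_of_exactAt {S : DGStr 𝒜 M} (h : ∀ v, S.ExactAt (Θ.e v)) : S.IsAcyclic := by
  intro m hm
  have h1 : ∀ v, ∃ m', S.d m' = op (Θ.e v) • m := fun v =>
    h v _ (DGStr.smul_smul_self (Θ.mul_self v) m) (by
      rw [DGStr.d_smul _ (Θ.d_eq v), hm, smul_zero])
  choose f hf using h1
  refine ⟨∑ v, f v, ?_⟩
  rw [map_sum, Finset.sum_congr rfl fun v _ => hf v, Θ.sum_smul]

end Module

/-- The module `e v A`. -/
abbrev proj (v : V) : Perf 𝒜 :=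
  Perf.idempotent (Θ.mul_self v) (Θ.mem v) (Θ.d_eq v)

end TriangularSystem

end BigradedDG

namespace BigradedDG

open MulOpposite (op)

/-! ### Characters separating an increasing chain of subgroups -/

/-- Finitely supported functions with values in `ℚ/ℤ` form a divisible group. -/
instance divisibleByFinsupp : DivisibleBy (ℕ →₀ AddCircle (1 : ℚ)) ℤ :=
  divisibleByOfSMulRightSurj _ _ fun {n} hn f => by
    -- Division in ℚ/ℤ is not unique; choosing 0 as the quotient of 0 keeps the support finite.
    refine ⟨Finsupp.mapRange (fun x => if x = 0 then 0 else DivisibleBy.div x n) (by simp) f, ?_⟩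
    refine Finsupp.ext fun i => ?_
    simp only [Finsupp.smul_apply, Finsupp.mapRange_apply]
    split_ifs with h
    · rw [h, smul_zero]
    · exact DivisibleBy.div_cancel _ hn

theorem exists_character_of_notMem {M : Type*} [AddCommGroup M] {K : AddSubgroup M} {z : M}
    (hz : z ∉ K) : ∃ ψ : M →+ AddCircle (1 : ℚ), (∀ m ∈ K, ψ m = 0) ∧ ψ z ≠ 0 := by
  have h : (QuotientAddGroup.mk' K z) ≠ 0 := fun h => hz ((QuotientAddGroup.eq_zero_iff z).1 h)
  obtain ⟨c, hc⟩ := CharacterModule.exists_character_apply_ne_zero_of_ne_zero h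
  refine ⟨(c : (M ⧸ K) →+ AddCircle (1 : ℚ)).comp (QuotientAddGroup.mk' K), fun m hm => ?_, hc⟩
  have : QuotientAddGroup.mk' K m = 0 := (QuotientAddGroup.eq_zero_iff m).2 hm
  change c (QuotientAddGroup.mk' K m) = 0
  rw [this]
  exact map_zero (c : (M ⧸ K) →+ AddCircle (1 : ℚ))

/-- Characters `ψ n` to ℚ/ℤ that kill `K n` but not `z n` exist separately. On the union of the
chain only finitely many are nonzero at each element, so together they land in the finitely
supported functions; these form a divisible, hence injective, group, and the map extends to `M`. -/
theorem exists_hom_finsupp {M : Type*} [AddCommGroup M] {K : ℕ → AddSubgroup M} (hK : Monotone K)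
    {z : ℕ → M} (hz : ∀ n, z n ∈ K (n + 1)) (hz' : ∀ n, z n ∉ K n) :
    ∃ Φ : M →+ (ℕ →₀ AddCircle (1 : ℚ)), (∀ m ∈ K 0, Φ m = 0) ∧ ∀ n, Φ (z n) n ≠ 0 := by
  choose ψ hψ hψz using fun n => exists_character_of_notMem (hz' n)
  let L : AddSubgroup M := ⨆ n, K n
  have hL : ∀ m, m ∈ L ↔ ∃ n, m ∈ K n := fun m =>
    AddSubgroup.mem_iSup_of_directed hK.directed_le
  have hfin : ∀ m : L, (Function.support fun n => ψ n m).Finite := by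
    rintro ⟨m, hm⟩
    obtain ⟨N, hN⟩ := (hL m).1 hm
    refine (Set.finite_lt_nat N).subset fun n hn => ?_
    by_contra h
    exact hn (hψ n m (hK (not_lt.1 h) hN))
  let Φ₀ : L →+ (ℕ →₀ AddCircle (1 : ℚ)) :=
    { toFun := fun m => Finsupp.ofSupportFinite (fun n => ψ n m) (hfin m)
      map_zero' := Finsupp.ext fun n => map_zero (ψ n)
      map_add' := fun a b => Finsupp.ext fun n => map_add (ψ n) (a : M) b }
  obtain ⟨Φ, hΦ⟩ := (Module.Baer.of_divisible _).extension_property_addMonoidHom L.subtype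
    Subtype.val_injective Φ₀
  have hΦ' : ∀ m (hm : m ∈ L) n, Φ m n = ψ n m := fun m hm n =>
    DFunLike.congr_fun (DFunLike.congr_fun hΦ ⟨m, hm⟩) n
  refine ⟨Φ, fun m hm => Finsupp.ext fun n => ?_, fun n => ?_⟩
  · rw [hΦ' m ((hL m).2 ⟨0, hm⟩), hψ n m (hK (Nat.zero_le n) hm)]
    rfl
  · rw [hΦ' _ ((hL _).2 ⟨n + 1, hz n⟩)]
    exact hψz n

/-- If no finite subset of `Z` generates `Z` modulo `B`, there is a sequence in `Z` each of whose
terms is not generated modulo `B` by the preceding ones. -/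
theorem exists_chain {M : Type*} [AddCommGroup M] (Z : Set M) (B : AddSubgroup M)
    (h : ∀ s : Finset M, (s : Set M) ⊆ Z → ¬ Z ⊆ (AddSubgroup.closure (s : Set M) ⊔ B : _)) :
    ∃ (K : ℕ → AddSubgroup M) (z : ℕ → M), Monotone K ∧ B ≤ K 0 ∧ (∀ n, z n ∈ Z) ∧
      (∀ n, z n ∈ K (n + 1)) ∧ ∀ n, z n ∉ K n := by
  classical
  have h' : ∀ s : {s : Finset M // (s : Set M) ⊆ Z}, ∃ z ∈ Z,
      z ∉ AddSubgroup.closure (s.1 : Set M) ⊔ B := fun s => Set.not_subset.1 (h s.1 s.2)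
  choose c hc hc' using h'
  let s : ℕ → {s : Finset M // (s : Set M) ⊆ Z} := fun n =>
    Nat.rec ⟨∅, by simp⟩ (fun _ s => ⟨insert (c s) s.1, by
      rw [Finset.coe_insert]
      exact Set.insert_subset (hc s) s.2⟩) n
  have hs : ∀ n, (s (n + 1)).1 = insert (c (s n)) (s n).1 := fun n => rfl
  refine ⟨fun n => AddSubgroup.closure ((s n).1 : Set M) ⊔ B, fun n => c (s n),
    monotone_nat_of_le_succ fun n => ?_, le_sup_right, fun n => hc _, fun n => ?_, fun n => hc' _⟩
  · refine sup_le_sup_right (AddSubgroup.closure_mono ?_) _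
    rw [hs, Finset.coe_insert]
    exact Set.subset_insert _ _
  · refine AddSubgroup.mem_sup_left (AddSubgroup.subset_closure ?_)
    rw [hs, Finset.coe_insert]
    exact Set.mem_insert _ _

variable {A : Type u} [Ring A] {𝒜 : DGAlg A}

/-! ### Modules on which the algebra acts through an augmentation -/

/-- The right module on an abelian group given by an augmentation, concentrated in one degree. -/
def augmentationMod {ε : A →+* ℤ} (hε : ∀ g ≠ 0, ∀ a ∈ 𝒜.deg g, ε a = 0)
    (hd : ∀ a, ε (𝒜.d a) = 0) (J : Type u) [AddCommGroup J] (g : ℤ × ℤ) : DGMod 𝒜 :=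
  letI : Module Aᵐᵒᵖ J := Module.compHom J (RingHom.fromOpposite ε fun _ _ => Commute.all _ _)
  { carrier := J
    str :=
      { deg := fun h => if h = g then ⊤ else ⊥
        isInternal := isInternal_concentrated J g
        smul_mem := fun {g₁ h m a} hm ha => by
          change ε a • m ∈ _
          by_cases hh : h = 0
          · subst hh
            rw [add_zero]
            exact AddSubgroup.zsmul_mem _ hm _
          · rw [hε h hh a ha, zero_smul]
            exact AddSubgroup.zero_mem _
        d := 0
        d_mem := fun _ => AddSubgroup.zero_mem _
        d_d := fun _ => rfl
        leibniz := fun {g₁ m} _ a => by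
          have h1 : op (𝒜.d a) • m = 0 := by
            change ε (𝒜.d a) • m = 0
            rw [hd, zero_smul]
          rw [h1]
          simp } }

/-! ### Homogeneous submodules and maps into direct sums -/

namespace DGStr

variable {M : Type u} [AddCommGroup M] [Module Aᵐᵒᵖ M]

/-- The structure of a differential bigraded module on a homogeneous submodule that is stable under
the differential. -/
def restrict (S : DGStr 𝒜 M) (P : Submodule Aᵐᵒᵖ M)
    (hP : ∀ g, ∀ m ∈ P, component S.isInternal g m ∈ P) (hd : ∀ m ∈ P, S.d m ∈ P) :
    DGStr 𝒜 P where
  deg g := (S.deg g).comap P.subtype.toAddMonoidHom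
  isInternal := by
    classical
    constructor
    · rw [injective_iff_map_eq_zero]
      intro x hx
      ext i
      exact map_coe_eq_zero _ S.deg S.isInternal.1 P.subtype.toAddMonoidHom (fun _ _ hx => hx) x
        hx i
    · rintro ⟨x, hx⟩
      obtain ⟨s, hs⟩ := exists_finset_sum_component S.isInternal x
      refine ⟨∑ g ∈ s, DirectSum.of _ g ⟨⟨component S.isInternal g x, hP g x hx⟩,
        component_mem S.isInternal g x⟩, Subtype.ext ?_⟩
      rw [map_sum, AddSubmonoidClass.coe_finsetSum]
      refine Eq.trans ?_ hs.symm
      refine Finset.sum_congr rfl fun g _ => ?_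
      rw [DirectSum.coeAddMonoidHom_of]
  smul_mem := fun hm ha => S.smul_mem hm ha
  d := (S.d.comp P.subtype.toAddMonoidHom).codRestrict P.toAddSubgroup (fun x => hd x x.2)
  d_mem := fun hm => S.d_mem hm
  d_d := fun m => Subtype.ext (S.d_d m)
  leibniz := fun {g m} hm a => Subtype.ext (by
    have h1 := S.leibniz hm a
    rw [Units.smul_def] at h1 ⊢
    exact h1)

theorem isMorphism_subtype (S : DGStr 𝒜 M) (P : Submodule Aᵐᵒᵖ M)
    (hP : ∀ g, ∀ m ∈ P, component S.isInternal g m ∈ P) (hd : ∀ m ∈ P, S.d m ∈ P) :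
    IsMorphism (S.restrict P hP hd) S P.subtype :=
  isMorphism_iff.2 ⟨fun _ _ hm => hm, fun _ => rfl⟩

/-- The hypothesis `h` says that the quotient of `M` by `P` is acyclic. A cycle `(m, p)` of the cone
has `p = - d m`, and the element `m - d m'` of `P` is the second coordinate of its primitive. -/
theorem isAcyclic_cone_subtype (S : DGStr 𝒜 M) (P : Submodule Aᵐᵒᵖ M)
    (hP : ∀ g, ∀ m ∈ P, component S.isInternal g m ∈ P) (hd : ∀ m ∈ P, S.d m ∈ P)
    (h : ∀ m, S.d m ∈ P → ∃ m', m - S.d m' ∈ P) :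
    (cone (S.restrict P hP hd) S P.subtype (S.isMorphism_subtype P hP hd)).IsAcyclic := by
  rintro ⟨m, p⟩ hmp
  rw [cone_d] at hmp
  have h1 : S.d m + p = 0 := congrArg Prod.fst hmp
  have h2 : (p : M) = - S.d m := by rw [eq_neg_iff_add_eq_zero, add_comm, h1]
  obtain ⟨m', hm'⟩ := h m (by
    have := P.neg_mem p.2
    rwa [h2, neg_neg] at this)
  refine ⟨(m', ⟨_, hm'⟩), ?_⟩
  rw [cone_d]
  refine Prod.ext ?_ (Subtype.ext ?_)
  · change S.d m' + (m - S.d m') = m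
    abel
  · change - S.d (m - S.d m') = p
    rw [h2, map_sub, S.d_d, sub_zero]

/-- The morphism to a direct sum with given components, finitely many of which are nonzero on each
element. -/
def toDirectSum {I : Type u} {D : I → Type u} [∀ i, AddCommGroup (D i)]
    [∀ i, Module Aᵐᵒᵖ (D i)] (f : ∀ i, M →ₗ[Aᵐᵒᵖ] D i) (hf : ∀ m, {i | f i m ≠ 0}.Finite) :
    M →ₗ[Aᵐᵒᵖ] ⨁ i, D i :=
  letI := Classical.decEq I
  have key : ∀ m i, (DFinsupp.mk (β := D) (hf m).toFinset fun i => f i m) i = f i m := by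
    intro m i
    rw [DFinsupp.mk_apply]
    split_ifs with h
    · rfl
    · rw [Set.Finite.mem_toFinset, Set.mem_ofPred_eq, not_not] at h
      exact h.symm
  { toFun := fun m => DFinsupp.mk (hf m).toFinset fun i => f i m
    map_add' := fun a b => DFinsupp.ext fun i => by
      rw [key, DFinsupp.add_apply, key, key, map_add]
    map_smul' := fun c a => DFinsupp.ext fun i => by
      rw [key, RingHom.id_apply, DFinsupp.smul_apply, key, map_smul] }

theorem toDirectSum_apply {I : Type u} {D : I → Type u} [∀ i, AddCommGroup (D i)]
    [∀ i, Module Aᵐᵒᵖ (D i)] (f : ∀ i, M →ₗ[Aᵐᵒᵖ] D i) (hf : ∀ m, {i | f i m ≠ 0}.Finite) (m : M)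
    (i : I) : toDirectSum f hf m i = f i m := by
  classical
  change (DFinsupp.mk (hf m).toFinset fun i : ((hf m).toFinset : Set I) => f i m) i = f i m
  rw [DFinsupp.mk_apply]
  split_ifs with h
  · rfl
  · rw [Set.Finite.mem_toFinset, Set.mem_ofPred_eq, not_not] at h
    exact h.symm

theorem isMorphism_toDirectSum {I : Type u} {D : I → Type u} [∀ i, AddCommGroup (D i)]
    [∀ i, Module Aᵐᵒᵖ (D i)] {S : DGStr 𝒜 M} {T : ∀ i, DGStr 𝒜 (D i)} (f : ∀ i, M →ₗ[Aᵐᵒᵖ] D i)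
    (hf : ∀ m, {i | f i m ≠ 0}.Finite) (h : ∀ i, IsMorphism S (T i) (f i)) :
    IsMorphism S (directSum T) (toDirectSum f hf) := by
  refine isMorphism_iff.2 ⟨fun g m hm i => ?_, fun m => DFinsupp.ext fun i => ?_⟩
  · rw [toDirectSum_apply]
    exact (isMorphism_iff.1 (h i)).1 g m hm
  · rw [directSum_d_apply, toDirectSum_apply, toDirectSum_apply, morphism_d (h i)]

end DGStr

end BigradedDG

namespace BigradedDG

open MulOpposite (op)

variable {A : Type u} [Ring A] {𝒜 : DGAlg A}

/-! ### Finite generation of the homology at a minimal remaining vertex -/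

namespace TriangularSystem

variable {V : Type u} [Fintype V] [PartialOrder V] (Θ : TriangularSystem 𝒜 V)
variable {M : Type u} [AddCommGroup M] [Module Aᵐᵒᵖ M]

theorem smul_smul_eq_sum (w : V) (a : A) (m : M) :
    op (Θ.e w) • op a • m = ∑ j, op (Θ.e j * a * Θ.e w) • m := by
  conv_lhs => rw [← Θ.sum_smul m, Finset.smul_sum, Finset.smul_sum]
  refine Finset.sum_congr rfl fun j _ => ?_
  rw [smul_smul, smul_smul, ← MulOpposite.op_mul, ← MulOpposite.op_mul, ← mul_assoc]

/-- The submodule of elements that are annihilated by the idempotents of a lower set. -/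
def annihilated (M : Type u) [AddCommGroup M] [Module Aᵐᵒᵖ M] {U : Set V} (hU : IsLowerSet U) :
    Submodule Aᵐᵒᵖ M where
  carrier := {m | ∀ w ∈ U, op (Θ.e w) • m = 0}
  zero_mem' := fun _ _ => smul_zero _
  add_mem' := fun ha hb w hw => by rw [smul_add, ha w hw, hb w hw, add_zero]
  smul_mem' := fun c m hm w hw => by
    rw [← MulOpposite.op_unop c, smul_smul_eq_sum]
    refine Finset.sum_eq_zero fun j _ => ?_
    -- Only the terms with `j ≤ w` survive triangularity, and then `j` lies in the lower set, so `m`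
    -- is already annihilated by `e j`.
    by_cases hj : j ≤ w
    · rw [mul_assoc, MulOpposite.op_mul, mul_smul, hm j (hU hj hw), smul_zero]
    · rw [Θ.mul_mul_of_not_le hj, MulOpposite.op_zero, zero_smul]

theorem component_mem_annihilated (S : DGStr 𝒜 M) {U : Set V} (hU : IsLowerSet U) (g : ℤ × ℤ)
    (m : M) (hm : m ∈ Θ.annihilated M hU) :
    component S.isInternal g m ∈ Θ.annihilated M hU := fun w hw => by
  rw [← S.component_smul (Θ.mem w), hm w hw, map_zero]

theorem d_mem_annihilated (S : DGStr 𝒜 M) {U : Set V} (hU : IsLowerSet U)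
    (m : M) (hm : m ∈ Θ.annihilated M hU) : S.d m ∈ Θ.annihilated M hU := fun w hw => by
  rw [← S.d_smul (Θ.d_eq w), hm w hw, map_zero]

/-- The submodule `annihilated` as a differential bigraded module. -/
abbrev annihilatedStr (S : DGStr 𝒜 M) {U : Set V} (hU : IsLowerSet U) :
    DGStr 𝒜 (Θ.annihilated M hU) :=
  S.restrict _ (Θ.component_mem_annihilated S hU) (Θ.d_mem_annihilated S hU)

/-- If `d m` is annihilated, then each `m e w` with `w ∈ U` is a cycle and, by exactness, a
boundary. Subtracting these boundaries moves `m` into the annihilated submodule, so the inclusion is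
a quasi-isomorphism. -/
theorem isAcyclic_cone_annihilated (S : DGStr 𝒜 M) {U : Set V} (hU : IsLowerSet U)
    (hex : ∀ w ∈ U, S.ExactAt (Θ.e w)) :
    ((Θ.annihilatedStr S hU).cone S (Θ.annihilated M hU).subtype
      (S.isMorphism_subtype _ (Θ.component_mem_annihilated S hU)
        (Θ.d_mem_annihilated S hU))).IsAcyclic := by
  classical
  refine S.isAcyclic_cone_subtype _ _ _ fun m hm => ?_
  have h1 : ∀ w, ∃ n, w ∈ U → S.d n = op (Θ.e w) • m := by
    intro w
    by_cases hw : w ∈ U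
    · obtain ⟨n, hn⟩ := hex w hw (op (Θ.e w) • m) (DGStr.smul_smul_self (Θ.mul_self w) m) (by
        rw [S.d_smul (Θ.d_eq w)]
        exact hm w hw)
      exact ⟨n, fun _ => hn⟩
    · exact ⟨0, fun h => absurd h hw⟩
  choose n hn using h1
  refine ⟨∑ w, op (Θ.e w) • n w, fun w hw => ?_⟩
  rw [smul_sub, ← S.d_smul (Θ.d_eq w), Finset.smul_sum, Finset.sum_eq_single w,
    DGStr.smul_smul_self (Θ.mul_self w), S.d_smul (Θ.d_eq w), hn w hw,
    DGStr.smul_smul_self (Θ.mul_self w), sub_self]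
  · exact fun j _ hj => Θ.smul_smul_of_ne hj _
  · simp

/-- On the annihilated submodule, the algebra acts on the image of a minimal remaining idempotent
through the augmentation. -/
theorem smul_smul_of_mem_annihilated {U : Set V} (hU : IsLowerSet U) {k : V}
    (hk : ∀ w < k, w ∈ U) {m : M} (hm : m ∈ Θ.annihilated M hU) (a : A) :
    op (Θ.e k) • op a • m = Θ.ε k a • op (Θ.e k) • m := by
  rw [smul_smul_eq_sum, Finset.sum_eq_single k]
  · rw [Θ.mul_mul_self, MulOpposite.op_smul, smul_assoc]
  · intro j _ hj
    by_cases h : j ≤ k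
    · rw [mul_assoc, MulOpposite.op_mul, mul_smul, hm j (hk j (lt_of_le_of_ne h hj)), smul_zero]
    · rw [Θ.mul_mul_of_not_le h, MulOpposite.op_zero, zero_smul]
  · simp

/-- The homogeneous cycles of `M e`. -/
def _root_.BigradedDG.DGStr.homogeneousCycles (S : DGStr 𝒜 M) (e : A) : Set M :=
  {z | (∃ g, z ∈ S.deg g) ∧ op e • z = z ∧ S.d z = 0}

/-- A compact projective module that is exact at all idempotents of a lower set has no infinite
independent sequence of homology classes at a minimal remaining idempotent. -/
theorem not_exists_chain {S : DGStr 𝒜 M} (hP : S.IsProjective) (hC : S.IsCompact) {U : Set V}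
    (hU : IsLowerSet U) (hex : ∀ w ∈ U, S.ExactAt (Θ.e w)) {k : V} (hk : ∀ w < k, w ∈ U)
    {K : ℕ → AddSubgroup M} (hK : Monotone K) (hK0 : S.d.range ≤ K 0) {z : ℕ → M}
    (hz : ∀ n, z n ∈ S.homogeneousCycles (Θ.e k)) (hzK : ∀ n, z n ∈ K (n + 1)) :
    ∃ n, z n ∈ K n := by
  by_contra! hzK'
  obtain ⟨Φ, hΦ, hΦz⟩ := exists_hom_finsupp hK hzK hzK'
  choose g hg using fun n => (hz n).1
  have hΦd : ∀ m, Φ (S.d m) = 0 := fun m => hΦ _ (hK0 ⟨m, rfl⟩)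
  -- The n-th character, restricted to the part of `M e k` in the degree of `z n`, so that it is
  -- homogeneous and can be nonzero on `z n`.
  let φ : ℕ → M → AddCircle (1 : ℚ) := fun n m =>
    Φ (component S.isInternal (g n) (op (Θ.e k) • m)) n
  have hφd : ∀ n m, φ n (S.d m) = 0 := by
    intro n m
    have h1 : g n = (g n - (1, 0)) + (1, 0) := by abel
    simp only [φ]
    rw [← S.d_smul (Θ.d_eq k), h1, S.component_d, hΦd]
    rfl
  have hφadd : ∀ n a b, φ n (a + b) = φ n a + φ n b := fun n a b => by
    simp only [φ, smul_add, map_add]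
    rfl
  have hφz : ∀ n, φ n (z n) ≠ 0 := fun n => by
    simp only [φ]
    rw [(hz n).2.1, component_of_mem _ (hg n)]
    exact hΦz n
  have hφfin : ∀ m, {n | φ n m ≠ 0}.Finite := by
    intro m
    refine ((finite_component_ne_zero S.isInternal (op (Θ.e k) • m)).biUnion fun h _ =>
      (Φ (component S.isInternal h (op (Θ.e k) • m))).support.finite_toSet).subset fun n hn => ?_
    refine Set.mem_biUnion (x := g n) ?_ ?_
    · intro h0
      refine hn ?_
      simp only [φ]
      rw [h0, map_zero]
      rfl
    · exact Finsupp.mem_support_iff.2 hn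
  -- The group and the index set are lifted because compactness is tested on families in universe
  -- `u`.
  let J := ULift.{u} (AddCircle (1 : ℚ))
  let T : ULift.{u} ℕ → DGMod 𝒜 := fun n =>
    augmentationMod (fun g hg a ha => Θ.ε_of_mem (v := k) hg ha) (Θ.ε_d k) J (g n.down)
  -- Linearity over `A` holds only on the annihilated submodule, where the action on the k-part
  -- factors through `ε k`.
  let f : ∀ n : ULift.{u} ℕ, Θ.annihilated M hU →ₗ[Aᵐᵒᵖ] (T n).carrier := fun n =>
    { toFun := fun m => (ULift.up (φ n.down m) : J)
      map_add' := fun a b => congrArg ULift.up (hφadd n.down a b)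
      map_smul' := fun c m => by
        change (ULift.up (φ n.down (c • (m : M))) : J) = Θ.ε k c.unop • (ULift.up (φ n.down m) : J)
        have h1 := Θ.smul_smul_of_mem_annihilated hU hk m.2 c.unop
        rw [MulOpposite.op_unop] at h1
        simp only [φ]
        rw [h1, map_zsmul, map_zsmul]
        rfl }
  have hf : ∀ m, {n | f n m ≠ 0}.Finite := fun m => by
    refine ((hφfin m).preimage (ULift.down_injective.injOn)).subset fun n hn h0 => hn ?_
    exact congrArg ULift.up h0
  have hfm : ∀ n, (Θ.annihilatedStr S hU).IsMorphism (T n).str (f n) := fun n => by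
    rw [DGStr.isMorphism_iff]
    refine ⟨fun h m hm => ?_, fun m => ?_⟩
    · by_cases hh : h = g n.down
      · change _ ∈ (if h = g n.down then (⊤ : AddSubgroup J) else ⊥)
        rw [if_pos hh]
        exact AddSubgroup.mem_top _
      · have h1 : φ n.down m = 0 := by
          have hm' : (m : M) ∈ S.deg h := hm
          simp only [φ]
          rw [component_of_mem_ne S.isInternal (S.smul_mem_of_mem_zero (Θ.mem k) hm') hh, map_zero]
          rfl
        have h2 : f n m = 0 := congrArg ULift.up h1
        rw [h2]
        exact AddSubgroup.zero_mem _
    · exact (congrArg (ULift.up : AddCircle (1 : ℚ) → J) (hφd n.down m)).symm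
  have hΨ := DGStr.isMorphism_toDirectSum f hf hfm
  -- Projectivity transports the map from the submodule to all of `M`: it is precomposed with a
  -- homotopy section `s` of the inclusion.
  obtain ⟨s, hs, hsid⟩ := hP.exists_section _ (Θ.isAcyclic_cone_annihilated S hU hex)
  obtain ⟨F, hF⟩ := DGStr.isCompact_iff.1 hC _ _ (fun n => (T n).str) _ (hΨ.comp_mem_cycles hs)
  obtain ⟨n, hn⟩ := Infinite.exists_notMem_finset F
  obtain ⟨h, -, hh⟩ := DGStr.mem_boundaries_zero.1 hF
  obtain ⟨h', -, hh'⟩ := DGStr.mem_boundaries_zero.1 hsid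
  -- The summands have zero differential and `z n` is a cycle, so both terms of the homotopy vanish
  -- on `z n` in a summand outside of `F`. But `s (z n)` differs from `z n` by a boundary, on which
  -- the character vanishes.
  have h1 := DFunLike.congr_fun (hh (z n.down)) n
  rw [(hz n.down).2.2, map_zero, add_zero, DGStr.directSum_d_apply, LinearMap.comp_apply,
    DGStr.dropProj_apply, if_neg hn, LinearMap.comp_apply, DGStr.toDirectSum_apply] at h1
  have h2 : φ n.down (s (z n.down)) = 0 := congrArg ULift.down h1
  have h3 := hh' (z n.down)
  rw [(hz n.down).2.2, map_zero, add_zero] at h3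
  have h4 : (s (z n.down) : M) = S.d (h' (z n.down)) + z n.down := by
    rw [← h3]
    simp
  rw [h4, hφadd, hφd, zero_add] at h2
  exact hφz _ h2

/-- The homology at a minimal remaining idempotent is finitely generated. -/
theorem exists_generators {S : DGStr 𝒜 M} (hP : S.IsProjective) (hC : S.IsCompact) {U : Set V}
    (hU : IsLowerSet U) (hex : ∀ w ∈ U, S.ExactAt (Θ.e w)) {k : V} (hk : ∀ w < k, w ∈ U) :
    ∃ (p : ℕ) (x : Fin p → M), (∀ i, x i ∈ S.homogeneousCycles (Θ.e k)) ∧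
      ∀ z, op (Θ.e k) • z = z → S.d z = 0 → ∃ (c : Fin p → ℤ) (m : M),
        z = ∑ i, c i • x i + S.d m := by
  classical
  by_contra hcon
  have h0 : ∀ s : Finset M, (s : Set M) ⊆ S.homogeneousCycles (Θ.e k) →
      ¬ S.homogeneousCycles (Θ.e k) ⊆ (AddSubgroup.closure (s : Set M) ⊔ S.d.range : _) := by
    intro s hs hsub
    apply hcon
    refine ⟨s.card, fun i => s.equivFin.symm i, fun i => hs (s.equivFin.symm i).2,
      fun z hez hdz => ?_⟩
    have h1 : z ∈ AddSubgroup.closure (s : Set M) ⊔ S.d.range := by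
      -- The homogeneous components of a cycle in `M e k` are again cycles there, so homogeneous
      -- generators suffice.
      obtain ⟨t, ht⟩ := exists_finset_sum_component S.isInternal z
      rw [ht]
      refine AddSubgroup.sum_mem _ fun g _ => hsub ⟨⟨g, component_mem _ _ _⟩, ?_, ?_⟩
      · rw [← S.component_smul (Θ.mem k), hez]
      · rw [← S.component_d, hdz, map_zero]
    obtain ⟨y, hy, -, ⟨m, rfl⟩, rfl⟩ := AddSubgroup.mem_sup.1 h1
    have h2 : y ∈ Submodule.span ℤ (Set.range fun i => (s.equivFin.symm i : M)) := by
      have h3 : (Set.range fun i => (s.equivFin.symm i : M)) = s := by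
        ext x
        constructor
        · rintro ⟨i, rfl⟩
          exact (s.equivFin.symm i).2
        · intro hx
          exact ⟨s.equivFin ⟨x, hx⟩, by simp⟩
      rw [h3, ← Submodule.mem_toAddSubgroup, Submodule.span_int_eq_addSubgroupClosure]
      exact hy
    obtain ⟨c, rfl⟩ := (Submodule.mem_span_range_iff_exists_fun ℤ).1 h2
    exact ⟨c, m, rfl⟩
  obtain ⟨K, z, hK, hK0, hz, hzK, hzK'⟩ := exists_chain _ _ h0
  obtain ⟨n, hn⟩ := Θ.not_exists_chain hP hC hU hex hk hK hK0 hz hzK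
  exact hzK' n hn

end TriangularSystem

end BigradedDG

namespace BigradedDG

open MulOpposite (op)

variable {A : Type u} [Ring A] {𝒜 : DGAlg A}

/-! ### Attaching cells -/

/-- The homology of `M e` is generated by the classes of `x` and `y`, which are homogeneous, and the
classes of `y` are independent modulo those of `x`. -/
structure IsPresentation {M : Type u} [AddCommGroup M] [Module Aᵐᵒᵖ M] (S : DGStr 𝒜 M) (e : A)
    {p q : ℕ} (x : Fin p → M) (y : Fin q → M) : Prop where
  left_mem : ∀ i, x i ∈ S.homogeneousCycles e
  right_mem : ∀ j, y j ∈ S.homogeneousCycles e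
  exists_eq : ∀ z, op e • z = z → S.d z = 0 → ∃ (c : Fin p → ℤ) (b : Fin q → ℤ) (m : M),
    z = ∑ i, c i • x i + ∑ j, b j • y j + S.d m
  eq_zero : ∀ (c : Fin p → ℤ) (b : Fin q → ℤ) (m : M), op e • m = m →
    ∑ i, c i • x i + ∑ j, b j • y j = S.d m → b = 0

namespace TriangularSystem

variable {V : Type u} [Fintype V] [PartialOrder V] (Θ : TriangularSystem 𝒜 V)

section Cell

variable {M : Type u} [AddCommGroup M] [Module Aᵐᵒᵖ M] {S : DGStr 𝒜 M} {k : V} {s : ℤ × ℤ} {x : M}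
  (hx : x ∈ S.deg s) (hdx : S.d x = 0)

/-- The module `e k A`, with the structure of a differential bigraded module. -/
abbrev projStr (k : V) : DGStr 𝒜 (idempotentModule (Θ.e k)) :=
  idempotentStr (Θ.mul_self k) (Θ.mem k) (Θ.d_eq k)

/-- The cone of the map `e k A{s} ⟶ M` that corresponds to a cycle `x` of degree `s`. -/
abbrev attachStr (k : V) {s : ℤ × ℤ} {x : M} (hx : x ∈ S.deg s) (hdx : S.d x = 0) :
    DGStr 𝒜 (M × idempotentModule (Θ.e k)) :=
  ((Θ.projStr k).shift s).cone S (evalMap (Θ.e k) x)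
    (evalMap_isMorphism (Θ.mul_self k) (Θ.mem k) (Θ.d_eq k) hx hdx)

/-- The generator of `e k A`. -/
def gen (k : V) : idempotentModule (Θ.e k) := ⟨Θ.e k, Θ.mul_self k⟩

theorem smul_gen_eq_zero {n : ℤ} : n • Θ.gen k = 0 ↔ n = 0 := by
  rw [← Θ.smul_e_eq_zero (v := k)]
  exact Subtype.ext_iff

theorem op_smul_gen : op (Θ.e k) • Θ.gen k = Θ.gen k := Subtype.ext (Θ.mul_self k)

/-- Such an element equals `e k * a * e k`, which is an integer multiple of `e k`. -/
theorem exists_eq_smul_gen {a : idempotentModule (Θ.e k)} (ha : op (Θ.e k) • a = a) :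
    ∃ n : ℤ, a = n • Θ.gen k := by
  refine ⟨Θ.ε k a, Subtype.ext ?_⟩
  have h1 : (a : A) * Θ.e k = a := congrArg Subtype.val ha
  have h2 : Θ.e k * (a : A) = a := a.2
  change (a : A) = Θ.ε k a • Θ.e k
  rw [← Θ.mul_mul_self, h2, h1]

theorem attachStr_d_gen (hex : op (Θ.e k) • x = x) (m : M) (n : ℤ) :
    (Θ.attachStr k hx hdx).d (m, n • Θ.gen k) = (S.d m + n • x, 0) := by
  rw [DGStr.cone_d]
  have h1 : (Θ.projStr k).d (Θ.gen k) = 0 := Subtype.ext (Θ.d_eq k)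
  have h2 : evalMap (Θ.e k) x (Θ.gen k) = x := hex
  refine Prod.ext ?_ ?_
  · rw [map_zsmul, h2]
  · change -(s.1.negOnePow • (Θ.projStr k).d (n • Θ.gen k)) = 0
    rw [map_zsmul, h1, smul_zero, smul_zero, neg_zero]

theorem gen_mem_deg {g : ℤ × ℤ} (hg : g + (1, 0) = s) (n : ℤ) :
    n • Θ.gen k ∈ ((Θ.projStr k).shift s).deg (g + (1, 0)) := by
  refine AddSubgroup.zsmul_mem _ ?_ n
  rw [hg, DGStr.mem_shift_deg, sub_self]
  exact Θ.mem k

theorem inl_mem_homogeneousCycles {z : M} (hz : z ∈ S.homogeneousCycles (Θ.e k)) :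
    ((z, 0) : M × idempotentModule (Θ.e k)) ∈
      (Θ.attachStr k hx hdx).homogeneousCycles (Θ.e k) := by
  obtain ⟨⟨g, hg⟩, he, hd⟩ := hz
  refine ⟨⟨g, (DGStr.mem_cone_deg _).2 ⟨hg, AddSubgroup.zero_mem _⟩⟩,
    Prod.ext he (smul_zero _), ?_⟩
  rw [DGStr.cone_d]
  simp [hd]

/-- At `e w` the new cell contributes `e k A e w`, which is zero, so the cone looks like `M` there.
-/
theorem attachStr_exactAt {w : V} (hw : ¬ k ≤ w) (h : S.ExactAt (Θ.e w)) :
    (Θ.attachStr k hx hdx).ExactAt (Θ.e w) := by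
  rintro ⟨m, a⟩ hma hd
  have ha : a = 0 := by
    have h1 : (a : A) * Θ.e w = a := congrArg (fun z => (z.2 : A)) hma
    have h2 : Θ.e k * (a : A) = a := a.2
    refine Subtype.ext ?_
    rw [← h1, ← h2, Θ.mul_mul_of_not_le hw]
    rfl
  subst ha
  rw [DGStr.cone_d] at hd
  obtain ⟨m', hm'⟩ := h m (congrArg Prod.fst hma) (by simpa using congrArg Prod.fst hd)
  refine ⟨(m', 0), ?_⟩
  rw [DGStr.cone_d]
  simp [hm']

/-- A sum in the first summand of a cone. -/
theorem sum_inl {E : Type*} [AddCommGroup E] {p : ℕ} (c : Fin p → ℤ) (x : Fin p → M) :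
    ∑ i, c i • ((x i, 0) : M × E) = (∑ i, c i • x i, 0) := by
  ext
  · simp [Prod.fst_sum]
  · simp [Prod.snd_sum]

section Attach

variable {p q : ℕ} {y : Fin q → M}

/-- Boundaries in the cone of the idempotent component. -/
theorem attachStr_eq_of_fixed (hex : op (Θ.e k) • x = x) {w : M × idempotentModule (Θ.e k)}
    (hw : op (Θ.e k) • w = w) : ∃ (m : M) (n : ℤ), op (Θ.e k) • m = m ∧ w = (m, n • Θ.gen k) ∧
      (Θ.attachStr k hx hdx).d w = (S.d m + n • x, 0) := by
  obtain ⟨m, a⟩ := w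
  obtain ⟨n, rfl⟩ := Θ.exists_eq_smul_gen (k := k) (a := a) (congrArg Prod.snd hw)
  exact ⟨m, n, congrArg Prod.fst hw, rfl, Θ.attachStr_d_gen hx hdx hex m n⟩

/-- Attaching a cell along the last independent generator. -/
theorem isPresentation_attach_right {x' : Fin p → M} {y : Fin (q + 1) → M}
    (h : IsPresentation S (Θ.e k) x' y) {s : ℤ × ℤ} (hs : y 0 ∈ S.deg s) :
    IsPresentation (Θ.attachStr k hs (h.right_mem 0).2.2) (Θ.e k) (fun i => (x' i, 0))
      (fun j : Fin q => (y j.succ, 0)) where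
  left_mem i := Θ.inl_mem_homogeneousCycles _ _ (h.left_mem i)
  right_mem j := Θ.inl_mem_homogeneousCycles _ _ (h.right_mem _)
  exists_eq := by
    intro z hz hdz
    have hy0 := (h.right_mem 0).2
    obtain ⟨m, n, hm, rfl, hd⟩ := Θ.attachStr_eq_of_fixed hs hy0.2 hy0.1 hz
    rw [hdz] at hd
    have h1 : S.d m + n • y 0 = 0 := (congrArg Prod.fst hd).symm
    -- The equation `d m = -n • y 0` is a relation among the generators, and independence forces its
    -- coefficient to vanish: no new cycle appears.
    have hn : n = 0 := by
      have h2 := h.eq_zero 0 (Fin.cons (-n) 0) m hm (by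
        rw [Fin.sum_univ_succ]
        simp only [Pi.zero_apply, zero_smul, Finset.sum_const_zero, zero_add, Fin.cons_zero,
          Fin.cons_succ, add_zero]
        rw [neg_smul, neg_eq_iff_add_eq_zero, add_comm, h1])
      have h3 := congrFun h2 0
      simpa using h3
    subst hn
    rw [zero_smul, add_zero] at h1
    obtain ⟨c, b, m', rfl⟩ := h.exists_eq m hm h1
    -- In the cone `y 0` is the boundary of the new generator, so its coefficient moves into the
    -- boundary term.
    refine ⟨c, fun j => b j.succ, (m', b 0 • Θ.gen k), ?_⟩
    rw [Θ.attachStr_d_gen _ _ hy0.1, sum_inl, sum_inl, Fin.sum_univ_succ]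
    refine Prod.ext ?_ ?_
    · simp only [Prod.fst_add]
      abel
    · simp
  eq_zero := by
    intro c b w hw hsum
    have hy0 := (h.right_mem 0).2
    obtain ⟨m, n, hm, rfl, hd⟩ := Θ.attachStr_eq_of_fixed hs hy0.2 hy0.1 hw
    rw [hd, sum_inl, sum_inl] at hsum
    have h1 : ∑ i, c i • x' i + ∑ j, b j • y j.succ = S.d m + n • y 0 := congrArg Prod.fst hsum
    have h2 := h.eq_zero c (Fin.cons (-n) b) m hm (by
      rw [Fin.sum_univ_succ]
      simp only [Fin.cons_zero, Fin.cons_succ]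
      rw [add_left_comm, h1, neg_smul]
      abel)
    funext j
    have := congrFun h2 j.succ
    simpa using this

/-- Attaching a cell along a generator decreases the number of generators, and creates at most one
new independent generator. -/
theorem exists_isPresentation_attach_left {x' : Fin (p + 1) → M} {y : Fin q → M}
    (h : IsPresentation S (Θ.e k) x' y) {s : ℤ × ℤ} (hs : x' 0 ∈ S.deg s) :
    ∃ (q' : ℕ) (y' : Fin q' → M × idempotentModule (Θ.e k)),
      IsPresentation (Θ.attachStr k hs (h.left_mem 0).2.2) (Θ.e k) (fun i : Fin p => (x' i.succ, 0))
        y' := by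
  have hx0 := (h.left_mem 0).2
  -- The annihilator of the class of `x' 0` in the homology of `M e k`. It is cyclic, and a nonzero
  -- generator `n₀` is the order of the class.
  let I : AddSubgroup ℤ :=
    { carrier := {n | ∃ m, op (Θ.e k) • m = m ∧ S.d m = n • x' 0}
      zero_mem' := ⟨0, smul_zero _, by simp⟩
      add_mem' := by
        rintro a b ⟨m, hm, hm'⟩ ⟨n, hn, hn'⟩
        exact ⟨m + n, by rw [smul_add, hm, hn], by rw [map_add, hm', hn', add_smul]⟩
      neg_mem' := by
        rintro a ⟨m, hm, hm'⟩
        exact ⟨-m, by rw [smul_neg, hm], by rw [map_neg, hm', neg_smul]⟩ }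
  obtain ⟨n₀, hn₀⟩ := Int.subgroup_cyclic I
  have hI : ∀ n m, op (Θ.e k) • m = m → S.d m + n • x' 0 = 0 → ∃ t : ℤ, n = t * n₀ := by
    intro n m hm hn
    have h1 : n ∈ I := ⟨-m, by rw [smul_neg, hm], by
      rw [map_neg, neg_eq_iff_add_eq_zero, hn]⟩
    rw [hn₀] at h1
    obtain ⟨t, ht⟩ := AddSubgroup.mem_closure_singleton.1 h1
    exact ⟨t, by rw [← ht, smul_eq_mul]⟩
  have key : ∀ m, op (Θ.e k) • m = m → S.d m = 0 → ∃ (c : Fin p → ℤ) (b : Fin q → ℤ)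
      (w : M × idempotentModule (Θ.e k)), ((m, 0) : M × idempotentModule (Θ.e k)) =
        ∑ i, c i • ((x' i.succ, 0) : M × idempotentModule (Θ.e k)) + ∑ j, b j • (y j, 0) +
          (Θ.attachStr k hs hx0.2).d w := by
    intro m hm hdm
    obtain ⟨c, b, m', rfl⟩ := h.exists_eq m hm hdm
    refine ⟨fun i => c i.succ, b, (m', c 0 • Θ.gen k), ?_⟩
    rw [Θ.attachStr_d_gen _ _ hx0.1, sum_inl, sum_inl, Fin.sum_univ_succ]
    refine Prod.ext ?_ ?_
    · simp only [Prod.fst_add]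
      abel
    · simp
  have key' : ∀ (c : Fin p → ℤ) (b : Fin q → ℤ) (m : M) (n : ℤ), op (Θ.e k) • m = m →
      ∑ i, c i • x' i.succ + ∑ j, b j • y j = S.d m + n • x' 0 → b = 0 := by
    intro c b m n hm hsum
    refine h.eq_zero (Fin.cons (-n) c) b m hm ?_
    rw [Fin.sum_univ_succ]
    simp only [Fin.cons_zero, Fin.cons_succ]
    rw [add_assoc, hsum, neg_smul]
    abel
  -- A class of infinite order is killed without side effects. A class of finite order `n₀` leaves
  -- the new cycle `(m₀, n₀ • gen)` with `d m₀ = -n₀ • x' 0`.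
  by_cases hn : n₀ = 0
  · subst hn
    refine ⟨q, fun j => (y j, 0), fun i => Θ.inl_mem_homogeneousCycles _ _ (h.left_mem _),
      fun i => Θ.inl_mem_homogeneousCycles _ _ (h.right_mem _), fun z hz hdz => ?_,
      fun c b w hw hsum => ?_⟩
    · obtain ⟨m, n, hm, rfl, hd⟩ := Θ.attachStr_eq_of_fixed hs hx0.2 hx0.1 hz
      rw [hdz] at hd
      have h1 : S.d m + n • x' 0 = 0 := (congrArg Prod.fst hd).symm
      obtain ⟨t, rfl⟩ := hI n m hm h1
      rw [mul_zero, zero_smul, add_zero] at h1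
      rw [mul_zero, zero_smul]
      exact key m hm h1
    · obtain ⟨m, n, hm, rfl, hd⟩ := Θ.attachStr_eq_of_fixed hs hx0.2 hx0.1 hw
      rw [hd, sum_inl, sum_inl] at hsum
      exact key' c b m n hm (congrArg Prod.fst hsum)
  · have hs' : (s - (1, 0)) + (1, 0) = s := by abel
    obtain ⟨m₀, hm₀, hem₀, hdm₀⟩ : ∃ m₀ ∈ S.deg (s - (1, 0)), op (Θ.e k) • m₀ = m₀ ∧
        S.d m₀ = (-n₀) • x' 0 := by
      have h1 : -n₀ ∈ I := by
        rw [hn₀]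
        exact AddSubgroup.neg_mem _ (AddSubgroup.subset_closure rfl)
      obtain ⟨m, -, hm⟩ := h1
      refine DGStr.exists_primitive (Θ.mul_self k) (Θ.mem k) (Θ.d_eq k) ?_ ?_ ⟨m, hm⟩
      · rw [hs']
        exact AddSubgroup.zsmul_mem _ hs _
      · rw [smul_comm, hx0.1]
    refine ⟨q + 1, Fin.cons (m₀, n₀ • Θ.gen k) fun j => (y j, 0),
      fun i => Θ.inl_mem_homogeneousCycles _ _ (h.left_mem _), ?_, fun z hz hdz => ?_,
      fun c b w hw hsum => ?_⟩
    · refine Fin.cases ?_ fun j => ?_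
      · rw [Fin.cons_zero]
        refine ⟨⟨s - (1, 0), (DGStr.mem_cone_deg _).2 ⟨hm₀, Θ.gen_mem_deg hs' n₀⟩⟩,
          Prod.ext hem₀ ?_, ?_⟩
        · change op (Θ.e k) • n₀ • Θ.gen k = n₀ • Θ.gen k
          rw [smul_comm, op_smul_gen]
        · rw [Θ.attachStr_d_gen _ _ hx0.1, hdm₀, neg_smul, neg_add_cancel]
          rfl
      · rw [Fin.cons_succ]
        exact Θ.inl_mem_homogeneousCycles _ _ (h.right_mem _)
    · obtain ⟨m, n, hm, rfl, hd⟩ := Θ.attachStr_eq_of_fixed hs hx0.2 hx0.1 hz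
      rw [hdz] at hd
      have h1 : S.d m + n • x' 0 = 0 := (congrArg Prod.fst hd).symm
      obtain ⟨t, rfl⟩ := hI n m hm h1
      -- The second coordinate of a cycle is a multiple `t * n₀` of the generator, so subtracting
      -- `t` copies of the new cycle leaves a cycle in `M`.
      obtain ⟨c, b, w, hw⟩ := key (m - t • m₀) (by rw [smul_sub, hm, smul_comm, hem₀]) (by
        rw [map_sub, map_zsmul, hdm₀, smul_smul, mul_neg, neg_smul, sub_neg_eq_add, h1])
      refine ⟨c, Fin.cons t b, w, ?_⟩
      rw [Fin.sum_univ_succ]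
      simp only [Fin.cons_zero, Fin.cons_succ]
      rw [add_left_comm, add_assoc, ← hw]
      refine Prod.ext ?_ ?_
      · simp
      · simp [smul_smul]
    · obtain ⟨m, n, hm, rfl, hd⟩ := Θ.attachStr_eq_of_fixed hs hx0.2 hx0.1 hw
      rw [hd, Fin.sum_univ_succ] at hsum
      simp only [Fin.cons_zero, Fin.cons_succ] at hsum
      rw [sum_inl, sum_inl] at hsum
      -- Independence of the new class is read off from the second coordinate, where all other terms
      -- vanish and `n₀ ≠ 0`.
      have h2 : b 0 • n₀ • Θ.gen k = 0 := by simpa using congrArg Prod.snd hsum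
      rw [smul_smul, smul_gen_eq_zero, mul_eq_zero, or_iff_left hn] at h2
      have h1 : ∑ i, c i • x' i.succ + ∑ j, b j.succ • y j = S.d m + n • x' 0 := by
        have := congrArg Prod.fst hsum
        rw [h2] at this
        simpa using this
      have h3 := key' c (fun j => b j.succ) m n hm h1
      funext j
      refine Fin.cases h2 (fun j => ?_) j
      exact congrFun h3 j

end Attach

end Cell

/-! ### Reduction to acyclic modules by attaching cells -/

/-- The compact projective module obtained by attaching a cell. -/
abbrev attach (P : Perf 𝒜) (k : V) {s : ℤ × ℤ} {x : P.carrier} (hx : x ∈ P.str.deg s)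
    (hdx : P.str.d x = 0) : Perf 𝒜 :=
  ((Θ.proj k).shift s).cone P (evalMap (Θ.e k) x)
    (evalMap_isMorphism (Θ.mul_self k) (Θ.mem k) (Θ.d_eq k) hx hdx)

/-- Every compact projective module becomes acyclic after attaching finitely many cells. -/
theorem perf_induction {motive : Perf 𝒜 → Prop}
    (acyclic : ∀ P : Perf 𝒜, P.str.IsAcyclic → motive P)
    (cell : ∀ (P : Perf 𝒜) (k : V) (s : ℤ × ℤ) (x : P.carrier) (hx : x ∈ P.str.deg s)
      (hdx : P.str.d x = 0), motive (Θ.attach P k hx hdx) → motive P) (P : Perf 𝒜) :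
    motive P := by
  classical
  -- Induction on the number of vertices outside of a lower set `U` at which `P` is already exact,
  -- starting from the empty set.
  suffices H : ∀ (n : ℕ) (U : Finset V), Uᶜ.card = n → IsLowerSet (U : Set V) →
      ∀ P : Perf 𝒜, (∀ w ∈ U, P.str.ExactAt (Θ.e w)) → motive P by
    exact H _ ∅ rfl (by simp [IsLowerSet]) P (by simp)
  intro n
  induction n with
  | zero =>
    intro U hU _ P hP
    refine acyclic P (Θ.isAcyclic_of_exactAt fun v => hP v ?_)
    rw [Finset.card_eq_zero, Finset.compl_eq_empty_iff] at hU
    rw [hU]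
    exact Finset.mem_univ v
  | succ n ih =>
    intro U hU hlow P hP
    obtain ⟨k, hk⟩ := (Uᶜ : Finset V).exists_minimal (by
      rw [← Finset.card_pos, hU]
      exact Nat.succ_pos n)
    have hkU : k ∉ U := Finset.mem_compl.1 hk.1
    have hlt : ∀ w < k, w ∈ U := fun w hw => by
      by_contra h
      exact hk.not_prop_of_lt hw (Finset.mem_compl.2 h)
    have hnot : ∀ w ∈ U, ¬ k ≤ w := fun w hw h => hkU (hlow h hw)
    have step : ∀ P : Perf 𝒜, (∀ w ∈ U, P.str.ExactAt (Θ.e w)) → P.str.ExactAt (Θ.e k) →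
        motive P := by
      intro P hP hPk
      refine ih (insert k U) ?_ ?_ P ?_
      · have := Finset.card_compl_add_card U
        have h2 := Finset.card_compl_add_card (insert k U)
        rw [Finset.card_insert_of_notMem hkU] at h2
        omega
      · intro a b hba ha
        rw [Finset.mem_coe, Finset.mem_insert] at ha ⊢
        rcases ha with rfl | ha
        · rcases hba.eq_or_lt with h | h
          · exact Or.inl h
          · exact Or.inr (hlt b h)
        · exact Or.inr (hlow hba ha)
      · intro w hw
        rcases Finset.mem_insert.1 hw with rfl | hw
        · exact hPk
        · exact hP w hw
    -- With only independent generators left, each cell lowers their number by one.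
    have hright : ∀ (q : ℕ) (P : Perf 𝒜), (∀ w ∈ U, P.str.ExactAt (Θ.e w)) →
        ∀ (x : Fin 0 → P.carrier) (y : Fin q → P.carrier),
          IsPresentation P.str (Θ.e k) x y → motive P := by
      intro q
      induction q with
      | zero =>
        intro P hP x y h
        refine step P hP fun z hz hdz => ?_
        obtain ⟨c, b, m, hm⟩ := h.exists_eq z hz hdz
        exact ⟨m, by simpa using hm.symm⟩
      | succ q ihq =>
        intro P hP x y h
        obtain ⟨s, hs⟩ := (h.right_mem 0).1
        refine cell P k s (y 0) hs (h.right_mem 0).2.2 ?_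
        exact ihq _ (fun w hw => Θ.attachStr_exactAt hs (h.right_mem 0).2.2 (hnot w hw) (hP w hw)) _ _
          (Θ.isPresentation_attach_right h hs)
    -- The induction is on `p` alone, for all `q`, since killing one of the first generators may
    -- enlarge the second family.
    have hleft : ∀ (p q : ℕ) (P : Perf 𝒜), (∀ w ∈ U, P.str.ExactAt (Θ.e w)) →
        ∀ (x : Fin p → P.carrier) (y : Fin q → P.carrier),
          IsPresentation P.str (Θ.e k) x y → motive P := by
      intro p
      induction p with
      | zero => exact hright
      | succ p ihp =>
        intro q P hP x y h
        obtain ⟨s, hs⟩ := (h.left_mem 0).1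
        refine cell P k s (x 0) hs (h.left_mem 0).2.2 ?_
        obtain ⟨q', y', h'⟩ := Θ.exists_isPresentation_attach_left h hs
        exact ihp q' _ (fun w hw => Θ.attachStr_exactAt hs (h.left_mem 0).2.2 (hnot w hw) (hP w hw)) _ _ h'
    obtain ⟨p, x, hx, hgen⟩ := Θ.exists_generators P.projective P.compact hlow
      (fun w hw => hP w hw) hlt
    refine hleft p 0 P hP x Fin.elim0 ⟨hx, fun j => j.elim0, fun z hz hdz => ?_,
      fun _ _ _ _ _ => Subsingleton.elim _ _⟩
    obtain ⟨c, m, hm⟩ := hgen z hz hdz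
    exact ⟨c, Fin.elim0, m, by simpa using hm⟩

end TriangularSystem

end BigradedDG

namespace BigradedDG

open MulOpposite (op)

/-! ### Graded Euler characteristics -/

section Euler

/-- The alternating sum over the homological degree of a family of natural numbers. -/
def eulerSum (r : ℤ × ℤ → ℕ) : ℤ[T;T⁻¹] :=
  ∑ᶠ g : ℤ × ℤ, ((g.1.negOnePow : ℤ) * r g) • LaurentPolynomial.T g.2

theorem finite_support_eulerSum {r : ℤ × ℤ → ℕ} (hr : (Function.support r).Finite) :
    (Function.support fun g : ℤ × ℤ =>
      ((g.1.negOnePow : ℤ) * r g) • (LaurentPolynomial.T g.2 : ℤ[T;T⁻¹])).Finite :=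
  hr.subset fun g hg h => hg (by
    have : r g = 0 := h
    simp [this])

theorem eulerSum_add {r r' : ℤ × ℤ → ℕ} (hr : (Function.support r).Finite)
    (hr' : (Function.support r').Finite) :
    eulerSum (fun g => r g + r' g) = eulerSum r + eulerSum r' := by
  rw [eulerSum, eulerSum, eulerSum,
    ← finsum_add_distrib (finite_support_eulerSum hr) (finite_support_eulerSum hr')]
  refine finsum_congr fun g => ?_
  rw [← add_smul]
  push_cast
  ring_nf

theorem eulerSum_shift (r : ℤ × ℤ → ℕ) :
    eulerSum (fun g => r (g + (1, 0))) = - eulerSum r := by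
  rw [eulerSum, eulerSum, ← finsum_neg_distrib]
  refine Eq.trans ?_ (finsum_comp_equiv (Equiv.addRight ((1, 0) : ℤ × ℤ)))
  refine finsum_congr fun g => ?_
  simp [Int.negOnePow_succ]

theorem eulerSum_zero : eulerSum (fun _ => 0) = 0 := by
  simp [eulerSum]

theorem eulerSum_single (k : ℤ) :
    eulerSum (fun g => if g = (0, k) then 1 else 0) = LaurentPolynomial.T k := by
  rw [eulerSum, finsum_eq_single _ (0, k)]
  · simp
  · intro g hg
    simp [hg]

/-- The Euler characteristics in a long exact sequence
`⋯ → C g → N g → M g → C (g - (1, 0)) → ⋯` of finite dimensional vector spaces. -/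
theorem eulerSum_of_exact {C N M : ℤ × ℤ → Type*} [∀ g, AddCommGroup (C g)]
    [∀ g, AddCommGroup (N g)] [∀ g, AddCommGroup (M g)] [∀ g, Module ℚ (C g)] [∀ g, Module ℚ (N g)]
    [∀ g, Module ℚ (M g)] [∀ g, FiniteDimensional ℚ (C g)] [∀ g, FiniteDimensional ℚ (N g)]
    [∀ g, FiniteDimensional ℚ (M g)]
    (hN : (Function.support fun g => Module.finrank ℚ (N g)).Finite)
    (hC : (Function.support fun g => Module.finrank ℚ (C g)).Finite)
    (α : ∀ g, C g →ₗ[ℚ] N g) (β : ∀ g, N g →ₗ[ℚ] M g) (δ : ∀ g, M (g + (1, 0)) →ₗ[ℚ] C g)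
    (h₁ : ∀ g, Function.Exact (α g) (β g)) (h₂ : ∀ g, Function.Exact (β (g + (1, 0))) (δ g))
    (h₃ : ∀ g, Function.Exact (δ g) (α g)) :
    eulerSum (fun g => Module.finrank ℚ (N g)) =
      eulerSum (fun g => Module.finrank ℚ (M g)) + eulerSum (fun g => Module.finrank ℚ (C g)) := by
  have eC : ∀ g, Module.finrank ℚ (C g) =
      Module.finrank ℚ (α g).range + Module.finrank ℚ (δ g).range := fun g => by
    rw [← (LinearMap.exact_iff.1 (h₃ g)), LinearMap.finrank_range_add_finrank_ker]
  have eN : ∀ g, Module.finrank ℚ (N g) =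
      Module.finrank ℚ (β g).range + Module.finrank ℚ (α g).range := fun g => by
    rw [← (LinearMap.exact_iff.1 (h₁ g)), LinearMap.finrank_range_add_finrank_ker]
  have eM : ∀ g, Module.finrank ℚ (M (g + (1, 0))) =
      Module.finrank ℚ (δ g).range + Module.finrank ℚ (β (g + (1, 0))).range := fun g => by
    rw [← (LinearMap.exact_iff.1 (h₂ g)), LinearMap.finrank_range_add_finrank_ker]
  have fα : (Function.support fun g => Module.finrank ℚ (α g).range).Finite :=
    hN.subset fun g hg h => hg (by
      have h' := (eN g).symm.trans h
      change Module.finrank ℚ (α g).range = 0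
      omega)
  have fβ : (Function.support fun g => Module.finrank ℚ (β g).range).Finite :=
    hN.subset fun g hg h => hg (by
      have h' := (eN g).symm.trans h
      change Module.finrank ℚ (β g).range = 0
      omega)
  have fδ : (Function.support fun g => Module.finrank ℚ (δ g).range).Finite :=
    hC.subset fun g hg h => hg (by
      have h' := (eC g).symm.trans h
      change Module.finrank ℚ (δ g).range = 0
      omega)
  have fβ' : (Function.support fun g => Module.finrank ℚ (β (g + (1, 0))).range).Finite :=
    fβ.preimage ((add_left_injective (1, 0)).injOn)
  have hM : eulerSum (fun g => Module.finrank ℚ (M g)) =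
      eulerSum (fun g => Module.finrank ℚ (β g).range) -
        eulerSum (fun g => Module.finrank ℚ (δ g).range) := by
    -- The dimension of `M` is known through exactness only in degrees written as `g + (1, 0)`, so
    -- the sum is reindexed by the homological shift at the cost of a sign.
    have h1 := eulerSum_shift (fun g => Module.finrank ℚ (M g))
    simp only [eM] at h1
    rw [eulerSum_add fδ fβ', eulerSum_shift (fun g => Module.finrank ℚ (β g).range)] at h1
    rw [← neg_eq_iff_eq_neg] at h1
    rw [← h1]
    abel
  rw [hM]
  simp only [eC, eN]
  rw [eulerSum_add fβ fα, eulerSum_add fα fδ]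
  abel

end Euler

/-! ### Subquotients -/

section Subquotient

variable {R X Y : Type*} [Ring R] [AddCommGroup X] [Module R X] [AddCommGroup Y] [Module R Y]

/-- The quotient `Z / (Z ∩ B)` of submodules. -/
abbrev Subquotient (Z B : Submodule R X) : Type _ := Z ⧸ B.submoduleOf Z

namespace Subquotient

variable {Z B : Submodule R X} {Z' B' : Submodule R Y}

/-- The class of an element. -/
def mk (x : X) (hx : x ∈ Z) : Subquotient Z B := (B.submoduleOf Z).mkQ ⟨x, hx⟩

theorem exists_mk (y : Subquotient Z B) : ∃ x hx, y = mk x hx := by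
  obtain ⟨⟨x, hx⟩, rfl⟩ := (B.submoduleOf Z).mkQ_surjective y
  exact ⟨x, hx, rfl⟩

theorem mk_eq_zero {x : X} {hx : x ∈ Z} : (mk x hx : Subquotient Z B) = 0 ↔ x ∈ B :=
  Submodule.Quotient.mk_eq_zero _

theorem mk_eq_mk {x y : X} {hx : x ∈ Z} {hy : y ∈ Z} :
    (mk x hx : Subquotient Z B) = mk y hy ↔ x - y ∈ B :=
  Submodule.Quotient.eq _

/-- The map of subquotients induced by a linear map. -/
def map (f : X →ₗ[R] Y) (hZ : ∀ x ∈ Z, f x ∈ Z') (hB : ∀ x ∈ B, f x ∈ B') :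
    Subquotient Z B →ₗ[R] Subquotient Z' B' :=
  Submodule.mapQ _ _ (f.restrict hZ) fun x hx => hB x hx

end Subquotient

end Subquotient

/-! ### Cohomology with coefficients in an augmentation -/

variable {A : Type u} [Ring A] {𝒜 : DGAlg A}

namespace DGStr

variable {M N L : Type u} [AddCommGroup M] [Module Aᵐᵒᵖ M] [AddCommGroup N] [Module Aᵐᵒᵖ N]
  [AddCommGroup L] [Module Aᵐᵒᵖ L]

/-- The rational functionals on the component of degree `g` on which the algebra acts through the
augmentation `ε`. -/
def functionals (S : DGStr 𝒜 M) (ε : A →+* ℤ) (g : ℤ × ℤ) : Submodule ℚ (M →+ ℚ) where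
  carrier := {f | (∀ a m, f (op a • m) = ε a • f m) ∧ ∀ h, h ≠ g → ∀ m ∈ S.deg h, f m = 0}
  zero_mem' := ⟨fun _ _ => (smul_zero _).symm, fun _ _ _ _ => rfl⟩
  add_mem' := fun hf hf' => ⟨fun a m => by
    rw [AddMonoidHom.add_apply, AddMonoidHom.add_apply, hf.1, hf'.1, smul_add], fun h hh m hm => by
    rw [AddMonoidHom.add_apply, hf.2 h hh m hm, hf'.2 h hh m hm, add_zero]⟩
  smul_mem' := fun c f hf => ⟨fun a m => by
    change c • f _ = ε a • c • f m
    rw [hf.1, smul_comm], fun h hh m hm => by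
    change c • f _ = 0
    rw [hf.2 h hh m hm, smul_zero]⟩

/-- The functionals that vanish on boundaries. -/
def cocycles (S : DGStr 𝒜 M) (ε : A →+* ℤ) (g : ℤ × ℤ) : Submodule ℚ (M →+ ℚ) where
  carrier := {f | f ∈ S.functionals ε g ∧ ∀ m, f (S.d m) = 0}
  zero_mem' := ⟨Submodule.zero_mem _, fun _ => rfl⟩
  add_mem' := fun hf hf' => ⟨Submodule.add_mem _ hf.1 hf'.1, fun m => by
    rw [AddMonoidHom.add_apply, hf.2, hf'.2, add_zero]⟩
  smul_mem' := fun c f hf => ⟨Submodule.smul_mem _ c hf.1, fun m => by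
    change c • f _ = 0
    rw [hf.2, smul_zero]⟩

/-- The functionals that factor through the differential. -/
def coboundaries (S : DGStr 𝒜 M) (ε : A →+* ℤ) (g : ℤ × ℤ) : Submodule ℚ (M →+ ℚ) where
  carrier := {f | ∃ k ∈ S.functionals ε (g + (1, 0)), ∀ m, f m = k (S.d m)}
  zero_mem' := ⟨0, Submodule.zero_mem _, fun _ => rfl⟩
  add_mem' := by
    rintro f f' ⟨k, hk, h⟩ ⟨k', hk', h'⟩
    exact ⟨k + k', Submodule.add_mem _ hk hk', fun m => by
      rw [AddMonoidHom.add_apply, AddMonoidHom.add_apply, h, h']⟩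
  smul_mem' := by
    rintro c f ⟨k, hk, h⟩
    exact ⟨c • k, Submodule.smul_mem _ c hk, fun m => congrArg (c • ·) (h m)⟩

/-- The cohomology of the complex of functionals. -/
abbrev Cohomology (S : DGStr 𝒜 M) (ε : A →+* ℤ) (g : ℤ × ℤ) : Type u :=
  Subquotient (S.cocycles ε g) (S.coboundaries ε g)

/-- Composition with a homomorphism. -/
def precomp (u : M →+ N) : (N →+ ℚ) →ₗ[ℚ] (M →+ ℚ) where
  toFun f := f.comp u
  map_add' _ _ := rfl
  map_smul' _ _ := rfl

theorem precomp_apply (u : M →+ N) (f : N →+ ℚ) (m : M) : precomp u f m = f (u m) := rfl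

section Pull

variable {S : DGStr 𝒜 M} {T : DGStr 𝒜 N} {R : DGStr 𝒜 L} (ε : A →+* ℤ)

theorem precomp_mem_functionals {u : M →ₗ[Aᵐᵒᵖ] N} (e : ℤ × ℤ)
    (hu : ∀ g m, m ∈ S.deg g → u m ∈ T.deg (g + e)) {g : ℤ × ℤ} {f : N →+ ℚ}
    (hf : f ∈ T.functionals ε (g + e)) :
    precomp u.toAddMonoidHom f ∈ S.functionals ε g := by
  refine ⟨fun a m => ?_, fun h hh m hm => ?_⟩
  · rw [precomp_apply, precomp_apply]
    change f (u (op a • m)) = _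
    rw [map_smul, hf.1]
    rfl
  · exact hf.2 _ (fun h' => hh (add_right_cancel h')) _ (hu h m hm)

theorem IsMorphism.precomp_mem_functionals {u : M →ₗ[Aᵐᵒᵖ] N} (hu : IsMorphism S T u) {g : ℤ × ℤ}
    {f : N →+ ℚ} (hf : f ∈ T.functionals ε g) :
    precomp u.toAddMonoidHom f ∈ S.functionals ε g := by
  refine DGStr.precomp_mem_functionals (T := T) ε 0 (fun g m hm => ?_) (by rwa [add_zero])
  rw [add_zero]
  exact (isMorphism_iff.1 hu).1 g m hm

/-- The map on cohomology induced by a morphism. -/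
def pull {u : M →ₗ[Aᵐᵒᵖ] N} (hu : IsMorphism S T u) (g : ℤ × ℤ) :
    T.Cohomology ε g →ₗ[ℚ] S.Cohomology ε g :=
  Subquotient.map (precomp u.toAddMonoidHom)
    (fun f hf => ⟨hu.precomp_mem_functionals ε hf.1, fun m => by
      change f (u (S.d m)) = 0
      rw [← morphism_d hu, hf.2]⟩)
    (fun f ⟨k, hk, h⟩ => ⟨_, hu.precomp_mem_functionals ε hk, fun m => by
      change f (u m) = k (u (S.d m))
      rw [h, morphism_d hu]⟩)

variable {ε} in
/-- A cocycle becomes a coboundary after composition with a map that is homotopic to zero. -/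
theorem precomp_mem_coboundaries {u : M →ₗ[Aᵐᵒᵖ] N} (hu : u ∈ boundaries S T 0) {g : ℤ × ℤ}
    {f : N →+ ℚ} (hf : f ∈ T.cocycles ε g) :
    precomp u.toAddMonoidHom f ∈ S.coboundaries ε g := by
  obtain ⟨h, hh, hu⟩ := mem_boundaries_zero.1 hu
  refine ⟨precomp h.toAddMonoidHom f,
    DGStr.precomp_mem_functionals (T := T) ε (-1, 0) hh ?_, fun m => ?_⟩
  · have : g + (1, 0) + (-1, 0) = g := by ext <;> simp
    rw [this]
    exact hf.1
  · change f (u m) = f (h (S.d m))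
    rw [hu, map_add, hf.2, zero_add]

/-- Homotopy equivalent modules have isomorphic cohomology. -/
theorem IsHomotopyEquiv.exists_cohomologyEquiv {u : M →ₗ[Aᵐᵒᵖ] N} (hu : IsHomotopyEquiv S T u)
    (g : ℤ × ℤ) : Nonempty (T.Cohomology ε g ≃ₗ[ℚ] S.Cohomology ε g) := by
  obtain ⟨hu, v, hv, h1, h2⟩ := hu
  refine ⟨LinearEquiv.ofLinearMap (pull ε hu g) (pull ε hv g) (LinearMap.ext fun y => ?_)
    (LinearMap.ext fun y => ?_)⟩
  · obtain ⟨f, hf, rfl⟩ := y.exists_mk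
    exact Subquotient.mk_eq_mk.2 (by
      convert precomp_mem_coboundaries h1 hf using 1
      ext m
      change f (v (u m)) - f m = f (v (u m) - m)
      rw [map_sub])
  · obtain ⟨f, hf, rfl⟩ := y.exists_mk
    exact Subquotient.mk_eq_mk.2 (by
      convert precomp_mem_coboundaries h2 hf using 1
      ext m
      change f (u (v m)) - f m = f (u (v m) - m)
      rw [map_sub])

/-- The identity is null-homotopic, so every cocycle is a coboundary. -/
theorem subsingleton_cohomology (hS : S.IsProjective) (hS' : S.IsAcyclic) (g : ℤ × ℤ) :
    Subsingleton (S.Cohomology ε g) := by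
  refine ⟨fun y y' => ?_⟩
  obtain ⟨f, hf, rfl⟩ := y.exists_mk
  obtain ⟨f', hf', rfl⟩ := y'.exists_mk
  exact Subquotient.mk_eq_mk.2
    (precomp_mem_coboundaries (hS.mem_boundaries hS' (isMorphism_id S))
      (Submodule.sub_mem _ hf hf'))

/-! ### The long exact cohomology sequence of a mapping cone -/

section Cone

variable {u : M →ₗ[Aᵐᵒᵖ] N} (hu : IsMorphism S T u)

theorem precomp_snd_mem_functionals {g : ℤ × ℤ} {f : M →+ ℚ}
    (hf : f ∈ S.functionals ε (g + (1, 0))) :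
    precomp (LinearMap.snd Aᵐᵒᵖ N M).toAddMonoidHom f ∈ (cone S T u hu).functionals ε g :=
  DGStr.precomp_mem_functionals (T := S) ε (1, 0)
    (fun _ _ hx => ((mem_cone_deg hu).1 hx).2) hf

theorem precomp_fst_mem_functionals {g : ℤ × ℤ} {f : N →+ ℚ}
    (hf : f ∈ T.functionals ε g) :
    precomp (LinearMap.fst Aᵐᵒᵖ N M).toAddMonoidHom f ∈ (cone S T u hu).functionals ε g :=
  DGStr.precomp_mem_functionals (T := T) ε 0
    (fun g x hx => by rw [add_zero]; exact ((mem_cone_deg hu).1 hx).1) (by rwa [add_zero])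

theorem precomp_inr_mem_functionals {g : ℤ × ℤ} {f : N × M →+ ℚ}
    (hf : f ∈ (cone S T u hu).functionals ε g) :
    precomp (LinearMap.inr Aᵐᵒᵖ N M).toAddMonoidHom f ∈ S.functionals ε (g + (1, 0)) := by
  refine DGStr.precomp_mem_functionals (T := cone S T u hu) ε (-1, 0)
    (fun g x hx => (mem_cone_deg hu).2 ⟨AddSubgroup.zero_mem _, ?_⟩) ?_
  · have : g + (-1, 0) + (1, 0) = g := by ext <;> simp
    rw [this]
    exact hx
  · have : g + (1, 0) + (-1, 0) = g := by ext <;> simp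
    rw [this]
    exact hf

/-- The connecting map from the cohomology of the source to the cohomology of the cone. -/
def connecting (g : ℤ × ℤ) : S.Cohomology ε (g + (1, 0)) →ₗ[ℚ] (cone S T u hu).Cohomology ε g :=
  Subquotient.map (precomp (LinearMap.snd Aᵐᵒᵖ N M).toAddMonoidHom)
    (fun f hf => ⟨precomp_snd_mem_functionals ε hu hf.1, fun x => by
      rw [cone_d]
      change f (- S.d x.2) = 0
      rw [map_neg, hf.2, neg_zero]⟩)
    (fun f ⟨k, hk, h⟩ => ⟨-precomp (LinearMap.snd Aᵐᵒᵖ N M).toAddMonoidHom k,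
      Submodule.neg_mem _ (precomp_snd_mem_functionals ε hu hk), fun x => by
      rw [cone_d]
      change f x.2 = - k (- S.d x.2)
      rw [map_neg, neg_neg, h]⟩)

/-- If `f ∘ u = k ∘ d`, then `(n, m) ↦ f n + k m` is a cocycle on the cone that extends `f`.
Conversely, the restriction of a cocycle on the cone to `M` exhibits `f ∘ u` as a coboundary. -/
theorem exact_pull_pull (g : ℤ × ℤ) :
    Function.Exact (pull ε (isMorphism_inl hu) g) (pull ε hu g) := by
  intro y
  obtain ⟨f, hf, rfl⟩ := y.exists_mk
  constructor
  · intro h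
    obtain ⟨k, hk, h⟩ := Subquotient.mk_eq_zero.1 h
    refine ⟨Subquotient.mk (precomp (LinearMap.fst Aᵐᵒᵖ N M).toAddMonoidHom f +
      precomp (LinearMap.snd Aᵐᵒᵖ N M).toAddMonoidHom k)
      ⟨Submodule.add_mem _ (precomp_fst_mem_functionals ε hu hf.1)
        (precomp_snd_mem_functionals ε hu hk), fun x => ?_⟩, ?_⟩
    · rw [cone_d]
      have h1 : f (u x.2) = k (S.d x.2) := h x.2
      change f (T.d x.1 + u x.2) + k (- S.d x.2) = 0
      rw [map_add, hf.2, h1, map_neg, zero_add, add_neg_cancel]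
    · refine Subquotient.mk_eq_mk.2 ?_
      convert Submodule.zero_mem _
      ext m
      change f m + k 0 - f m = 0
      simp
  · rintro ⟨y, hy⟩
    obtain ⟨f', hf', rfl⟩ := y.exists_mk
    rw [← hy]
    refine Subquotient.mk_eq_zero.2 ⟨precomp (LinearMap.inr Aᵐᵒᵖ N M).toAddMonoidHom f',
      precomp_inr_mem_functionals ε hu hf'.1, fun m => ?_⟩
    change f' (u m, 0) = f' (0, S.d m)
    have h1 := hf'.2 (0, m)
    rw [cone_d, map_zero, zero_add] at h1
    have h2 : (u m, - S.d m) = ((u m, 0) - (0, S.d m) : N × M) := by simp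
    rwa [h2, map_sub, sub_eq_zero] at h1

/-- If `f ∘ snd` is `k` composed with the differential of the cone, then `k` restricts to a cocycle
on `N`, and the restriction of `k` to `M` is the coboundary that compares its pullback with `f`. -/
theorem exact_pull_connecting (g : ℤ × ℤ) :
    Function.Exact (pull ε hu (g + (1, 0))) (connecting ε hu g) := by
  intro y
  obtain ⟨f, hf, rfl⟩ := y.exists_mk
  constructor
  · intro h
    obtain ⟨k, hk, h⟩ := Subquotient.mk_eq_zero.1 h
    refine ⟨Subquotient.mk (precomp (LinearMap.inl Aᵐᵒᵖ N M).toAddMonoidHom k)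
      ⟨(isMorphism_inl hu).precomp_mem_functionals ε hk, fun n => ?_⟩, ?_⟩
    · have h1 := h (n, 0)
      rw [cone_d] at h1
      simp only [map_zero, add_zero, neg_zero] at h1
      exact h1.symm.trans (map_zero f)
    · refine Subquotient.mk_eq_mk.2 ⟨precomp (LinearMap.inr Aᵐᵒᵖ N M).toAddMonoidHom k,
        precomp_inr_mem_functionals ε hu hk, fun m => ?_⟩
      have h1 : f m = k ((cone S T u hu).d (0, m)) := h (0, m)
      rw [cone_d, map_zero, zero_add] at h1
      change k (u m, 0) - f m = k (0, S.d m)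
      rw [h1, ← map_sub]
      simp
  · rintro ⟨y, hy⟩
    obtain ⟨k, hk, rfl⟩ := y.exists_mk
    rw [← hy]
    refine Subquotient.mk_eq_zero.2 ⟨precomp (LinearMap.fst Aᵐᵒᵖ N M).toAddMonoidHom k,
      precomp_fst_mem_functionals ε hu hk.1, fun x => ?_⟩
    rw [cone_d]
    change k (u x.2) = k (T.d x.1 + u x.2)
    rw [map_add, hk.2, zero_add]

/-- If the restriction of `f` to `N` is `k ∘ d`, then `f` is cohomologous to a cocycle that lives on
`M` only, namely its restriction to `M` corrected by `k ∘ u`. -/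
theorem exact_connecting_pull (g : ℤ × ℤ) :
    Function.Exact (connecting ε hu g) (pull ε (isMorphism_inl hu) g) := by
  intro y
  obtain ⟨f, hf, rfl⟩ := y.exists_mk
  have hsplit : ∀ x, f x = f (x.1, 0) + f (0, x.2) := fun x => by
    rw [← map_add]
    simp
  constructor
  · intro h
    obtain ⟨k, hk, h⟩ := Subquotient.mk_eq_zero.1 h
    have h' : ∀ n, f (n, 0) = k (T.d n) := h
    have hd : ∀ m, f (u m, 0) = f (0, S.d m) := fun m => by
      have h1 := hf.2 (0, m)
      rw [cone_d, map_zero, zero_add] at h1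
      have h2 : (u m, - S.d m) = ((u m, 0) - (0, S.d m) : N × M) := by simp
      rwa [h2, map_sub, sub_eq_zero] at h1
    refine ⟨Subquotient.mk (precomp (LinearMap.inr Aᵐᵒᵖ N M).toAddMonoidHom f -
      precomp u.toAddMonoidHom k) ⟨Submodule.sub_mem _ (precomp_inr_mem_functionals ε hu hf.1)
        (hu.precomp_mem_functionals ε hk), fun m => ?_⟩, ?_⟩
    · change f (0, S.d m) - k (u (S.d m)) = 0
      rw [← hd, h', morphism_d hu, sub_self]
    · refine Subquotient.mk_eq_mk.2 ⟨-precomp (LinearMap.fst Aᵐᵒᵖ N M).toAddMonoidHom k,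
        Submodule.neg_mem _ (precomp_fst_mem_functionals ε hu hk), fun x => ?_⟩
      rw [cone_d]
      change f (0, x.2) - k (u x.2) - f x = - k (T.d x.1 + u x.2)
      rw [hsplit x, h', map_add]
      abel
  · rintro ⟨y, hy⟩
    obtain ⟨k, hk, rfl⟩ := y.exists_mk
    rw [← hy]
    refine Subquotient.mk_eq_zero.2 ?_
    convert Submodule.zero_mem _
    ext m
    exact map_zero k

end Cone

end Pull

/-! ### The Euler characteristic -/

/-- The total cohomology is finite dimensional. -/
structure IsFiniteType (S : DGStr 𝒜 M) (ε : A →+* ℤ) : Prop where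
  finiteDimensional : ∀ g, FiniteDimensional ℚ (S.Cohomology ε g)
  finite : (Function.support fun g => Module.finrank ℚ (S.Cohomology ε g)).Finite

/-- The graded Euler characteristic of the cohomology. -/
def euler (S : DGStr 𝒜 M) (ε : A →+* ℤ) : ℤ[T;T⁻¹] :=
  eulerSum fun g => Module.finrank ℚ (S.Cohomology ε g)

variable {S : DGStr 𝒜 M} {T : DGStr 𝒜 N} {ε : A →+* ℤ}

theorem IsHomotopyEquiv.finrank_cohomology {u : M →ₗ[Aᵐᵒᵖ] N} (hu : IsHomotopyEquiv S T u)
    (ε : A →+* ℤ) (g : ℤ × ℤ) :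
    Module.finrank ℚ (T.Cohomology ε g) = Module.finrank ℚ (S.Cohomology ε g) :=
  (hu.exists_cohomologyEquiv ε g).some.finrank_eq

theorem IsHomotopyEquiv.euler_eq {u : M →ₗ[Aᵐᵒᵖ] N} (hu : IsHomotopyEquiv S T u)
    (ε : A →+* ℤ) : T.euler ε = S.euler ε := by
  simp only [euler, hu.finrank_cohomology ε]

theorem IsFiniteType.of_isHomotopyEquiv (h : S.IsFiniteType ε) {u : M →ₗ[Aᵐᵒᵖ] N}
    (hu : IsHomotopyEquiv S T u) : T.IsFiniteType ε where
  finiteDimensional g := by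
    have := h.finiteDimensional g
    exact Module.Finite.equiv (hu.exists_cohomologyEquiv ε g).some.symm
  finite := by
    simp only [hu.finrank_cohomology ε]
    exact h.finite

theorem IsFiniteType.of_isAcyclic (hS : S.IsProjective) (hS' : S.IsAcyclic) (ε : A →+* ℤ) :
    S.IsFiniteType ε := by
  have h := subsingleton_cohomology ε hS hS'
  refine ⟨fun g => inferInstance, ?_⟩
  convert Set.finite_empty
  rw [Function.support_eq_empty_iff]
  funext g
  exact Module.finrank_zero_of_subsingleton

/-- The cohomology of `T` sits in an exact sequence between those of the cone and of `S`. The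
implication goes from the cone back to the target, as the induction over cells requires. -/
theorem IsFiniteType.of_cone {u : M →ₗ[Aᵐᵒᵖ] N} (hu : IsMorphism S T u) (hS : S.IsFiniteType ε)
    (hC : (cone S T u hu).IsFiniteType ε) : T.IsFiniteType ε := by
  have h1 := hS.finiteDimensional
  have h2 := hC.finiteDimensional
  have hfd : ∀ g, FiniteDimensional ℚ (T.Cohomology ε g) := fun g =>
    Module.Finite.of_exact (f := pull ε (isMorphism_inl hu) g) (g := (pull ε hu g).rangeRestrict)
      (LinearMap.exact_iff.2 (by
        rw [LinearMap.ker_rangeRestrict, LinearMap.exact_iff.1 (exact_pull_pull ε hu g)]))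
      (LinearMap.surjective_rangeRestrict _)
  refine ⟨hfd, (hS.finite.union hC.finite).subset fun g hg => ?_⟩
  by_contra hcon
  simp only [Set.mem_union, Function.mem_support, not_or, not_not] at hcon
  refine hg ?_
  have e := LinearMap.finrank_range_add_finrank_ker (pull ε hu g)
  rw [LinearMap.exact_iff.1 (exact_pull_pull ε hu g)] at e
  have e1 := Submodule.finrank_le (pull ε hu g).range
  have e2 := LinearMap.finrank_range_le (pull ε (isMorphism_inl hu) g)
  change Module.finrank ℚ (T.Cohomology ε g) = 0
  omega

theorem euler_cone {u : M →ₗ[Aᵐᵒᵖ] N} (hu : IsMorphism S T u) (hS : S.IsFiniteType ε)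
    (hT : T.IsFiniteType ε) (hC : (cone S T u hu).IsFiniteType ε) :
    T.euler ε = S.euler ε + (cone S T u hu).euler ε := by
  have h1 := hS.finiteDimensional
  have h2 := hT.finiteDimensional
  have h3 := hC.finiteDimensional
  exact eulerSum_of_exact (C := fun g => (cone S T u hu).Cohomology ε g)
    (N := fun g => T.Cohomology ε g) (M := fun g => S.Cohomology ε g) hT.finite hC.finite
    (pull ε (isMorphism_inl hu)) (pull ε hu) (connecting ε hu) (exact_pull_pull ε hu)
    (exact_pull_connecting ε hu) (exact_connecting_pull ε hu)

end DGStr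

theorem IsDistinguished.euler_eq {P₁ P₂ P₃ : Type u} [AddCommGroup P₁] [Module Aᵐᵒᵖ P₁]
    [AddCommGroup P₂] [Module Aᵐᵒᵖ P₂] [AddCommGroup P₃] [Module Aᵐᵒᵖ P₃] {S₁ : DGStr 𝒜 P₁}
    {S₂ : DGStr 𝒜 P₂} {S₃ : DGStr 𝒜 P₃} {f : P₁ →ₗ[Aᵐᵒᵖ] P₂} {g : P₂ →ₗ[Aᵐᵒᵖ] P₃}
    {h : P₃ →ₗ[Aᵐᵒᵖ] P₁} (H : IsDistinguished S₁ S₂ S₃ f g h) {ε : A →+* ℤ}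
    (h₁ : S₁.IsFiniteType ε) (h₂ : S₂.IsFiniteType ε) (h₃ : S₃.IsFiniteType ε) :
    S₂.euler ε = S₁.euler ε + S₃.euler ε := by
  obtain ⟨-, -, -, M, N, u, hu, a, b, c, ha, hb, hc, -⟩ := H
  rw [← ha.euler_eq, ← hb.euler_eq, ← hc.euler_eq]
  exact DGStr.euler_cone hu (h₁.of_isHomotopyEquiv ha) (h₂.of_isHomotopyEquiv hb)
    (h₃.of_isHomotopyEquiv hc)

end BigradedDG

namespace BigradedDG

open MulOpposite (op)

/-! ### The Grothendieck group of a triangular system -/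

variable {A : Type u} [Ring A] {𝒜 : DGAlg A}

namespace TriangularSystem

variable {V : Type u} [Fintype V] [PartialOrder V] (Θ : TriangularSystem 𝒜 V)

theorem functional_apply {v k : V} {s g : ℤ × ℤ} {f : idempotentModule (Θ.e k) →+ ℚ}
    (hf : f ∈ ((Θ.projStr k).shift s).functionals (Θ.ε v) g) (a : idempotentModule (Θ.e k)) :
    f a = Θ.ε v a • f (Θ.gen k) := by
  rw [← hf.1]
  congr 1
  exact Subtype.ext a.2.symm

theorem gen_mem_shift_deg (k : V) (s : ℤ × ℤ) : Θ.gen k ∈ ((Θ.projStr k).shift s).deg s := by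
  rw [DGStr.mem_shift_deg, sub_self]
  exact Θ.mem k

/-- A functional is determined by its value on the generator, which has degree `s` and on which `ε
v` vanishes for `v ≠ k`. -/
theorem functional_eq_zero {v k : V} {s g : ℤ × ℤ} (h : ¬ (v = k ∧ g = s))
    {f : idempotentModule (Θ.e k) →+ ℚ}
    (hf : f ∈ ((Θ.projStr k).shift s).functionals (Θ.ε v) g) : f = 0 := by
  have h0 : f (Θ.gen k) = 0 := by
    by_cases hv : v = k
    · exact hf.2 s (fun hs => h ⟨hv, hs.symm⟩) _ (Θ.gen_mem_shift_deg k s)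
    · have h1 := Θ.functional_apply hf (Θ.gen k)
      have h2 : Θ.ε v (Θ.gen k : A) = 0 := Θ.ε_of_ne hv
      rwa [h2, zero_smul] at h1
  ext a
  rw [Θ.functional_apply hf, h0, smul_zero]
  rfl

theorem subsingleton_cohomology_of_not {v k : V} {s g : ℤ × ℤ} (h : ¬ (v = k ∧ g = s)) :
    Subsingleton (((Θ.projStr k).shift s).Cohomology (Θ.ε v) g) := by
  refine ⟨fun y y' => ?_⟩
  obtain ⟨f, hf, rfl⟩ := y.exists_mk
  obtain ⟨f', hf', rfl⟩ := y'.exists_mk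
  refine Subquotient.mk_eq_mk.2 ?_
  rw [Θ.functional_eq_zero h hf.1, Θ.functional_eq_zero h hf'.1, sub_self]
  exact Submodule.zero_mem _

/-- The augmentation `ε k` itself is a cocycle and spans all functionals of degree `s`. There are no
nonzero coboundaries because there are no functionals of degree `s + (1, 0)`. -/
theorem finrank_cohomology_self (k : V) (s : ℤ × ℤ) :
    Module.finrank ℚ (((Θ.projStr k).shift s).Cohomology (Θ.ε k) s) = 1 := by
  have hd : ∀ a : idempotentModule (Θ.e k), Θ.ε k (((Θ.projStr k).shift s).d a : A) = 0 := by
    intro a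
    have h1 : Θ.ε k ((Θ.projStr k).d a : A) = 0 := Θ.ε_d k (a : A)
    rw [DGStr.shift_d]
    rcases Int.units_eq_one_or s.1.negOnePow with h | h
    · rw [h, one_smul, h1]
    · rw [h, Units.neg_smul, one_smul, NegMemClass.coe_neg, map_neg, h1, neg_zero]
  let f₀ : idempotentModule (Θ.e k) →+ ℚ :=
    { toFun := fun a => (Θ.ε k a : ℚ)
      map_zero' := by simp
      map_add' := fun a b => by simp }
  have hf₀ : f₀ ∈ ((Θ.projStr k).shift s).cocycles (Θ.ε k) s := by
    refine ⟨⟨fun a m => ?_, fun h hh m hm => ?_⟩, fun m => ?_⟩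
    · change ((Θ.ε k ((m : A) * a) : ℤ) : ℚ) = Θ.ε k a • ((Θ.ε k m : ℤ) : ℚ)
      rw [map_mul, mul_comm, zsmul_eq_mul, Int.cast_mul]
    · change ((Θ.ε k (m : A) : ℤ) : ℚ) = 0
      have hm' : (m : A) ∈ 𝒜.deg (h - s) := hm
      rw [Θ.ε_of_mem (sub_ne_zero.2 hh) hm', Int.cast_zero]
    · change ((Θ.ε k _ : ℤ) : ℚ) = 0
      rw [hd, Int.cast_zero]
  have hgen : f₀ (Θ.gen k) = 1 := by
    change ((Θ.ε k (Θ.e k) : ℤ) : ℚ) = 1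
    rw [Θ.ε_self, Int.cast_one]
  have hne : (Subquotient.mk f₀ hf₀ : ((Θ.projStr k).shift s).Cohomology (Θ.ε k) s) ≠ 0 := by
    intro h
    obtain ⟨j, hj, h⟩ := Subquotient.mk_eq_zero.1 h
    have hj0 := Θ.functional_eq_zero (v := k) (k := k) (s := s) (g := s + (1, 0)) (by simp) hj
    have h1 := h (Θ.gen k)
    rw [hj0, hgen] at h1
    exact one_ne_zero h1
  rw [finrank_eq_one_iff_of_nonzero' _ hne]
  intro w
  obtain ⟨f, hf, rfl⟩ := w.exists_mk
  refine ⟨f (Θ.gen k), ?_⟩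
  refine Subquotient.mk_eq_mk (hx := Submodule.smul_mem _ _ hf₀).2 ?_
  convert Submodule.zero_mem _
  ext a
  change f (Θ.gen k) * ((Θ.ε k a : ℤ) : ℚ) - f a = 0
  rw [Θ.functional_apply hf.1 a, zsmul_eq_mul, mul_comm, sub_self]

theorem finrank_cohomology [DecidableEq V] (v k : V) (s g : ℤ × ℤ) :
    Module.finrank ℚ (((Θ.projStr k).shift s).Cohomology (Θ.ε v) g) =
      if v = k ∧ g = s then 1 else 0 := by
  split_ifs with h
  · obtain ⟨rfl, rfl⟩ := h
    exact Θ.finrank_cohomology_self v g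
  · have := Θ.subsingleton_cohomology_of_not h
    exact Module.finrank_zero_of_subsingleton

theorem isFiniteType_projStr (v k : V) (s : ℤ × ℤ) :
    ((Θ.projStr k).shift s).IsFiniteType (Θ.ε v) := by
  classical
  refine ⟨fun g => ?_, (Set.finite_singleton s).subset fun g hg => ?_⟩
  · by_cases h : v = k ∧ g = s
    · refine Module.finite_of_finrank_pos ?_
      rw [Θ.finrank_cohomology, if_pos h]
      exact one_pos
    · have := Θ.subsingleton_cohomology_of_not h
      infer_instance
  · by_contra hne
    refine hg ?_
    simp only [Θ.finrank_cohomology]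
    rw [if_neg fun h => hne h.2]

theorem isFiniteType (P : Perf 𝒜) (v : V) : P.str.IsFiniteType (Θ.ε v) := by
  induction P using Θ.perf_induction with
  | acyclic P hP => exact DGStr.IsFiniteType.of_isAcyclic P.projective hP _
  | cell P k s x hx hdx h =>
    exact DGStr.IsFiniteType.of_cone
      (evalMap_isMorphism (Θ.mul_self k) (Θ.mem k) (Θ.d_eq k) hx hdx)
      (Θ.isFiniteType_projStr v k s) h

theorem euler_projStr [DecidableEq V] (v k : V) (n : ℤ) :
    ((Θ.projStr k).shift (0, n)).euler (Θ.ε v) = if v = k then LaurentPolynomial.T n else 0 := by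
  simp only [DGStr.euler, Θ.finrank_cohomology]
  split_ifs with h
  · simp only [h, true_and]
    exact eulerSum_single n
  · simp only [h, false_and, if_false]
    exact eulerSum_zero

/-- The Euler characteristic as a homomorphism on the Grothendieck group. -/
def eulerHom (v : V) : K0 𝒜 →+ ℤ[T;T⁻¹] :=
  QuotientAddGroup.lift (K0Relations 𝒜)
    (FreeAbelianGroup.lift fun P : Perf 𝒜 => P.str.euler (Θ.ε v)) (by
      rw [K0Relations, AddSubgroup.closure_le]
      rintro x ⟨P₁, P₂, P₃, f, g, h, H, rfl⟩
      change FreeAbelianGroup.lift _ _ = _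
      rw [map_sub, map_add, FreeAbelianGroup.lift_apply_of, FreeAbelianGroup.lift_apply_of,
        FreeAbelianGroup.lift_apply_of, H.euler_eq (Θ.isFiniteType P₁ v) (Θ.isFiniteType P₂ v)
          (Θ.isFiniteType P₃ v), sub_self])

theorem eulerHom_mk (v : V) (P : Perf 𝒜) : Θ.eulerHom v (K0.mk P) = P.str.euler (Θ.ε v) :=
  FreeAbelianGroup.lift_apply_of _ _

/-- The linear map that sends the basis vector of `v` to the class of `e v A`. -/
def classMap : (V →₀ ℤ[T;T⁻¹]) →ₗ[ℤ[T;T⁻¹]] K0 𝒜 :=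
  Finsupp.linearCombination ℤ[T;T⁻¹] fun v => K0.mk (Θ.proj v)

theorem classMap_single (v : V) (r : ℤ[T;T⁻¹]) :
    Θ.classMap (Finsupp.single v r) = r • K0.mk (Θ.proj v) :=
  Finsupp.linearCombination_single _ _ _

/-- The Euler characteristics are dual to the classes of the cells. Since `eulerHom` is only known
to be additive, the computation is reduced to integer multiples of monomials. -/
theorem eulerHom_classMap (v : V) (x : V →₀ ℤ[T;T⁻¹]) : Θ.eulerHom v (Θ.classMap x) = x v := by
  classical
  induction x using Finsupp.induction_linear with
  | zero => simp
  | add x y hx hy => rw [map_add, map_add, hx, hy, Finsupp.add_apply]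
  | single k r =>
    rw [classMap_single]
    induction r using LaurentPolynomial.induction_on' with
    | add p q hp hq => rw [add_smul, map_add, hp, hq, Finsupp.single_add, Finsupp.add_apply]
    | C_mul_T n a =>
      have h1 : (LaurentPolynomial.C a * LaurentPolynomial.T n : ℤ[T;T⁻¹]) =
          a • LaurentPolynomial.T n := by
        rw [← LaurentPolynomial.smul_eq_C_mul]
      rw [h1, smul_assoc, map_zsmul, K0.T_smul_mk, eulerHom_mk, Finsupp.single_apply]
      refine (congrArg (a • ·) (Θ.euler_projStr v k n)).trans ?_
      by_cases h : v = k
      · simp [h]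
      · simp [h, Ne.symm h]

theorem classMap_injective : Function.Injective Θ.classMap := by
  intro x y hxy
  ext1 v
  rw [← Θ.eulerHom_classMap v x, ← Θ.eulerHom_classMap v y, hxy]

/-- Attaching a cell changes the class by that of a shift of `e k A`, which is a signed monomial
times a basis class. -/
theorem mk_mem_range (P : Perf 𝒜) : K0.mk P ∈ LinearMap.range Θ.classMap := by
  induction P using Θ.perf_induction with
  | acyclic P hP =>
    rw [K0.mk_eq_zero_of_isAcyclic P hP]
    exact Submodule.zero_mem _
  | cell P k s x hx hdx h =>
    have hk : K0.mk (Θ.proj k) ∈ LinearMap.range Θ.classMap :=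
      ⟨Finsupp.single k 1, by rw [classMap_single, one_smul]⟩
    rw [K0.mk_cone ((Θ.proj k).shift s) P _
      (evalMap_isMorphism (Θ.mul_self k) (Θ.mem k) (Θ.d_eq k) hx hdx)]
    refine Submodule.add_mem _ ?_ h
    obtain ⟨m, n⟩ := s
    rw [K0.mk_shift, ← K0.T_smul_mk, Units.smul_def]
    exact zsmul_mem (Submodule.smul_mem _ _ hk) _

theorem classMap_surjective : Function.Surjective Θ.classMap := by
  intro x
  obtain ⟨y, rfl⟩ := QuotientAddGroup.mk'_surjective (K0Relations 𝒜) x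
  change QuotientAddGroup.mk' (K0Relations 𝒜) y ∈ LinearMap.range Θ.classMap
  induction y using FreeAbelianGroup.induction_on with
  | zero => exact Submodule.zero_mem _
  | of P => exact Θ.mk_mem_range P
  | neg P h => exact Submodule.neg_mem _ h
  | add x y hx hy => exact Submodule.add_mem _ hx hy

/-- The Grothendieck group is free on the classes of the modules `e v A`. -/
def classEquiv : (V →₀ ℤ[T;T⁻¹]) ≃ₗ[ℤ[T;T⁻¹]] K0 𝒜 :=
  LinearEquiv.ofBijective Θ.classMap ⟨Θ.classMap_injective, Θ.classMap_surjective⟩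

end TriangularSystem

/-! ### Quiver algebras of acyclic quivers -/

section Quiver

variable {V : Type u} [Quiver.{u} V]

/-- The vertices of an acyclic quiver, ordered by the existence of paths. -/
abbrev pathOrder (hacyclic : ∀ (v : V) (p : Quiver.Path v v), p.length = 0) : PartialOrder V where
  le v w := Nonempty (Quiver.Path v w)
  le_refl v := ⟨Quiver.Path.nil⟩
  le_trans := fun _ _ _ ⟨p⟩ ⟨q⟩ => ⟨p.comp q⟩
  le_antisymm := fun v w ⟨p⟩ ⟨q⟩ => by
    have h := hacyclic v (p.comp q)
    rw [Quiver.Path.length_comp] at h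
    exact Quiver.Path.eq_of_length_zero p (by omega)

/-! ### Idempotents and augmentations of path algebras -/

namespace PathAlgebra

theorem ofPath_mul [Fintype V] {a b c : V} (p : Quiver.Path a b) (q : Quiver.Path b c) :
    ofPath p * ofPath q = ofPath (p.comp q) := mulHom_comp p q

theorem ofPath_mul_of_ne [Fintype V] {a b c d : V} (p : Quiver.Path a b) (q : Quiver.Path c d)
    (h : b ≠ c) : ofPath p * ofPath q = 0 := mulHom_ne p q h

open Classical in
theorem nil_mul_ofPath_mul_nil [Fintype V] (v w : V) {a b : V} (p : Quiver.Path a b) :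
    ofPath (Quiver.Path.nil : Quiver.Path v v) * ofPath p *
      ofPath (Quiver.Path.nil : Quiver.Path w w) = if v = a ∧ b = w then ofPath p else 0 := by
  by_cases h : v = a
  · subst h
    rw [ofPath_mul, Quiver.Path.nil_comp]
    by_cases h' : b = w
    · subst h'
      rw [ofPath_mul, Quiver.Path.comp_nil]
      simp
    · rw [ofPath_mul_of_ne _ _ h', if_neg fun hh => h' hh.2]
  · rw [ofPath_mul_of_ne _ _ h, zero_mul, if_neg fun hh => h hh.1]

open Classical in
/-- The sum of the coefficients of the closed paths at `v`. -/
def closedCoeff (v : V) : PathAlgebra V →ₗ[ℤ] ℤ :=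
  Finsupp.linearCombination ℤ fun p => if p.1 = v ∧ p.2.1 = v then 1 else 0

open Classical in
theorem closedCoeff_ofPath (v : V) {a b : V} (p : Quiver.Path a b) :
    closedCoeff v (ofPath p) = if a = v ∧ b = v then 1 else 0 := by
  refine (Finsupp.linearCombination_single _ _ _).trans ?_
  rw [one_smul]

variable [Fintype V] (hacyclic : ∀ (v : V) (p : Quiver.Path v v), p.length = 0)

-- Acyclicity is what makes this multiplicative: without it a closed path at `v` could be a product
-- of two paths neither of which is closed at `v`.
include hacyclic in
theorem closedCoeff_mul (v : V) (x y : PathAlgebra V) :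
    closedCoeff v (x * y) = closedCoeff v x * closedCoeff v y := by
  classical
  induction x using induction_path with
  | h0 => simp
  | hadd a b ha hb => rw [add_mul, map_add, ha, hb, map_add, add_mul]
  | hneg a ha => rw [neg_mul, map_neg, ha, map_neg, neg_mul]
  | hp a b p =>
  induction y using induction_path with
  | h0 => simp
  | hadd a b ha hb => rw [mul_add, map_add, ha, hb, map_add, mul_add]
  | hneg a ha => rw [mul_neg, map_neg, ha, map_neg, mul_neg]
  | hp c d q =>
    rw [closedCoeff_ofPath, closedCoeff_ofPath]
    by_cases hbc : b = c
    · subst hbc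
      rw [ofPath_mul, closedCoeff_ofPath]
      by_cases h : a = v ∧ d = v
      · obtain ⟨rfl, rfl⟩ := h
        let := pathOrder hacyclic
        -- A closed path that factors through `b` makes `b` and its endpoint comparable in both
        -- directions.
        have hb : d = b := le_antisymm (⟨p⟩ : d ≤ b) (⟨q⟩ : b ≤ d)
        simp [← hb]
      · rw [if_neg h]
        by_cases ha : a = v <;> by_cases hd : d = v <;> simp_all
    · rw [ofPath_mul_of_ne _ _ hbc, map_zero]
      by_cases hb : b = v <;> by_cases hc : c = v <;> simp_all

theorem closedCoeff_one (v : V) : closedCoeff v 1 = 1 := by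
  classical
  change closedCoeff v (∑ w : V, ofPath (Quiver.Path.nil : Quiver.Path w w)) = 1
  rw [map_sum]
  simp only [closedCoeff_ofPath, and_self]
  simp

/-- The augmentation of the path algebra of an acyclic quiver at a vertex. -/
def augmentation (v : V) : PathAlgebra V →+* ℤ where
  toFun := closedCoeff v
  map_zero' := map_zero _
  map_add' := map_add _
  map_one' := closedCoeff_one v
  map_mul' := closedCoeff_mul hacyclic v

include hacyclic in
theorem closedCoeff_of_mem_positivePaths (v : V) {x : PathAlgebra V} (hx : x ∈ positivePaths V) :
    closedCoeff v x = 0 := by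
  classical
  induction hx using AddSubgroup.closure_induction with
  | mem x hx =>
    obtain ⟨a, b, p, hp, rfl⟩ := hx
    rw [closedCoeff_ofPath, if_neg]
    rintro ⟨rfl, rfl⟩
    have := hacyclic _ p
    omega
  | zero => exact map_zero _
  | add x y _ _ hx hy => rw [map_add, hx, hy, add_zero]
  | neg x _ hx => rw [map_neg, hx, neg_zero]

-- The only closed path at `v` is the trivial one, so the corner of the path algebra at `v` is a
-- copy of ℤ.
include hacyclic in
theorem nil_mul_mul_nil_self (v : V) (x : PathAlgebra V) :
    ofPath (Quiver.Path.nil : Quiver.Path v v) * x * ofPath (Quiver.Path.nil : Quiver.Path v v) =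
      closedCoeff v x • ofPath (Quiver.Path.nil : Quiver.Path v v) := by
  classical
  induction x using induction_path with
  | h0 => simp
  | hadd a b ha hb => rw [mul_add, add_mul, ha, hb, map_add, add_smul]
  | hneg a ha => rw [mul_neg, neg_mul, ha, map_neg, neg_smul]
  | hp a b p =>
    rw [nil_mul_ofPath_mul_nil, closedCoeff_ofPath]
    by_cases h : a = v ∧ b = v
    · obtain ⟨rfl, rfl⟩ := h
      have hp := hacyclic _ p
      rw [Quiver.Path.eq_nil_of_length_zero p hp]
      simp
    · rw [if_neg h, if_neg fun hh => h ⟨hh.1.symm, hh.2⟩, zero_smul]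

theorem nil_mul_mul_nil_of_isEmpty {v w : V} (h : ¬ Nonempty (Quiver.Path v w))
    (x : PathAlgebra V) :
    ofPath (Quiver.Path.nil : Quiver.Path v v) * x *
      ofPath (Quiver.Path.nil : Quiver.Path w w) = 0 := by
  classical
  induction x using induction_path with
  | h0 => simp
  | hadd a b ha hb => rw [mul_add, add_mul, ha, hb, add_zero]
  | hneg a ha => rw [mul_neg, neg_mul, ha, neg_zero]
  | hp a b p =>
    rw [nil_mul_ofPath_mul_nil, if_neg]
    rintro ⟨rfl, rfl⟩
    exact h ⟨p⟩

end PathAlgebra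

variable [Fintype V] (hacyclic : ∀ (v : V) (p : Quiver.Path v v), p.length = 0)
  {rel : Set (PathAlgebra V)} (hrel : rel ⊆ positivePaths V)

-- The augmentation sees only paths of length zero, hence kills the relations and descends to the
-- quotient.
include hrel in
theorem ringCon_span_le_ker (v : V) : (TwoSidedIdeal.span rel).ringCon ≤
    RingCon.ker (PathAlgebra.augmentation hacyclic v) := by
  have h : TwoSidedIdeal.span rel ≤ TwoSidedIdeal.ker (PathAlgebra.augmentation hacyclic v) :=
    TwoSidedIdeal.span_le.2 fun x hx =>
      (TwoSidedIdeal.mem_ker _).2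
        (PathAlgebra.closedCoeff_of_mem_positivePaths hacyclic v (hrel hx))
  exact TwoSidedIdeal.ringCon_le_iff.1 h

/-- The vertex idempotents of a quiver algebra of an acyclic quiver, with relations that involve
only paths of positive length. -/
def quiverSystem (𝒜 : DGAlg (QuiverAlgebra rel))
    (hdeg : ∀ v : V, vertexIdempotent rel v ∈ 𝒜.deg 0)
    (hd : ∀ v : V, 𝒜.d (vertexIdempotent rel v) = 0) :
    letI := pathOrder hacyclic
    TriangularSystem 𝒜 V :=
  letI := pathOrder hacyclic
  { e := vertexIdempotent rel
    mul_self := vertexIdempotent_mul_self rel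
    mul_of_ne := fun {v w} h => by
      rw [vertexIdempotent, vertexIdempotent, ← map_mul, PathAlgebra.ofPath_mul_of_ne _ _ h,
        map_zero]
    sum_eq := by
      simp only [vertexIdempotent]
      rw [← map_sum]
      exact map_one _
    mem := hdeg
    d_eq := hd
    mul_mul_of_not_le := fun {v w} h a => by
      obtain ⟨x, rfl⟩ := RingCon.mk'_surjective _ a
      rw [vertexIdempotent, vertexIdempotent, ← map_mul, ← map_mul,
        PathAlgebra.nil_mul_mul_nil_of_isEmpty h, map_zero]
    ε := fun v => RingCon.lift _ (PathAlgebra.augmentation hacyclic v)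
      (ringCon_span_le_ker hacyclic hrel v)
    mul_mul_self := fun v a => by
      obtain ⟨x, rfl⟩ := RingCon.mk'_surjective _ a
      rw [RingCon.lift_mk', vertexIdempotent, ← map_mul, ← map_mul,
        PathAlgebra.nil_mul_mul_nil_self hacyclic, map_zsmul]
      rfl
    ε_self := fun v => by
      classical
      rw [vertexIdempotent, RingCon.lift_mk']
      change PathAlgebra.closedCoeff v _ = 1
      rw [PathAlgebra.closedCoeff_ofPath]
      simp }

end Quiver

end BigradedDG

end

theorem theorem3p1 {V : Type u} [Quiver.{u} V] [Fintype V]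
    (hacyclic : ∀ (v : V) (p : Quiver.Path v v), p.length = 0)
    (rel : Set (PathAlgebra V))
    (hrel : rel ⊆ positivePaths V)
    (𝒜 : DGAlg (QuiverAlgebra rel))
    (hdeg : ∀ v : V, vertexIdempotent rel v ∈ 𝒜.deg 0)
    (hd : ∀ v : V, 𝒜.d (vertexIdempotent rel v) = 0) :
    ∃ φ : (V →₀ ℤ[T;T⁻¹]) ≃ₗ[ℤ[T;T⁻¹]] K0 𝒜,
      ∀ v : V, ∃ P : Perf 𝒜,
        P.toDGMod = idempotentDGMod 𝒜 (vertexIdempotent rel v)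
          (vertexIdempotent_mul_self rel v) (hdeg v) (hd v) ∧
        φ (Finsupp.single v 1) = K0.mk P := by
  let := pathOrder hacyclic
  let Θ := quiverSystem hacyclic hrel 𝒜 hdeg hd
  -- The module of `Θ.proj v` is by construction the one generated by the vertex idempotent.
  refine ⟨Θ.classEquiv, fun v => ⟨Θ.proj v, rfl, ?_⟩⟩
  exact (Θ.classMap_single v 1).trans (one_smul _ _)
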